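/- Let $K$ be an algebraically closed field of characteristic zero, let $Q$ be a finite quiver with vertex set $I$, and let $\overline{Q}$ be its double, obtained by adjoining a reverse arrow $a^*$ for each arrow $a$ of $Q$. Write $h(a)$, $t(a)$ for the head and tail of an arrow $a$. For $\alpha\in\mathbb{N}^I$ put $\alpha\cdot\alpha=\sum_{i\in I}\alpha_i^2$, $q(\alpha)=\sum_{i\in I}\alpha_i^2-\sum_{a\in Q}\alpha_{h(a)}\alpha_{t(a)}$ and $p(\alpha)=1-q(\alpha)$. Let $\mathrm{Rep}(\overline{Q},\alpha)=\bigoplus_{a\in\overline{Q}}\mathrm{Mat}(\alpha_{h(a)}\times\alpha_{t(a)},K)$, on which $\mathrm{GL}(\alpha)=\prod_{i\in I}\mathrm{GL}(\alpha_i,K)$ acts by conjugation, and let $\mu_\alpha:\mathrm{Rep}(\overline{Q},\alpha)\to\prod_{i\in I}\mathrm{Mat}(\alpha_i,K)$ be the map $$\mu_\alpha(x)_i=\sum_{a\in Q,\ h(a)=i}x_ax_{a^*}-\sum_{a\in Q,\ t(a)=i}x_{a^*}x_a .$$ The points of $\mu_\alpha^{-1}(0)$ are the representations of dimension vector $\alpha$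 of the preprojective algebra $\Pi=\Pi^0$ of $Q$. Let $\pi:\mu_\alpha^{-1}(0)\to N_Q(0,\alpha)=\mu_\alpha^{-1}(0)/\!\!/\mathrm{GL}(\alpha)$ be the affine quotient map, where $N_Q(0,\alpha)$ is the affine variety whose coordinate ring consists of the $\mathrm{GL}(\alpha)$-invariant regular functions on the variety $\mu_\alpha^{-1}(0)$; its points classify the isomorphism classes of semisimple representations of $\Pi$ of dimension vector $\alpha$. A point $x\in N_Q(0,\alpha)$ has representation type $(k_1,\beta^{(1)};\dots;k_r,\beta^{(r)})$ if there is $y\in\pi^{-1}(x)$ whose representation is isomorphic to $T_1^{k_1}\oplus\dots\oplus T_r^{k_r}$ with all $k_t\ge 1$ and with $T_1,\dots,T_r$ pairwise non-isomorphic simple representations of $\Pi$ of dimension vectors $\beta^{(1)},\dots,\beta^{(r)}$; the stratum of this type is the set of all such points $x$. (1) If $x\in N_Q(0,\alpha)$ has representation type $(k_1,\beta^{(1)};\dots;k_r,\beta^{(r)})$, then $$\dim\pi^{-1}(x)\le\alpha\cdot\alpha-1+p(\alpha)-\sum_{t=1}^r p(\beta^{(t)}).$$ (2) The inverse image in $\mu_\alpha^{-1}(0)$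 of the stratum of representation type $(k_1,\beta^{(1)};\dots;k_r,\beta^{(r)})$ has dimension at most $$\alpha\cdot\alpha-1+p(\alpha)+\sum_{t=1}^r p(\beta^{(t)}).$$ Here the dimension of a subset of $\mathrm{Rep}(\overline{Q},\alpha)$ is that of its Zariski closure, and the empty set has dimension $-\infty$. -/

import Mathlib

universe u v w w'

namespace QuiverReduction

section Forms

variable {I : Type u} [Fintype I] [Quiver.{v} I] [∀ i j : I, Fintype (i ⟶ j)]

/-- The quadratic form `q(a) = ∑ i, a i ^ 2 - ∑ (arrows e : i ⟶ j), a i * a j` of the quiver. -/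
def q (a : I → ℤ) : ℤ :=
  ∑ i, a i ^ 2 - ∑ i, ∑ j, ∑ _e : (i ⟶ j), a j * a i

/-- `p(a) = 1 - q(a)`, for a dimension vector `a`. -/
def p (a : I → ℕ) : ℤ := 1 - q fun i => (a i : ℤ)

/-- `a · a = ∑ i, a i ^ 2`. -/
def dotSelf (a : I → ℕ) : ℤ := ∑ i, (a i : ℤ) * (a i : ℤ)

end Forms

section Double

variable {I : Type u} [Quiver.{v} I]

/-- Arrows `i ⟶ j` of the double of the quiver: `Sum.inl e` is an arrow `e : i ⟶ j` of the quiver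
itself, and `Sum.inr e` is the reverse `e*` of an arrow `e : j ⟶ i` (so every loop also gets
a separate reverse). -/
abbrev DArrow (i j : I) : Type v := (i ⟶ j) ⊕ (j ⟶ i)

variable (K : Type w) [Field K]

/-- Representations of the double quiver on given vector spaces `V i`. -/
abbrev LinRep (V : I → Type w') [∀ i, AddCommGroup (V i)] [∀ i, Module K (V i)] :
    Type (max u v w') :=
  ∀ i j : I, DArrow i j → (V i →ₗ[K] V j)

variable {K}

namespace LinRep

variable {V W : I → Type w'} [∀ i, AddCommGroup (V i)] [∀ i, Module K (V i)]
  [∀ i, AddCommGroup (W i)] [∀ i, Module K (W i)]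

/-- Isomorphism of representations. -/
def Iso (x : LinRep K V) (y : LinRep K W) : Prop :=
  ∃ f : ∀ i, V i ≃ₗ[K] W i, ∀ (i j : I) (e : DArrow i j) (v : V i),
    f j (x i j e v) = y i j e (f i v)

/-- A simple representation: it is nonzero, and its only subrepresentations are `0` and itself. -/
def IsSimple (x : LinRep K V) : Prop :=
  (∃ i, Nontrivial (V i)) ∧
    ∀ U : ∀ i, Submodule K (V i),
      (∀ (i j : I) (e : DArrow i j), ∀ v ∈ U i, x i j e v ∈ U j) →
        (∀ i, U i = ⊥) ∨ (∀ i, U i = ⊤)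

/-- The direct sum `⨁ t, (T t)^(k t)`. -/
def sumPow {r : ℕ} (k : Fin r → ℕ) {V : Fin r → I → Type w'}
    [∀ t i, AddCommGroup (V t i)] [∀ t i, Module K (V t i)] (T : ∀ t, LinRep K (V t)) :
    LinRep K (fun i => (t : Fin r) → Fin (k t) → V t i) :=
  fun i j e => LinearMap.piMap fun t => LinearMap.piMap fun _ => T t i j e

end LinRep

variable (K)

/-- The affine space `Rep(Q̄, α)` of representations of the double quiver by matrices. -/
abbrev DRep (α : I → ℕ) : Type (max u v w) :=
  ∀ i j : I, DArrow i j → Matrix (Fin (α j)) (Fin (α i)) K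

/-- The group `GL(α) = ∏ i, GL(α i, K)`. -/
abbrev GLProd (α : I → ℕ) : Type (max u w) := ∀ i : I, GL (Fin (α i)) K

variable {K}

/-- The conjugation action of `GL(α)`: `(g x)_a = g_{h(a)} x_a g_{t(a)}⁻¹`. -/
def conj {α : I → ℕ} (g : GLProd K α) (x : DRep K α) : DRep K α :=
  fun i j e => (g j).1 * x i j e * (g i)⁻¹.1

/-- The representation on the column spaces `K^(α i)` given by a point of `Rep(Q̄, α)`. -/
def toLinRep {α : I → ℕ} (x : DRep K α) : LinRep K (fun i => Fin (α i) → K) :=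
  fun i j e => (x i j e).mulVecLin

/-- The coordinates on the affine space `Rep(Q̄, α)`: an arrow of the double, with a row and
a column index. -/
abbrev Coord (α : I → ℕ) : Type (max u v) :=
  Σ (i : I) (j : I) (_ : DArrow i j), Fin (α j) × Fin (α i)

/-- The coordinate vector of a point of `Rep(Q̄, α)`. -/
def coords {α : I → ℕ} (x : DRep K α) : Coord α → K :=
  fun c => x c.1 c.2.1 c.2.2.1 c.2.2.2.1 c.2.2.2.2

/-- The dimension of a (constructible) subset `S` of the affine space `Rep(Q̄, α)`:
the Krull dimension of the coordinate ring of the Zariski closure of `S`. It is `⊥` if `S = ∅`. -/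
noncomputable def dim {α : I → ℕ} (S : Set (DRep K α)) : WithBot ℕ∞ :=
  ringKrullDim (MvPolynomial (Coord α) K ⧸ MvPolynomial.vanishingIdeal K (coords '' S))

/-- The dimension of `S` is at most the integer `b`. -/
def DimLE {α : I → ℕ} (S : Set (DRep K α)) (b : ℤ) : Prop :=
  ∀ n : ℕ, (n : WithBot ℕ∞) ≤ dim S → (n : ℤ) ≤ b

end Double

section Moment

variable {I : Type u} [Fintype I] [Quiver.{v} I] [∀ i j : I, Fintype (i ⟶ j)]
variable {K : Type w} [Field K]

/-- The moment map `μ_α`, with `i`-th component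
`∑_{a, h(a) = i} x_a x_{a*} - ∑_{a, t(a) = i} x_{a*} x_a`. -/
def moment {α : I → ℕ} (x : DRep K α) (i : I) : Matrix (Fin (α i)) (Fin (α i)) K :=
  ∑ j, ∑ e : (j ⟶ i), x j i (Sum.inl e) * x i j (Sum.inr e) -
    ∑ j, ∑ e : (i ⟶ j), x j i (Sum.inr e) * x i j (Sum.inl e)

variable (K)

/-- The fibre `μ_α⁻¹(0)`; its points are the representations of dimension vector `α` of
the preprojective algebra. -/
def zeroFibre (α : I → ℕ) : Set (DRep K α) := {x | ∀ i, moment x i = 0}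

/-- The coordinate ring of the variety `μ_α⁻¹(0)`, as the algebra of its polynomial functions. -/
noncomputable def coordRing (α : I → ℕ) : Subalgebra K (zeroFibre K α → K) :=
  (MvPolynomial.aeval (R := K) fun (c : Coord α) (x : zeroFibre K α) => coords x.1 c).range

/-- The algebra of `GL(α)`-invariant polynomial functions on `μ_α⁻¹(0)`. -/
noncomputable def invRing (α : I → ℕ) : Subalgebra K (zeroFibre K α → K) where
  carrier := {f | f ∈ coordRing K α ∧
    ∀ (g : GLProd K α) (x y : zeroFibre K α), y.1 = conj g x.1 → f y = f x}
  mul_mem' := by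
    rintro a b ⟨ha, ha'⟩ ⟨hb, hb'⟩
    refine ⟨mul_mem ha hb, fun g x y h => ?_⟩
    simp only [Pi.mul_apply, ha' g x y h, hb' g x y h]
  add_mem' := by
    rintro a b ⟨ha, ha'⟩ ⟨hb, hb'⟩
    refine ⟨add_mem ha hb, fun g x y h => ?_⟩
    simp only [Pi.add_apply, ha' g x y h, hb' g x y h]
  algebraMap_mem' c := ⟨Subalgebra.algebraMap_mem _ c, fun _ _ _ _ => rfl⟩

/-- The (closed) points of the affine quotient variety `N_Q(0, α) = μ_α⁻¹(0) // GL(α)`, the affine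
variety whose coordinate ring is the algebra of invariants. -/
abbrev NQ (α : I → ℕ) : Type (max u v w) := invRing K α →ₐ[K] K

variable {K}

/-- The quotient map `π : μ_α⁻¹(0) → N_Q(0, α)`: a point is sent to evaluation of invariants
at that point. -/
noncomputable def quotMap {α : I → ℕ} (x : zeroFibre K α) : NQ K α :=
  (Pi.evalAlgHom K (fun _ : zeroFibre K α => K) x).comp (invRing K α).val

/-- The inverse image in `μ_α⁻¹(0)`, under the quotient map, of a set of points of `N_Q(0, α)`,
regarded as a subset of `Rep(Q̄, α)`. -/
def preimage {α : I → ℕ} (S : Set (NQ K α)) : Set (DRep K α) :=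
  Subtype.val '' (quotMap ⁻¹' S)

/-- `y` is a semisimple representation of the preprojective algebra isomorphic to
`⨁ t, (T t)^(k t)`, with multiplicities `k t > 0` and pairwise non-isomorphic simple
representations `T t` of the preprojective algebra, of dimension vectors `β t`. -/
def IsSemisimpleOfType {α : I → ℕ} (y : zeroFibre K α) {r : ℕ} (k : Fin r → ℕ)
    (β : Fin r → I → ℕ) : Prop :=
  (∀ t, 0 < k t) ∧
    ∃ T : ∀ t, DRep K (β t),
      (∀ t, T t ∈ zeroFibre K (β t)) ∧
      (∀ t, (toLinRep (T t)).IsSimple) ∧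
      (∀ s t, s ≠ t → ¬ (toLinRep (T s)).Iso (toLinRep (T t))) ∧
      (toLinRep y.1).Iso (LinRep.sumPow k fun t => toLinRep (T t))

/-- The stratum of representation type `(k_1, β_1; …; k_r, β_r)`: the points of `N_Q(0, α)`
whose corresponding semisimple representation has that type. -/
def stratum (α : I → ℕ) {r : ℕ} (k : Fin r → ℕ) (β : Fin r → I → ℕ) : Set (NQ K α) :=
  {ξ | ∃ y : zeroFibre K α, quotMap y = ξ ∧ IsSemisimpleOfType y k β}

end Moment

end QuiverReduction

/-!
The dimension of the Zariski closure of a set `Z` of representations is the transcendence degree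
over `K` of a generic point, and the generic point can be taken with coordinates in an ultrapower
`L` of `K` along an ultrafilter on `Z`, so that every first-order property of the points of `Z`
passes to it. Both parts thus bound the transcendence degree of a single representation `M` over
`L`.

A point of `μ⁻¹(0)` in the fibre over `T₁ ^ k₁ ⊕ ⋯ ⊕ Tᵣ ^ kᵣ` has the same trace functions as that
direct sum, hence a filtration whose layers are powers of the `Tₜ`, each layer being the largest
quotient of its kind. Reconstructing `M` layer by layer, transcendence degrees are bounded by
dimensions of tangent spaces, computed with derivations. The tangent spaces that occur are kernels
of the derivative of the moment map, which is dual under the trace pairing to `X ↦ X M - S X`, so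
their dimensions are governed by the dimensions of spaces of homomorphisms.

In part (1) the bricks `Tₜ` are constant. In part (2) they vary and contribute up to `2 p(βₜ)`
moduli each; to keep the choice of bases of the bricks from being counted as well, they are
replaced by conjugates under generic elements of `GL(βₜ)` in a second ultrapower.
-/

namespace QuiverReduction

/-! ### Transcendence degree and dimension -/

section Ultrapower

/-- `L` is the ultrapower of `K` along `U`, with `π` sending a family to its germ. -/
structure IsUltrapower {K : Type*} [Field K] {Ω : Type*} (U : Ultrafilter Ω) {L : Type*} [Field L]
    [Algebra K L] (π : (Ω → K) →ₐ[K] L) : Prop where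
  surjective : Function.Surjective π
  eq_zero_iff : ∀ f, π f = 0 ↔ ∀ᶠ ω in U, f ω = 0

theorem exists_isUltrapower (K : Type w) [Field K] {Ω : Type w'} (U : Ultrafilter Ω) :
    ∃ (L : Type (max w w')) (_ : Field L) (_ : Algebra K L) (π : (Ω → K) →ₐ[K] L),
      IsUltrapower U π := by
  let φ : (Ω → K) →+* Filter.Germ (U : Filter Ω) K := Filter.Germ.coeRingHom (U : Filter Ω)
  let _ : Algebra K (Filter.Germ (U : Filter Ω) K) := (φ.comp (algebraMap K (Ω → K))).toAlgebra
  exact ⟨Filter.Germ (U : Filter Ω) K, inferInstance, inferInstance,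
    { φ with commutes' := fun _ => rfl }, Quotient.mk_surjective, fun _ => Filter.Germ.coe_eq⟩

theorem exists_ultrafilter_eventually_aeval_ne_zero {K Ω J : Type*} [Field K] {f : J → Ω → K}
    (hf : AlgebraicIndependent K f) :
    ∃ U : Ultrafilter Ω, ∀ g : MvPolynomial J K, g ≠ 0 →
      ∀ᶠ ω in U, MvPolynomial.aeval f g ω ≠ 0 := by
  let 𝒮 : Set (Set Ω) :=
    {A | ∃ g : MvPolynomial J K, g ≠ 0 ∧ {ω | MvPolynomial.aeval f g ω ≠ 0} = A}
  suffices h𝒮 : ∀ T : Finset (Set Ω), (T : Set (Set Ω)) ⊆ 𝒮 → (⋂₀ (T : Set (Set Ω))).Nonempty by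
    obtain ⟨U, hU⟩ := Ultrafilter.exists_ultrafilter_of_finite_inter_nonempty 𝒮 h𝒮
    exact ⟨U, fun g hg => hU ⟨g, hg, rfl⟩⟩
  intro T hT
  have hT' : ∀ A ∈ T, ∃ g : MvPolynomial J K, g ≠ 0 ∧ {ω | MvPolynomial.aeval f g ω ≠ 0} = A :=
    fun A hA => hT hA
  choose! g hg hgT using hT'
  have hprod : MvPolynomial.aeval f (∏ A ∈ T, g A) ≠ 0 := fun h =>
    Finset.prod_ne_zero_iff.2 (fun A hA => hg A hA) ((injective_iff_map_eq_zero _).1 hf _ h)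
  obtain ⟨ω, hω⟩ := Function.ne_iff.1 hprod
  rw [map_prod, Finset.prod_apply, Pi.zero_apply, Finset.prod_ne_zero_iff] at hω
  exact ⟨ω, fun A hA => hgT A hA ▸ hω A hA⟩

theorem exists_isUltrapower_algebraicIndependent {K : Type w} [Field K] {Ω : Type w'} {J : Type*}
    {f : J → Ω → K} (hf : AlgebraicIndependent K f) :
    ∃ (U : Ultrafilter Ω) (L : Type (max w w')) (_ : Field L) (_ : Algebra K L)
      (π : (Ω → K) →ₐ[K] L), IsUltrapower U π ∧ AlgebraicIndependent K (fun j => π (f j)) := by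
  obtain ⟨U, hU⟩ := exists_ultrafilter_eventually_aeval_ne_zero hf
  obtain ⟨L, _, _, π, hπ⟩ := exists_isUltrapower K U
  refine ⟨U, L, _, _, π, hπ, (injective_iff_map_eq_zero _).2 fun g hg => ?_⟩
  by_contra hne
  rw [← MvPolynomial.comp_aeval_apply, hπ.eq_zero_iff] at hg
  obtain ⟨ω, h, h'⟩ := (hg.and (hU g hne)).exists
  exact h' h

end Ultrapower

section TranscendenceDegree

variable {K L : Type*} [Field K] [Field L] [Algebra K L] {X Y : Set L}

/-- The transcendence degree over `K` of the field generated by a subset of `L`, as the rank of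
the subset in the matroid of algebraic independence. -/
noncomputable abbrev trdegAdjoin (K : Type*) {L : Type*} [Field K] [Field L] [Algebra K L]
    (X : Set L) : ℕ∞ :=
  (AlgebraicIndependent.matroid K L).eRk X

open scoped IntermediateField.algebraAdjoinAdjoin in
theorem mem_matroid_closure_iff {a : L} :
    a ∈ (AlgebraicIndependent.matroid K L).closure X ↔
      IsAlgebraic (IntermediateField.adjoin K X) a := by
  rw [AlgebraicIndependent.matroid_closure_eq, SetLike.mem_coe, Subalgebra.mem_algebraicClosure]
  exact IsFractionRing.isAlgebraic_iff (Algebra.adjoin K X) (IntermediateField.adjoin K X) L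

theorem adjoin_subset_matroid_closure :
    (IntermediateField.adjoin K X : Set L) ⊆ (AlgebraicIndependent.matroid K L).closure X :=
  fun a ha => mem_matroid_closure_iff.2
    (isAlgebraic_algebraMap (⟨a, ha⟩ : IntermediateField.adjoin K X))

theorem trdegAdjoin_le_of_subset_closure
    (h : Y ⊆ (AlgebraicIndependent.matroid K L).closure X) : trdegAdjoin K Y ≤ trdegAdjoin K X :=
  (Matroid.eRk_mono _ h).trans_eq (Matroid.eRk_closure_eq _ _)

theorem trdegAdjoin_le_of_subset_adjoin (h : Y ⊆ IntermediateField.adjoin K X) :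
    trdegAdjoin K Y ≤ trdegAdjoin K X :=
  trdegAdjoin_le_of_subset_closure (h.trans adjoin_subset_matroid_closure)

theorem trdegAdjoin_range_of_algebraicIndependent {J : Type*} [Fintype J] {f : J → L}
    (hf : AlgebraicIndependent K f) : trdegAdjoin K (Set.range f) = Fintype.card J := by
  have hI : (AlgebraicIndependent.matroid K L).Indep (Set.range f) :=
    AlgebraicIndependent.matroid_indep_iff.2 hf.to_subtype_range
  rw [trdegAdjoin, hI.eRk_eq_encard, ← Set.image_univ, hf.injective.encard_image, Set.encard_univ,
    ENat.card_eq_coe_fintype_card]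

theorem trdegAdjoin_ne_top_of_finite (hX : X.Finite) : trdegAdjoin K X ≠ ⊤ :=
  ne_top_of_le_ne_top (Set.encard_ne_top_iff.2 hX) (Matroid.eRk_le_encard _ X)

theorem trdegAdjoin_eq_zero_of_subset_range (hX : X ⊆ Set.range (algebraMap K L)) :
    trdegAdjoin K X = 0 := by
  refine le_antisymm ((trdegAdjoin_le_of_subset_adjoin (X := ∅) (hX.trans ?_)).trans_eq
    (Matroid.eRk_empty _)) bot_le
  rintro _ ⟨c, rfl⟩
  exact IntermediateField.algebraMap_mem _ c

theorem trdegAdjoin_union_iUnion_le {τ : Type*} [Fintype τ] (X : Set L) (Y : τ → Set L) (c : τ → ℕ)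
    (h : ∀ t X', X ⊆ X' → trdegAdjoin K (X' ∪ Y t) ≤ trdegAdjoin K X' + c t) :
    trdegAdjoin K (X ∪ ⋃ t, Y t) ≤ trdegAdjoin K X + (∑ t, c t : ℕ) := by
  classical
  suffices key : ∀ s : Finset τ,
      trdegAdjoin K (X ∪ ⋃ t ∈ s, Y t) ≤ trdegAdjoin K X + (∑ t ∈ s, c t : ℕ) by
    simpa only [Finset.mem_univ, Set.iUnion_true] using key Finset.univ
  intro s
  induction s using Finset.induction_on with
  | empty => simp
  | insert t s hts ih =>
    calc trdegAdjoin K (X ∪ ⋃ t' ∈ insert t s, Y t')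
        = trdegAdjoin K ((X ∪ ⋃ t' ∈ s, Y t') ∪ Y t) := by
          rw [Finset.set_biUnion_insert, Set.union_assoc, Set.union_comm (Y t)]
      _ ≤ trdegAdjoin K (X ∪ ⋃ t' ∈ s, Y t') + c t := h t _ Set.subset_union_left
      _ ≤ trdegAdjoin K X + (∑ t' ∈ s, c t' : ℕ) + c t := by gcongr
      _ = trdegAdjoin K X + (∑ t' ∈ insert t s, c t' : ℕ) := by
          rw [Finset.sum_insert hts, add_comm (c t), Nat.cast_add, add_assoc]

section Tower

variable {L' : Type*} [Field L'] [Algebra K L'] [Algebra L L'] [IsScalarTower K L L']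

theorem trdegAdjoin_le_image_algebraMap (X : Set L) :
    trdegAdjoin K X ≤ trdegAdjoin K (algebraMap L L' '' X) := by
  obtain ⟨B, hB⟩ := (AlgebraicIndependent.matroid K L).exists_isBasis' X
  have hinj : Function.Injective (algebraMap L L') := (algebraMap L L').injective
  have hB' : (AlgebraicIndependent.matroid K L').Indep (algebraMap L L' '' B) := by
    have hind : AlgebraicIndependent K fun b : B => (b : L) :=
      AlgebraicIndependent.matroid_indep_iff.1 hB.indep
    have hmap := (hind.map' (f := IsScalarTower.toAlgHom K L L') hinj).to_subtype_range
    rw [Set.range_comp, Subtype.range_coe] at hmap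
    exact AlgebraicIndependent.matroid_indep_iff.2 hmap
  rw [trdegAdjoin, hB.eRk_eq_encard, ← hinj.encard_image, ← hB'.eRk_eq_encard]
  exact Matroid.eRk_mono _ (Set.image_mono hB.subset)

theorem trdegAdjoin_add_card_le {J : Type*} [Fintype J] {y : J → L'}
    (hy : AlgebraicIndependent L y) {X : Set L'} (hX : X ⊆ Set.range (algebraMap L L')) :
    trdegAdjoin K X + Fintype.card J ≤ trdegAdjoin K (X ∪ Set.range y) := by
  obtain ⟨B, hB⟩ := (AlgebraicIndependent.matroid K L').exists_isBasis' X
  have hindB : AlgebraicIndependent K fun b : B => (b : L') :=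
    AlgebraicIndependent.matroid_indep_iff.1 hB.indep
  have hind := hindB.sumElim_of_tower (S := L)
    (Subtype.range_coe.trans_subset (hB.subset.trans hX)) hy
  have hsub : Set.range (Sum.elim y ((↑) : B → L')) ⊆ X ∪ Set.range y := by
    rw [Set.Sum.elim_range, Subtype.range_coe, Set.union_comm]
    exact Set.union_subset_union_left _ hB.subset
  refine le_trans (le_of_eq ?_) (Matroid.eRk_mono _ hsub)
  rw [trdegAdjoin, hB.eRk_eq_encard,
    (AlgebraicIndependent.matroid_indep_iff.2 hind.to_subtype_range).eRk_eq_encard,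
    ← Set.image_univ, hind.injective.encard_image, Set.encard_univ, ENat.card_sum, add_comm,
    ENat.card_eq_coe_fintype_card]
  rfl

end Tower

end TranscendenceDegree

section KrullDimension

theorem ringKrullDim_le_of_isIntegral (R S : Type*) [CommRing R] [CommRing S] [Algebra R S]
    [Algebra.IsIntegral R S] : ringKrullDim S ≤ ringKrullDim R :=
  Order.krullDim_le_of_strictMono (PrimeSpectrum.comap (algebraMap R S))
    fun _ _ h => Ideal.IsIntegral.comap_lt_comap h

theorem exists_algebraicIndependent_of_le_ringKrullDim {K R : Type*} [Field K] [CommRing R]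
    [Algebra K R] [Algebra.FiniteType K R] {n : ℕ} (hn : (n : WithBot ℕ∞) ≤ ringKrullDim R) :
    ∃ f : Fin n → R, AlgebraicIndependent K f := by
  have : Nontrivial R := by
    by_contra hR
    rw [not_nontrivial_iff_subsingleton] at hR
    rw [ringKrullDim_eq_bot_of_subsingleton] at hn
    exact absurd hn (WithBot.not_coe_le_bot _)
  obtain ⟨s, g, hg, hint⟩ := exists_integral_inj_algHom_of_fg K R
  let _ := g.toRingHom.toAlgebra
  have : Algebra.IsIntegral (MvPolynomial (Fin s) K) R := ⟨hint⟩
  have hdim : ringKrullDim (MvPolynomial (Fin s) K) = s := by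
    rw [MvPolynomial.ringKrullDim_of_isNoetherianRing, ringKrullDim_eq_zero_of_field, zero_add,
      Nat.card_eq_fintype_card, Fintype.card_fin]
  have hns : n ≤ s := by
    have := hn.trans (ringKrullDim_le_of_isIntegral (MvPolynomial (Fin s) K) R)
    exact_mod_cast this.trans_eq hdim
  exact ⟨_, ((MvPolynomial.algebraicIndependent_X (Fin s) K).map' hg).comp _
    (Fin.castLE_injective hns)⟩

theorem exists_algebraicIndependent_aeval {K Ω ι : Type*} [Field K] [Finite ι] (x : Ω → ι → K)
    {n : ℕ} (hn : (n : WithBot ℕ∞) ≤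
      ringKrullDim (MvPolynomial ι K ⧸ MvPolynomial.vanishingIdeal K (Set.range x))) :
    ∃ g : Fin n → MvPolynomial ι K,
      AlgebraicIndependent K fun j => MvPolynomial.aeval (fun i ω => x ω i) (g j) := by
  let ev : MvPolynomial ι K →ₐ[K] (Ω → K) := MvPolynomial.aeval fun i ω => x ω i
  have hker (g) : g ∈ MvPolynomial.vanishingIdeal K (Set.range x) ↔ ev g = 0 := by
    have hev (ω) : ev g ω = MvPolynomial.aeval (x ω) g :=
      MvPolynomial.comp_aeval_apply (fun i ω => x ω i) (Pi.evalAlgHom K (fun _ : Ω => K) ω) g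
    simp only [MvPolynomial.mem_vanishingIdeal_iff, funext_iff, hev, Set.forall_mem_range,
      Pi.zero_apply]
  let evq := Ideal.Quotient.liftₐ _ ev fun g hg => (hker g).1 hg
  have hinj : Function.Injective evq := by
    refine (injective_iff_map_eq_zero _).2 fun g hg => ?_
    obtain ⟨g, rfl⟩ := Ideal.Quotient.mk_surjective g
    exact Ideal.Quotient.eq_zero_iff_mem.2 ((hker g).2 hg)
  obtain ⟨f, hf⟩ := exists_algebraicIndependent_of_le_ringKrullDim (K := K) hn
  choose g hg using fun j => Ideal.Quotient.mk_surjective (f j)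
  obtain rfl : f = fun j => Ideal.Quotient.mk _ (g j) := funext fun j => (hg j).symm
  exact ⟨g, hf.map' (f := evq) hinj⟩

/-- In a suitable ultrapower, the germ of the identity parametrization is a generic point of
a component of maximal dimension of the Zariski closure. -/
theorem exists_isUltrapower_le_trdegAdjoin {K : Type w} [Field K] {Ω : Type w'} {ι : Type*}
    [Finite ι] (x : Ω → ι → K) {n : ℕ} (hn : (n : WithBot ℕ∞) ≤
      ringKrullDim (MvPolynomial ι K ⧸ MvPolynomial.vanishingIdeal K (Set.range x))) :
    ∃ (U : Ultrafilter Ω) (L : Type (max w w')) (_ : Field L) (_ : Algebra K L)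
      (π : (Ω → K) →ₐ[K] L), IsUltrapower U π ∧
      (n : ℕ∞) ≤ trdegAdjoin K (Set.range fun i => π fun ω => x ω i) := by
  obtain ⟨g, hg⟩ := exists_algebraicIndependent_aeval x hn
  obtain ⟨U, L, _, _, π, hπ, hind⟩ := exists_isUltrapower_algebraicIndependent hg
  refine ⟨U, L, _, _, π, hπ, ?_⟩
  rw [← Fintype.card_fin n, ← trdegAdjoin_range_of_algebraicIndependent hind]
  refine trdegAdjoin_le_of_subset_adjoin (Set.range_subset_iff.2 fun j => ?_)
  refine IntermediateField.algebra_adjoin_le_adjoin K _ ?_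
  rw [Algebra.adjoin_range_eq_range_aeval]
  exact ⟨g j, (MvPolynomial.comp_aeval_apply _ π (g j)).symm⟩

theorem exists_isUltrapower_of_le_dim {I : Type u} [Finite I] [Quiver.{v} I]
    [∀ i j : I, Finite (i ⟶ j)] {K : Type w} [Field K] {α : I → ℕ} {S : Set (DRep K α)} {n : ℕ}
    (hn : (n : WithBot ℕ∞) ≤ dim S) :
    ∃ (U : Ultrafilter S) (L : Type (max u v w)) (_ : Field L) (_ : Algebra K L)
      (π : (S → K) →ₐ[K] L), IsUltrapower U π ∧
      (n : ℕ∞) ≤ trdegAdjoin K (Set.range fun c : Coord α => π fun s => coords s.1 c) :=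
  exists_isUltrapower_le_trdegAdjoin (fun s : S => coords s.1)
    (by rwa [dim, Set.image_eq_range] at hn)

end KrullDimension

section TangentSpace

theorem exists_finset_card_le_finrank {L ι : Type*} [Field L] [Finite ι]
    (V : Submodule L (ι → L)) :
    ∃ σ : Finset ι, σ.card ≤ Module.finrank L V ∧ ∀ v ∈ V, (∀ i ∈ σ, v i = 0) → v = 0 := by
  classical
  let φ : ι → Module.Dual L V := fun i => (LinearMap.proj i).comp V.subtype
  obtain ⟨κ, a, ha, hspan, hli⟩ := exists_linearIndependent' L φ
  have : Finite κ := Finite.of_injective a ha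
  have := Fintype.ofFinite κ
  refine ⟨Finset.univ.image a, ?_, fun v hv h => funext fun i => ?_⟩
  · rw [Finset.card_image_of_injective _ ha, Finset.card_univ, ← Subspace.dual_finrank_eq]
    exact hli.fintype_card_le_finrank
  · have hle : Submodule.span L (Set.range φ) ≤ LinearMap.ker (Module.Dual.eval L V ⟨v, hv⟩) := by
      rw [← hspan, Submodule.span_le]
      rintro _ ⟨k, rfl⟩
      exact h (a k) (Finset.mem_image_of_mem _ (Finset.mem_univ k))
    exact hle (Submodule.subset_span ⟨i, rfl⟩)

theorem derivation_adjoin_eq_zero {F L M : Type*} [Field F] [Field L] [Algebra F L] {s : Set L}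
    [AddCommGroup M] [Module F M] [Module (IntermediateField.adjoin F s) M]
    (D : Derivation F (IntermediateField.adjoin F s) M)
    (h : ∀ a : IntermediateField.adjoin F s, (a : L) ∈ s → D a = 0) : D = 0 := by
  ext ⟨a, ha⟩
  induction ha using IntermediateField.adjoin_induction with
  | mem a ha => exact h _ ha
  | algebraMap a => exact D.map_algebraMap a
  | add a b ha hb h₁ h₂ =>
    have := D.map_add ⟨a, ha⟩ ⟨b, hb⟩
    rwa [h₁, h₂, Derivation.coe_zero, Pi.zero_apply, Pi.zero_apply, add_zero] at this
  | mul a b ha hb h₁ h₂ =>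
    have := D.leibniz ⟨a, ha⟩ ⟨b, hb⟩
    rwa [h₁, h₂, Derivation.coe_zero, Pi.zero_apply, Pi.zero_apply, smul_zero, smul_zero,
      add_zero] at this
  | inv a ha h₁ =>
    have := D.leibniz_inv ⟨a, ha⟩
    rwa [h₁, Derivation.coe_zero, Pi.zero_apply, smul_zero] at this

theorem isAlgebraic_of_derivation_eq_zero {F E : Type*} [Field F] [Field E] [Algebra F E]
    [Algebra.EssFiniteType F E] (h : ∀ D : Derivation F E E, D = 0) : Algebra.IsAlgebraic F E := by
  have : Algebra.FormallyUnramified F E := by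
    refine ⟨subsingleton_of_forall_eq 0 fun ω => ?_⟩
    rw [← Module.forall_dual_apply_eq_zero_iff E]
    intro φ
    have hφ : φ = 0 := (KaehlerDifferential.linearMapEquivDerivation F E).injective
      ((h _).trans (map_zero _).symm)
    rw [hφ, LinearMap.zero_apply]
  have := Algebra.FormallyUnramified.isSeparable F E
  infer_instance

variable {K L : Type*} [Field K] [Field L] [Algebra K L]

/-- Once the coordinates in `σ` are adjoined, no derivation moves the remaining ones. -/
theorem isAlgebraic_adjoin_union_image {ι : Type*} [Finite ι] (X : Set L) (x : ι → L) (σ : Set ι)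
    (hσ : ∀ (E : IntermediateField K L) (D : Derivation K E L), X ⊆ E →
      (∀ a : E, (a : L) ∈ X → D a = 0) → ∀ x' : ι → E, (∀ i, (x' i : L) = x i) →
        (∀ i ∈ σ, D (x' i) = 0) → ∀ i, D (x' i) = 0) (i : ι) :
    IsAlgebraic (IntermediateField.adjoin K (X ∪ x '' σ)) (x i) := by
  set E₀ := IntermediateField.adjoin K (X ∪ x '' σ)
  let E := IntermediateField.adjoin E₀ (Set.range x)
  have hE₀ : X ∪ x '' σ ⊆ E₀ := IntermediateField.subset_adjoin _ _
  have hx (i) : x i ∈ E := IntermediateField.subset_adjoin _ _ ⟨i, rfl⟩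
  have : Algebra.EssFiniteType E₀ E :=
    IntermediateField.essFiniteType_iff.2 (IntermediateField.fg_def.2 ⟨_, Set.finite_range x, rfl⟩)
  have halg : Algebra.IsAlgebraic E₀ E := by
    refine isAlgebraic_of_derivation_eq_zero fun D => derivation_adjoin_eq_zero D ?_
    rintro ⟨_, ha⟩ ⟨i, rfl⟩
    let D' : Derivation K (E.restrictScalars K) L :=
      ((Algebra.linearMap E L).compDer D).restrictScalars K
    have hD' (a : E) (ha : (a : L) ∈ E₀) : D' a = 0 :=
      ((Algebra.linearMap E L).compDer D).map_algebraMap ⟨a, ha⟩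
    refine (map_eq_zero (algebraMap E L)).1 (hσ (E.restrictScalars K) D'
      (fun a ha => E.algebraMap_mem ⟨a, hE₀ (Or.inl ha)⟩) (fun a ha => hD' a (hE₀ (Or.inl ha)))
      (fun i => ⟨x i, hx i⟩) (fun _ => rfl)
      (fun i hi => hD' _ (hE₀ (Or.inr (Set.mem_image_of_mem x hi)))) i)
  exact (halg.isAlgebraic ⟨x i, hx i⟩).algebraMap (A := L)

theorem trdegAdjoin_union_range_le {ι : Type*} [Finite ι] (X : Set L) (x : ι → L)
    (V : Submodule L (ι → L))
    (hV : ∀ (E : IntermediateField K L) (D : Derivation K E L), X ⊆ E →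
      (∀ a : E, (a : L) ∈ X → D a = 0) → ∀ x' : ι → E, (∀ i, (x' i : L) = x i) →
        (fun i => D (x' i)) ∈ V) :
    trdegAdjoin K (X ∪ Set.range x) ≤ trdegAdjoin K X + Module.finrank L V := by
  classical
  obtain ⟨σ, hσ, hσV⟩ := exists_finset_card_le_finrank V
  have halg := isAlgebraic_adjoin_union_image X x σ fun E D hX hD x' hx' h i =>
    congrFun (hσV _ (hV E D hX hD x' hx') h) i
  have hcl : X ∪ Set.range x ⊆ (AlgebraicIndependent.matroid K L).closure (X ∪ x '' σ) :=
    Set.union_subset ((Set.subset_union_left.trans (IntermediateField.subset_adjoin _ _)).trans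
      adjoin_subset_matroid_closure)
      (Set.range_subset_iff.2 fun i => mem_matroid_closure_iff.2 (halg i))
  calc trdegAdjoin K (X ∪ Set.range x) ≤ trdegAdjoin K (X ∪ x '' σ) :=
        trdegAdjoin_le_of_subset_closure hcl
    _ ≤ trdegAdjoin K X + (x '' σ).encard := Matroid.eRk_union_le_eRk_add_encard _ _ _
    _ ≤ trdegAdjoin K X + Module.finrank L V := by
        gcongr
        refine (Set.encard_image_le _ _).trans ?_
        rw [Set.encard_coe_eq_coe_finsetCard]
        exact_mod_cast hσ

end TangentSpace

section Matrices

variable {K L : Type*} [Field K] [Field L] [Algebra K L]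

theorem exists_mul_submatrix_eq_one {m : ℕ} {ι : Type*} [Finite ι]
    (b : Matrix (Fin m) ι L) (hb : LinearIndependent L b.row) :
    ∃ (g : GL (Fin m) L) (a : Fin m → ι), Function.Injective a ∧
      (g.1 * b).submatrix id a = 1 := by
  classical
  have := Fintype.ofFinite ι
  obtain ⟨κ, a, ha, hspan, hli⟩ := exists_linearIndependent' L b.col
  have : Finite κ := Finite.of_injective a ha
  have := Fintype.ofFinite κ
  have hcard : Fintype.card κ = m := by
    rw [← finrank_span_eq_card hli, hspan, ← Matrix.rank_eq_finrank_span_cols, hb.rank_matrix,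
      Fintype.card_fin]
  let e : Fin m ≃ κ := (Fintype.equivFinOfCardEq hcard).symm
  have hu : IsUnit (b.submatrix id (a ∘ e)) := by
    rw [← Matrix.isUnit_transpose, ← Matrix.linearIndependent_rows_iff_isUnit]
    exact hli.comp e e.injective
  obtain ⟨u, hu⟩ := hu
  refine ⟨u⁻¹, a ∘ e, ha.comp e.injective, ?_⟩
  rw [Matrix.submatrix_mul _ _ _ id _ Function.bijective_id, Matrix.submatrix_id_id, ← hu,
    Units.inv_mul]

theorem trdegAdjoin_union_echelon_le {ι : Type*} [Fintype ι] {m : ℕ} (X : Set L)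
    (b : Matrix (Fin m) ι L) {a : Fin m → ι} (ha : Function.Injective a)
    (hb : b.submatrix id a = 1) :
    trdegAdjoin K (X ∪ ⋃ k, Set.range (b k)) ≤
      trdegAdjoin K X + (m * (Fintype.card ι - m) : ℕ) := by
  classical
  let T : Finset (Fin m × ι) := Finset.univ ×ˢ (Finset.univ.image a)ᶜ
  let f : Fin m × ι → L := fun c => b c.1 c.2
  have hT : T.card = m * (Fintype.card ι - m) := by
    rw [Finset.card_product, Finset.card_univ, Fintype.card_fin, Finset.card_compl,
      Finset.card_image_of_injective _ ha, Finset.card_univ, Fintype.card_fin]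
  have hsub : X ∪ ⋃ k, Set.range (b k) ⊆ IntermediateField.adjoin K (X ∪ f '' T) := by
    have hadj := IntermediateField.subset_adjoin K (X ∪ f '' T)
    refine Set.union_subset (Set.subset_union_left.trans hadj)
      (Set.iUnion_subset fun k => Set.range_subset_iff.2 fun i => ?_)
    by_cases hi : ∃ j, a j = i
    · obtain ⟨j, rfl⟩ := hi
      rw [show b k (a j) = (1 : Matrix (Fin m) (Fin m) L) k j from congrFun (congrFun hb k) j,
        Matrix.one_apply]
      split_ifs
      exacts [one_mem _, zero_mem _]
    · exact hadj (Or.inr ⟨(k, i), by simpa [T] using hi, rfl⟩)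
  calc trdegAdjoin K (X ∪ ⋃ k, Set.range (b k)) ≤ trdegAdjoin K (X ∪ f '' T) :=
        trdegAdjoin_le_of_subset_adjoin hsub
    _ ≤ trdegAdjoin K X + (f '' T).encard := Matroid.eRk_union_le_eRk_add_encard _ _ _
    _ ≤ trdegAdjoin K X + (m * (Fintype.card ι - m) : ℕ) := by
        gcongr
        refine (Set.encard_image_le _ _).trans ?_
        rw [Set.encard_coe_eq_coe_finsetCard, hT]

theorem map_derivation_mul {E : IntermediateField K L} (D : Derivation K E L) {l m n : Type*}
    [Fintype m] (A : Matrix l m E) (B : Matrix m n E) :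
    (A * B).map D = A.map (algebraMap E L) * B.map D + A.map D * B.map (algebraMap E L) := by
  ext i j
  simp only [Matrix.map_apply, Matrix.mul_apply, Matrix.add_apply, map_sum, Derivation.leibniz,
    Finset.sum_add_distrib, Algebra.smul_def, mul_comm]

theorem matrix_mul_mem {F : IntermediateField K L} {l m n : Type*} [Fintype m] {A : Matrix l m L}
    {B : Matrix m n L} (hA : ∀ x y, A x y ∈ F) (hB : ∀ x y, B x y ∈ F) (x y) :
    (A * B) x y ∈ F := by
  rw [Matrix.mul_apply]
  exact sum_mem fun z _ => mul_mem (hA x z) (hB z y)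

end Matrices

/-! ### Matrix representations and the moment map -/

section Vertices

variable {I : Type u}

/-- Families of matrices `K^(β i) → K^(α i)` attached to the vertices. -/
abbrev VMat (L : Type w) (α β : I → ℕ) : Type (max u w) :=
  ∀ i : I, Matrix (Fin (α i)) (Fin (β i)) L

/-- Coordinates on `VMat L α β`. -/
abbrev VCoord (α β : I → ℕ) : Type u := Σ i : I, Fin (α i) × Fin (β i)

/-- The coordinate vector of a family of vertex matrices. -/
def VMat.entries {L : Type w} {α β : I → ℕ} (X : VMat L α β) : VCoord α β → L :=
  fun c => X c.1 c.2.1 c.2.2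

/-- `VMat.entries` as a linear equivalence. -/
def VMat.entriesEquiv (L : Type w) [Field L] (α β : I → ℕ) :
    VMat L α β ≃ₗ[L] (VCoord α β → L) where
  toFun := VMat.entries
  invFun f := fun i => Matrix.of fun a b => f ⟨i, a, b⟩
  map_add' _ _ := rfl
  map_smul' _ _ := rfl
  left_inv _ := rfl
  right_inv _ := rfl

variable [Fintype I]

/-- The number of coordinates of `VMat L α β`. -/
def vertDim (α β : I → ℕ) : ℕ := ∑ i, α i * β i

theorem finrank_vMat {L : Type w} [Field L] {α β : I → ℕ} :
    Module.finrank L (VMat L α β) = vertDim α β := by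
  simp only [Module.finrank_pi_fintype, Module.finrank_matrix, Fintype.card_fin,
    Module.finrank_self, mul_one, vertDim]

theorem card_vCoord {α β : I → ℕ} : Fintype.card (VCoord α β) = vertDim α β := by
  simp only [Fintype.card_sigma, Fintype.card_prod, Fintype.card_fin, vertDim]

theorem vertDim_comm {α β : I → ℕ} : vertDim α β = vertDim β α := by
  simp only [vertDim, mul_comm]

theorem vertDim_add_mul (m : ℕ) (α β : I → ℕ) :
    vertDim β (fun i => α i + m * β i) = vertDim α β + m * vertDim β β := by
  simp only [vertDim, Finset.mul_sum, ← Finset.sum_add_distrib]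
  exact Finset.sum_congr rfl fun i _ => by ring

theorem dotSelf_eq_vertDim (α : I → ℕ) : dotSelf α = vertDim α α := by
  simp only [dotSelf, vertDim, Nat.cast_sum, Nat.cast_mul]

/-- The trace pairing between families of vertex matrices. -/
def tracePairing {R : Type w} [CommRing R] {α β : I → ℕ} :
    VMat R β α →ₗ[R] Module.Dual R (VMat R α β) :=
  LinearMap.mk₂ R (fun Y w => ∑ i, (Y i * w i).trace)
    (fun _ _ _ => by
      simp only [Pi.add_apply, Matrix.add_mul, Matrix.trace_add, Finset.sum_add_distrib])
    (fun _ _ _ => by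
      simp only [Pi.smul_apply, Matrix.smul_mul, Matrix.trace_smul, Finset.smul_sum])
    (fun _ _ _ => by
      simp only [Pi.add_apply, Matrix.mul_add, Matrix.trace_add, Finset.sum_add_distrib])
    (fun _ _ _ => by
      simp only [Pi.smul_apply, Matrix.mul_smul, Matrix.trace_smul, Finset.smul_sum])

theorem tracePairing_apply {R : Type w} [CommRing R] {α β : I → ℕ} (Y : VMat R β α)
    (w : VMat R α β) : tracePairing Y w = ∑ i, (Y i * w i).trace :=
  rfl

end Vertices

section Arrows

variable {I : Type u} [Quiver.{v} I]

/-- Families of matrices `K^(β i) → K^(α j)` attached to the arrows `i ⟶ j` of the double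
quiver. `DRep L α` is the case `α = β`. -/
abbrev RArr (L : Type w) (α β : I → ℕ) : Type (max u v w) :=
  ∀ i j : I, DArrow i j → Matrix (Fin (α j)) (Fin (β i)) L

/-- Coordinates on `RArr L α β`. -/
abbrev RCoord (α β : I → ℕ) : Type (max u v) :=
  Σ (i : I) (j : I) (_ : DArrow i j), Fin (α j) × Fin (β i)

/-- The coordinate vector of a family of arrow matrices; on `DRep L α` it is `coords`. -/
def RArr.entries {L : Type w} {α β : I → ℕ} (x : RArr L α β) : RCoord α β → L :=
  fun c => x c.1 c.2.1 c.2.2.1 c.2.2.2.1 c.2.2.2.2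

/-- `RArr.entries` as a linear equivalence. -/
def RArr.entriesEquiv (L : Type w) [Field L] (α β : I → ℕ) :
    RArr L α β ≃ₗ[L] (RCoord α β → L) where
  toFun := RArr.entries
  invFun f := fun i j e => Matrix.of fun a b => f ⟨i, j, e, a, b⟩
  map_add' _ _ := rfl
  map_smul' _ _ := rfl
  left_inv _ := rfl
  right_inv _ := rfl

section Hom

variable {L : Type w} [Field L] {α β : I → ℕ}

/-- `X` is a homomorphism of representations from `M` to `S`. -/
def IsHom (M : DRep L α) (S : DRep L β) (X : VMat L β α) : Prop :=
  ∀ (i j : I) (e : DArrow i j), X j * M i j e = S i j e * X i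

/-- The map `X ↦ X M - S X`, whose kernel is the space of homomorphisms from `M` to `S`. -/
def homDefect (M : DRep L α) (S : DRep L β) : VMat L β α →ₗ[L] RArr L β α where
  toFun X := fun i j e => X j * M i j e - S i j e * X i
  map_add' X Y := by
    funext i j e
    simp only [Pi.add_apply, Matrix.add_mul, Matrix.mul_add]
    abel
  map_smul' c X := by
    funext i j e
    simp only [Pi.smul_apply, Matrix.smul_mul, Matrix.mul_smul, RingHom.id_apply, smul_sub]

/-- The space of homomorphisms from `M` to `S`. -/
def homSpace (M : DRep L α) (S : DRep L β) : Submodule L (VMat L β α) :=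
  LinearMap.ker (homDefect M S)

theorem mem_homSpace {M : DRep L α} {S : DRep L β} {X : VMat L β α} :
    X ∈ homSpace M S ↔ IsHom M S X := by
  simp only [homSpace, LinearMap.mem_ker, homDefect, LinearMap.coe_mk, AddHom.coe_mk, funext_iff,
    Pi.zero_apply, sub_eq_zero, IsHom]

end Hom

section Moment

variable [Fintype I] [∀ i j : I, Fintype (i ⟶ j)]
variable {R : Type w} [CommRing R] {α β γ δ : I → ℕ}

/-- The polarization of the moment map, on rectangular families. -/
def bimoment : RArr R α γ →ₗ[R] RArr R γ β →ₗ[R] VMat R α β :=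
  LinearMap.mk₂ R
    (fun x y i => ∑ j, ∑ e : (j ⟶ i), x j i (Sum.inl e) * y i j (Sum.inr e) -
      ∑ j, ∑ e : (i ⟶ j), x j i (Sum.inr e) * y i j (Sum.inl e))
    (fun x x' y => by
      funext i
      simp only [Pi.add_apply, Matrix.add_mul, Finset.sum_add_distrib]
      abel)
    (fun c x y => by
      funext i
      simp only [Pi.smul_apply, Matrix.smul_mul, ← Finset.smul_sum, smul_sub])
    (fun x y y' => by
      funext i
      simp only [Pi.add_apply, Matrix.mul_add, Finset.sum_add_distrib]
      abel)
    (fun c x y => by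
      funext i
      simp only [Pi.smul_apply, Matrix.mul_smul, ← Finset.smul_sum, smul_sub])

theorem bimoment_apply (x : RArr R α γ) (y : RArr R γ β) (i : I) :
    bimoment x y i = ∑ j, ∑ e : (j ⟶ i), x j i (Sum.inl e) * y i j (Sum.inr e) -
      ∑ j, ∑ e : (i ⟶ j), x j i (Sum.inr e) * y i j (Sum.inl e) :=
  rfl

theorem bimoment_mul_left (X : VMat R δ α) (x : RArr R α γ) (y : RArr R γ β) (i : I) :
    bimoment (fun i j e => X j * x i j e) y i = X i * bimoment x y i := by
  simp only [bimoment_apply, Matrix.mul_sub, Matrix.mul_sum, Matrix.mul_assoc]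

theorem bimoment_mul_right (x : RArr R α γ) (y : RArr R γ β) (Y : VMat R β δ) (i : I) :
    bimoment x (fun i j e => y i j e * Y i) i = bimoment x y i * Y i := by
  simp only [bimoment_apply, Matrix.sub_mul, Matrix.sum_mul, Matrix.mul_assoc]

theorem bimoment_mul_middle (x : RArr R α γ) (X : VMat R γ δ) (y : RArr R δ β) :
    bimoment (fun i j e => x i j e * X i) y = bimoment x (fun i j e => X j * y i j e) := by
  funext i
  simp only [bimoment_apply, Matrix.mul_assoc]

/-- The trace of the polarized moment map: the standard symplectic pairing. -/
def trMoment : RArr R α β →ₗ[R] Module.Dual R (RArr R β α) :=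
  LinearMap.mk₂ R (fun x y => ∑ i, (bimoment x y i).trace)
    (fun _ _ _ => by
      simp only [map_add, LinearMap.add_apply, Pi.add_apply, Matrix.trace_add,
        Finset.sum_add_distrib])
    (fun _ _ _ => by
      simp only [map_smul, LinearMap.smul_apply, Pi.smul_apply, Matrix.trace_smul,
        Finset.smul_sum])
    (fun _ _ _ => by
      simp only [map_add, Pi.add_apply, Matrix.trace_add, Finset.sum_add_distrib])
    (fun _ _ _ => by
      simp only [map_smul, Pi.smul_apply, Matrix.trace_smul, Finset.smul_sum])

theorem trMoment_apply (x : RArr R α β) (y : RArr R β α) :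
    trMoment x y = ∑ i, (bimoment x y i).trace :=
  rfl

theorem trMoment_comm (x : RArr R α β) (y : RArr R β α) : trMoment x y = -trMoment y x := by
  simp only [trMoment_apply, bimoment_apply, Matrix.trace_sub, Matrix.trace_sum,
    Finset.sum_sub_distrib, neg_sub]
  congr 1
  all_goals
    rw [Finset.sum_comm]
    exact Finset.sum_congr rfl fun i _ => Finset.sum_congr rfl fun j _ =>
      Finset.sum_congr rfl fun e _ => Matrix.trace_mul_comm _ _

theorem bimoment_single [DecidableEq I] [∀ i j : I, DecidableEq (DArrow i j)] (x : RArr R α β)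
    {i j : I} (e : DArrow i j) (A : Matrix (Fin (β i)) (Fin (α j)) R) :
    bimoment x (Pi.single j (Pi.single i (Pi.single e.swap A))) =
      Pi.single j (if e.isLeft then x i j e * A else -(x i j e * A)) := by
  funext k
  rw [bimoment_apply]
  rcases eq_or_ne k j with rfl | hk
  swap
  · simp only [Pi.single_eq_of_ne hk, Pi.zero_apply, Matrix.mul_zero, Finset.sum_const_zero,
      sub_zero]
  rw [Finset.sum_eq_single i (fun l _ hl => by simp [hl]) (fun h => absurd (Finset.mem_univ i) h),
    Finset.sum_eq_single i (fun l _ hl => by simp [hl]) (fun h => absurd (Finset.mem_univ i) h)]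
  rcases e with e | e
  · rw [Finset.sum_eq_single e (fun e' _ he' => by simp [he'])
      (fun h => absurd (Finset.mem_univ e) h)]
    simp
  · rw [Finset.sum_eq_single (a := e) (f := fun e' : (k ⟶ i) => x i k (Sum.inr e') * _)
      (fun e' _ he' => by simp [he']) (fun h => absurd (Finset.mem_univ e) h)]
    simp

theorem trMoment_injective : Function.Injective (trMoment (R := R) (α := α) (β := β)) := by
  classical
  refine (injective_iff_map_eq_zero _).2 fun x hx => ?_
  funext i j e
  ext a b
  have h := LinearMap.congr_fun hx
    (Pi.single j (Pi.single i (Pi.single e.swap (Matrix.single b a 1))))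
  rw [trMoment_apply, bimoment_single, Finset.sum_eq_single j (fun k _ hk => by simp [hk])
    (fun h => absurd (Finset.mem_univ j) h), Pi.single_eq_same] at h
  rcases e with e | e <;> simpa [Matrix.trace_mul_single] using h

section Field

variable {L : Type w} [Field L]

theorem moment_eq_bimoment (x : DRep L α) (i : I) : moment x i = bimoment x x i := rfl

/-- The derivative of the moment map at `N ⊕ S`, in the direction of extensions of `S` by `N`. -/
def dMoment (N : DRep L α) (S : DRep L β) : RArr L α β →ₗ[L] VMat L α β :=
  bimoment N + bimoment.flip S

theorem dMoment_apply (N : DRep L α) (S : DRep L β) (ζ : RArr L α β) :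
    dMoment N S ζ = bimoment N ζ + bimoment ζ S :=
  rfl

theorem tracePairing_dMoment (N : DRep L α) (S : DRep L β) (Y : VMat L β α) (ζ : RArr L α β) :
    tracePairing Y (dMoment N S ζ) = trMoment (homDefect N S Y) ζ := by
  have hN : trMoment (fun i j e => Y j * N i j e) ζ = tracePairing Y (bimoment N ζ) := by
    simp only [trMoment_apply, tracePairing_apply, bimoment_mul_left]
  have hS : trMoment (fun i j e => S i j e * Y i) ζ = -tracePairing Y (bimoment ζ S) := by
    rw [trMoment_apply, bimoment_mul_middle, ← trMoment_apply, trMoment_comm]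
    simp only [trMoment_apply, tracePairing_apply, bimoment_mul_left]
  have hsub : homDefect N S Y = (fun i j e => Y j * N i j e) - fun i j e => S i j e * Y i := rfl
  rw [hsub, map_sub, LinearMap.sub_apply, hN, hS, dMoment_apply, map_add, sub_neg_eq_add]

/-- The number of coordinates of `RArr L α β`. -/
def arrDim (α β : I → ℕ) : ℕ := ∑ i, ∑ j, ∑ _e : DArrow i j, α j * β i

theorem finrank_rArr : Module.finrank L (RArr L α β) = arrDim α β := by
  simp only [Module.finrank_pi_fintype, Module.finrank_matrix, Fintype.card_fin,
    Module.finrank_self, mul_one, arrDim]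

theorem finrank_range_homDefect_le (N : DRep L α) (S : DRep L β) :
    Module.finrank L (LinearMap.range (homDefect N S)) ≤
      Module.finrank L (LinearMap.range (dMoment N S)) := by
  have hcomp : (dMoment N S).dualMap.comp tracePairing = trMoment.comp (homDefect N S) := by
    ext1 Y
    ext1 ζ
    exact tracePairing_dMoment N S Y ζ
  calc Module.finrank L (LinearMap.range (homDefect N S))
      = Module.finrank L ((LinearMap.range (homDefect N S)).map trMoment) :=
        (Submodule.equivMapOfInjective _ trMoment_injective _).finrank_eq
    _ = Module.finrank L (LinearMap.range ((dMoment N S).dualMap.comp tracePairing)) := by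
        rw [hcomp, LinearMap.range_comp]
    _ ≤ Module.finrank L (LinearMap.range (dMoment N S).dualMap) :=
        Submodule.finrank_mono (LinearMap.range_comp_le_range _ _)
    _ = Module.finrank L (LinearMap.range (dMoment N S)) :=
        LinearMap.finrank_range_dualMap_eq_finrank_range _

theorem finrank_ker_dMoment_add_le (N : DRep L α) (S : DRep L β) :
    Module.finrank L (LinearMap.ker (dMoment N S)) + vertDim α β ≤
      arrDim α β + Module.finrank L (homSpace N S) := by
  have hhom : _ + Module.finrank L (homSpace N S) = _ :=
    LinearMap.finrank_range_add_finrank_ker (homDefect N S)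
  have hd := LinearMap.finrank_range_add_finrank_ker (dMoment N S)
  rw [finrank_vMat, vertDim_comm] at hhom
  rw [finrank_rArr] at hd
  have := finrank_range_homDefect_le N S
  omega

end Field

end Moment

end Arrows

section Numerics

variable {I : Type u} [Fintype I] [Quiver.{v} I] [∀ i j : I, Fintype (i ⟶ j)]

theorem arrDim_eq (α β : I → ℕ) :
    arrDim α β = ∑ i, ∑ j, ∑ _e : (i ⟶ j), (α j * β i + α i * β j) := by
  have h (i j : I) : ∑ _e : DArrow i j, α j * β i =
      ∑ _e : (i ⟶ j), α j * β i + ∑ _e : (j ⟶ i), α j * β i :=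
    Fintype.sum_sum_type _
  simp only [arrDim, h, Finset.sum_add_distrib]
  congr 1
  rw [Finset.sum_comm]

theorem arrDim_comm (α β : I → ℕ) : arrDim α β = arrDim β α := by
  rw [arrDim_eq, arrDim_eq]
  exact Finset.sum_congr rfl fun i _ => Finset.sum_congr rfl fun j _ =>
    Finset.sum_congr rfl fun e _ => by ring

theorem arrDim_add_left (α α' β : I → ℕ) :
    arrDim (fun i => α i + α' i) β = arrDim α β + arrDim α' β := by
  simp only [arrDim, add_mul, Finset.sum_add_distrib]

theorem arrDim_mul_left (m : ℕ) (α β : I → ℕ) :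
    arrDim (fun i => m * α i) β = m * arrDim α β := by
  simp only [arrDim, mul_assoc, Finset.mul_sum]

theorem arrDim_add_mul (m : ℕ) (α β : I → ℕ) :
    arrDim (fun i => α i + m * β i) (fun i => α i + m * β i) =
      arrDim α α + 2 * m * arrDim α β + m ^ 2 * arrDim β β := by
  rw [arrDim_add_left, arrDim_mul_left, arrDim_comm α, arrDim_comm β, arrDim_add_left,
    arrDim_add_left, arrDim_mul_left, arrDim_mul_left, arrDim_comm β α]
  ring

theorem two_mul_dotSelf_sub_q (α : I → ℕ) :
    2 * (dotSelf α - q fun i => (α i : ℤ)) = arrDim α α := by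
  have hdouble (i j : I) : ∑ _e : (i ⟶ j), ((α j : ℤ) * α i + α i * α j) =
      2 * ∑ _e : (i ⟶ j), (α j : ℤ) * α i := by
    rw [Finset.mul_sum]
    exact Finset.sum_congr rfl fun e _ => by ring
  rw [arrDim_eq, dotSelf, q]
  push_cast
  simp only [hdouble, ← Finset.mul_sum, ← sq]
  ring

theorem two_mul_p (α : I → ℕ) : 2 * p α = arrDim α α - 2 * vertDim α α + 2 := by
  rw [← two_mul_dotSelf_sub_q, ← dotSelf_eq_vertDim, p]
  ring

end Numerics

/-! ### Filtrations by bricks -/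

section Layers

variable {I : Type u} [Quiver.{v} I] {L : Type w} [Field L]

/-- An exact sequence `0 → N → M → S ^ m → 0` of representations, split on the vertices,
in which the components of `M → S ^ m` span the space of all homomorphisms from `M` to `S`. -/
structure Layer {α α' β : I → ℕ} (S : DRep L β) (m : ℕ) (M : DRep L α) (N : DRep L α') where
  proj : Fin m → VMat L β α
  incl : VMat L α α'
  retr : VMat L α' α
  sect : Fin m → VMat L α β
  dim_eq : ∀ i, α i = α' i + m * β i
  retr_incl : ∀ i, retr i * incl i = 1
  proj_incl : ∀ k i, proj k i * incl i = 0
  retr_sect : ∀ k i, retr i * sect k i = 0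
  proj_sect : ∀ k l i, proj k i * sect l i = if k = l then 1 else 0
  sum_eq : ∀ i, incl i * retr i + ∑ k, sect k i * proj k i = 1
  incl_hom : IsHom N M incl
  proj_hom : ∀ k, IsHom M S (proj k)
  full : ∀ X, IsHom M S X → ∃ c : Fin m → L, X = ∑ k, c k • proj k

/-- `M` has a filtration with successive quotients `(S t) ^ m`, from the top down, for the
entries `(t, m)` of the list, in which each step splits off all homomorphisms to `S t`. -/
def TopFilt {r : ℕ} {β : Fin r → I → ℕ} (S : ∀ t, DRep L (β t)) :
    List (Fin r × ℕ) → ∀ α : I → ℕ, DRep L α → Prop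
  | [], α, _ => ∀ i, α i = 0
  | (t, m) :: l, _, M => 0 < m ∧ ∃ (α' : I → ℕ) (N : DRep L α'),
      TopFilt S l α' N ∧ Nonempty (Layer (S t) m M N)

variable {α α' β : I → ℕ}

theorem IsHom.comp {γ : I → ℕ} {M : DRep L α} {N : DRep L β} {P : DRep L γ} {X : VMat L β α}
    {Y : VMat L γ β} (hY : IsHom N P Y) (hX : IsHom M N X) :
    IsHom M P (fun i => Y i * X i) := fun i j e => by
  rw [Matrix.mul_assoc, hX, ← Matrix.mul_assoc, hY, Matrix.mul_assoc]

namespace Layer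

variable {S : DRep L β} {m : ℕ} {M : DRep L α} {N : DRep L α'} (Y : Layer S m M N)

/-- The component `S → N` of `M` along an arrow, on the `k`-th copy of `S`. -/
def cocycle (k : Fin m) : RArr L α' β := fun i j e => Y.retr j * M i j e * Y.sect k i

theorem retr_mul (i j : I) (e : DArrow i j) :
    Y.retr j * M i j e = N i j e * Y.retr i + ∑ k, Y.cocycle k i j e * Y.proj k i := by
  calc Y.retr j * M i j e = Y.retr j * M i j e * (Y.incl i * Y.retr i +
        ∑ k, Y.sect k i * Y.proj k i) := by rw [Y.sum_eq, Matrix.mul_one]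
    _ = Y.retr j * (M i j e * Y.incl i) * Y.retr i + ∑ k, Y.cocycle k i j e * Y.proj k i := by
        simp only [cocycle, Matrix.mul_add, Matrix.mul_sum, Matrix.mul_assoc]
    _ = N i j e * Y.retr i + ∑ k, Y.cocycle k i j e * Y.proj k i := by
        rw [← Y.incl_hom, ← Matrix.mul_assoc, Y.retr_incl, Matrix.one_mul]

theorem mul_sect (i j : I) (e : DArrow i j) (k : Fin m) :
    M i j e * Y.sect k i = Y.incl j * Y.cocycle k i j e + Y.sect k j * S i j e := by
  calc M i j e * Y.sect k i = (Y.incl j * Y.retr j + ∑ l, Y.sect l j * Y.proj l j) *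
        (M i j e * Y.sect k i) := by rw [Y.sum_eq, Matrix.one_mul]
    _ = Y.incl j * Y.cocycle k i j e + ∑ l, Y.sect l j * (Y.proj l j * M i j e * Y.sect k i) := by
        simp only [cocycle, Matrix.add_mul, Matrix.sum_mul, Matrix.mul_assoc]
    _ = Y.incl j * Y.cocycle k i j e + Y.sect k j * S i j e := by
        rw [Finset.sum_eq_single k (fun l _ hl => ?_) fun h => absurd (Finset.mem_univ k) h]
        · rw [Y.proj_hom, Matrix.mul_assoc (S i j e), Y.proj_sect, if_pos rfl, Matrix.mul_one]
        · rw [Y.proj_hom, Matrix.mul_assoc (S i j e), Y.proj_sect, if_neg hl, Matrix.mul_zero,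
            Matrix.mul_zero]

theorem eq_sum (i j : I) (e : DArrow i j) :
    M i j e = Y.incl j * N i j e * Y.retr i +
      ∑ k, (Y.incl j * Y.cocycle k i j e + Y.sect k j * S i j e) * Y.proj k i := by
  calc M i j e = M i j e * (Y.incl i * Y.retr i + ∑ k, Y.sect k i * Y.proj k i) := by
        rw [Y.sum_eq, Matrix.mul_one]
    _ = Y.incl j * N i j e * Y.retr i +
        ∑ k, (Y.incl j * Y.cocycle k i j e + Y.sect k j * S i j e) * Y.proj k i := by
        simp only [Matrix.mul_add, Matrix.mul_sum, ← Matrix.mul_assoc, Y.mul_sect]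
        rw [← Y.incl_hom]

theorem eq_zero_of_mul_incl_of_mul_sect {γ : I → ℕ} {X : VMat L γ α} {i : I}
    (hincl : X i * Y.incl i = 0) (hsect : ∀ k, X i * Y.sect k i = 0) : X i = 0 := by
  calc X i = X i * (Y.incl i * Y.retr i + ∑ k, Y.sect k i * Y.proj k i) := by
        rw [Y.sum_eq, Matrix.mul_one]
    _ = 0 := by
        simp only [Matrix.mul_add, Matrix.mul_sum, ← Matrix.mul_assoc, hincl, hsect,
          Matrix.zero_mul, Finset.sum_const_zero, add_zero]

theorem isHom_mul_sect {γ : I → ℕ} {P : DRep L γ} {X : VMat L γ α} (hX : IsHom M P X)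
    (h0 : ∀ i, X i * Y.incl i = 0) (k : Fin m) : IsHom S P (fun i => X i * Y.sect k i) := by
  intro i j e
  rw [← Matrix.mul_assoc, ← hX, Matrix.mul_assoc _ (M i j e), Y.mul_sect, Matrix.mul_add,
    ← Matrix.mul_assoc, h0, Matrix.zero_mul, zero_add, Matrix.mul_assoc]

theorem incl_mul : (fun i j e => Y.incl j * N i j e : RArr L α α') =
    fun i j e => M i j e * Y.incl i := by
  funext i j e
  exact Y.incl_hom i j e

section Moment

variable [Fintype I] [∀ i j : I, Fintype (i ⟶ j)]

theorem moment_sub (Y : Layer S m M N) (hM : ∀ i, moment M i = 0) (i : I) : moment N i = 0 := by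
  have hincl : Y.incl i * moment N i = 0 := by
    rw [moment_eq_bimoment, ← bimoment_mul_left, Y.incl_mul, bimoment_mul_middle, Y.incl_mul,
      bimoment_mul_right, ← moment_eq_bimoment, hM, Matrix.zero_mul]
  rw [← Matrix.one_mul (moment N i), ← Y.retr_incl, Matrix.mul_assoc, hincl, Matrix.mul_zero]

theorem dMoment_cocycle (hM : ∀ i, moment M i = 0) (k : Fin m) :
    dMoment N S (Y.cocycle k) = 0 := by
  have hsect : (fun i j e => M i j e * Y.sect k i : RArr L α β) =
      (fun i j e => Y.incl j * Y.cocycle k i j e) + fun i j e => Y.sect k j * S i j e := by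
    funext i j e
    exact Y.mul_sect i j e k
  funext i
  -- the component `S → N` of the moment map at `M`
  have hmoment : Y.incl i * bimoment N (Y.cocycle k) i +
      (Y.incl i * bimoment (Y.cocycle k) S i + Y.sect k i * moment S i) = 0 := by
    have h : bimoment M (fun i j e => M i j e * Y.sect k i) i = 0 := by
      rw [bimoment_mul_right, ← moment_eq_bimoment, hM, Matrix.zero_mul]
    rwa [hsect, map_add, ← bimoment_mul_middle, ← bimoment_mul_middle, ← Y.incl_mul, hsect,
      map_add, LinearMap.add_apply, Pi.add_apply, Pi.add_apply, bimoment_mul_left,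
      bimoment_mul_left, bimoment_mul_left, ← moment_eq_bimoment] at h
  have hretr := congrArg (fun A => Y.retr i * A) hmoment
  rw [dMoment_apply, Pi.add_apply, Pi.zero_apply]
  simpa only [Matrix.mul_add, ← Matrix.mul_assoc, Y.retr_incl, Y.retr_sect, Matrix.one_mul,
    Matrix.zero_mul, add_zero, Matrix.mul_zero] using hretr

end Moment

section Hom

variable {γ : I → ℕ} {P : DRep L γ}

theorem isHom_extend {X : VMat L γ α'} (hX : IsHom N P X) {W : Fin m → VMat L γ β}
    (hW : ∀ k, homDefect S P (W k) = fun i j e => X j * Y.cocycle k i j e) :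
    IsHom M P fun i => X i * Y.retr i - ∑ k, W k i * Y.proj k i := by
  intro i j e
  have hWk (k) : X j * Y.cocycle k i j e = W k j * S i j e - P i j e * W k i :=
    (congrFun (congrFun (congrFun (hW k) i) j) e).symm
  have hproj (k) : W k j * Y.proj k j * M i j e = W k j * S i j e * Y.proj k i := by
    rw [Matrix.mul_assoc, Y.proj_hom, ← Matrix.mul_assoc]
  simp only [Matrix.sub_mul, Matrix.mul_sub, Matrix.sum_mul, Matrix.mul_sum, hproj]
  rw [Matrix.mul_assoc, Y.retr_mul, Matrix.mul_add, ← Matrix.mul_assoc, hX, Matrix.mul_sum]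
  simp only [← Matrix.mul_assoc, hWk, Matrix.sub_mul, Finset.sum_sub_distrib]
  abel

theorem finrank_homSpace_le (Y : Layer S m M N) : Module.finrank L (homSpace M S) ≤ m := by
  have hspan : homSpace M S ≤ Submodule.span L (Set.range Y.proj) := by
    intro X hX
    obtain ⟨c, rfl⟩ := Y.full X (mem_homSpace.1 hX)
    exact Submodule.sum_mem _ fun k _ => Submodule.smul_mem _ _ (Submodule.subset_span ⟨k, rfl⟩)
  have := Module.Finite.span_of_finite L (Set.finite_range Y.proj)
  exact (Submodule.finrank_mono hspan).trans
    ((finrank_range_le_card _).trans_eq (Fintype.card_fin m))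

theorem finrank_homSpace_le_sub [Finite I] (Y : Layer S m M N)
    (hP : ∀ X, IsHom S P X → X = 0) :
    Module.finrank L (homSpace M P) ≤ Module.finrank L (homSpace N P) := by
  let f : VMat L γ α →ₗ[L] VMat L γ α' :=
    { toFun := fun X i => X i * Y.incl i
      map_add' := fun X X' => funext fun i => Matrix.add_mul _ _ _
      map_smul' := fun c X => funext fun i => Matrix.smul_mul c (X i) (Y.incl i) }
  let g : homSpace M P →ₗ[L] homSpace N P :=
    f.restrict fun X hX => mem_homSpace.2 ((mem_homSpace.1 hX).comp Y.incl_hom)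
  refine LinearMap.finrank_le_finrank_of_injective (f := g)
    ((injective_iff_map_eq_zero _).2 ?_)
  rintro ⟨X, hX⟩ h0
  have hincl (i) : X i * Y.incl i = 0 := congrFun (congrArg Subtype.val h0) i
  refine Subtype.ext (funext fun i => Y.eq_zero_of_mul_incl_of_mul_sect (hincl i) fun k => ?_)
  exact congrFun (hP _ (Y.isHom_mul_sect (mem_homSpace.1 hX) hincl k)) i

end Hom

end Layer

end Layers

section Bricks

variable {I : Type u} [Fintype I] [Quiver.{v} I] [∀ i j : I, Fintype (i ⟶ j)]
variable {L : Type w} [Field L] {α α' β : I → ℕ}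

theorem dMoment_homDefect (N : DRep L α) (S : DRep L β) (W : VMat L α β) (i : I) :
    dMoment N S (homDefect S N W) i = W i * moment S i - moment N i * W i := by
  have hsub : homDefect S N W = (fun i j e => W j * S i j e) - fun i j e => N i j e * W i := rfl
  rw [dMoment_apply, Pi.add_apply, hsub, map_sub, map_sub, LinearMap.sub_apply, Pi.sub_apply,
    Pi.sub_apply, bimoment_mul_left, bimoment_mul_right, bimoment_mul_middle, moment_eq_bimoment,
    moment_eq_bimoment]
  abel

theorem IsHom.dMoment_mul {γ : I → ℕ} {N : DRep L α} {P : DRep L γ} {X : VMat L γ α}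
    (hX : IsHom N P X) (S : DRep L β) (ζ : RArr L α β) (i : I) :
    dMoment P S (fun i j e => X j * ζ i j e) i = X i * dMoment N S ζ i := by
  have hcomp : (fun i j e => X j * N i j e : RArr L γ α) = fun i j e => P i j e * X i := by
    funext i j e
    exact hX i j e
  rw [dMoment_apply, dMoment_apply, Pi.add_apply, Pi.add_apply, ← bimoment_mul_middle, ← hcomp,
    bimoment_mul_left, bimoment_mul_left, Matrix.mul_add]

/-- A brick that satisfies the preprojective relations. -/
structure IsBrick (S : DRep L β) : Prop where
  moment_eq : ∀ i, moment S i = 0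
  exists_pos : ∃ i, 0 < β i
  hom_self : ∀ X, IsHom S S X → ∃ c : L, X = fun _ => c • 1

namespace IsBrick

variable {S : DRep L β} (hS : IsBrick S)

include hS

theorem finrank_homSpace_le : Module.finrank L (homSpace S S) ≤ 1 := by
  refine finrank_le_one (R := L)
    (⟨fun _ => 1, mem_homSpace.2 fun i j e => by rw [Matrix.one_mul, Matrix.mul_one]⟩) ?_
  rintro ⟨X, hX⟩
  obtain ⟨c, rfl⟩ := hS.hom_self X (mem_homSpace.1 hX)
  exact ⟨c, rfl⟩

theorem finrank_ker_dMoment_le :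
    (Module.finrank L (LinearMap.ker (dMoment S S)) : ℤ) ≤ 2 * p β + dotSelf β - 1 := by
  have hker := finrank_ker_dMoment_add_le S S
  have hhom := hS.finrank_homSpace_le
  have hp := two_mul_p β
  rw [dotSelf_eq_vertDim]
  omega

theorem dotSelf_le_finrank_range :
    dotSelf β - 1 ≤ Module.finrank L (LinearMap.range (homDefect S S)) := by
  have hsum : _ + Module.finrank L (homSpace S S) = _ :=
    LinearMap.finrank_range_add_finrank_ker (homDefect S S)
  have hhom := hS.finrank_homSpace_le
  rw [finrank_vMat] at hsum
  rw [dotSelf_eq_vertDim]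
  omega

theorem range_homDefect_le :
    LinearMap.range (homDefect S S) ≤ LinearMap.ker (dMoment S S) := by
  rintro _ ⟨W, rfl⟩
  refine LinearMap.mem_ker.2 (funext fun i => ?_)
  rw [dMoment_homDefect, hS.moment_eq, Matrix.mul_zero, Matrix.zero_mul, sub_zero, Pi.zero_apply]

theorem p_nonneg : 0 ≤ p β := by
  have hrange := hS.dotSelf_le_finrank_range
  have hle := Submodule.finrank_mono hS.range_homDefect_le
  have hker := hS.finrank_ker_dMoment_le
  omega

theorem range_homDefect_eq (hp : p β = 0) :
    LinearMap.range (homDefect S S) = LinearMap.ker (dMoment S S) := by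
  refine Submodule.eq_of_le_of_finrank_le hS.range_homDefect_le ?_
  have hrange := hS.dotSelf_le_finrank_range
  have hker := hS.finrank_ker_dMoment_le
  omega

/-- A rigid brick has no self-extensions, so a second copy of it below the layer would have been
split off with the layer. -/
theorem finrank_homSpace_eq_zero (hp : p β = 0) {m : ℕ} {M : DRep L α} {N : DRep L α'}
    (Y : Layer S m M N) (hM : ∀ i, moment M i = 0) : Module.finrank L (homSpace N S) = 0 := by
  refine Submodule.finrank_eq_zero.2 ((Submodule.eq_bot_iff _).2 fun X hX => ?_)
  rw [mem_homSpace] at hX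
  have hcoboundary (k) : ∃ W, homDefect S S W = fun i j e => X j * Y.cocycle k i j e := by
    rw [← LinearMap.mem_range, hS.range_homDefect_eq hp, LinearMap.mem_ker]
    funext i
    rw [hX.dMoment_mul, Y.dMoment_cocycle hM, Pi.zero_apply, Pi.zero_apply, Matrix.mul_zero]
  choose W hW using hcoboundary
  obtain ⟨c, hc⟩ := Y.full _ (Y.isHom_extend hX hW)
  funext i
  have hincl := congrArg (fun A => A * Y.incl i) (congrFun hc i)
  simpa [Matrix.sub_mul, Matrix.mul_assoc, Matrix.sum_mul, Finset.sum_apply, Y.retr_incl,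
    Y.proj_incl] using hincl

end IsBrick

/-- A family of pairwise orthogonal bricks. -/
structure OrthBricks {r : ℕ} {β : Fin r → I → ℕ} (S : ∀ t, DRep L (β t)) : Prop where
  isBrick : ∀ t, IsBrick (S t)
  hom_ne : ∀ s t, s ≠ t → ∀ X, IsHom (S s) (S t) X → X = 0

/-- The multiplicity of the first entry with index `t`, or zero. -/
def firstMult {r : ℕ} (t : Fin r) : List (Fin r × ℕ) → ℕ
  | [] => 0
  | (s, m) :: l => if s = t then m else firstMult t l

theorem TopFilt.finrank_homSpace_le {r : ℕ} {β : Fin r → I → ℕ} {S : ∀ t, DRep L (β t)}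
    (hS : OrthBricks S) {l : List (Fin r × ℕ)} {α : I → ℕ} {M : DRep L α}
    (h : TopFilt S l α M) (t : Fin r) :
    Module.finrank L (homSpace M (S t)) ≤ firstMult t l := by
  induction l generalizing α with
  | nil =>
    have hzero : Module.finrank L (VMat L (β t) α) = 0 := by
      rw [finrank_vMat, vertDim]
      exact Finset.sum_eq_zero fun i _ => by rw [h i, mul_zero]
    exact (Submodule.finrank_le _).trans hzero.le
  | cons a l ih =>
    obtain ⟨s, m⟩ := a
    obtain ⟨-, α', N, hN, ⟨Y⟩⟩ := h
    by_cases hst : s = t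
    · subst hst
      rw [firstMult, if_pos rfl]
      exact Y.finrank_homSpace_le
    · rw [firstMult, if_neg hst]
      exact (Y.finrank_homSpace_le_sub (hS.hom_ne s t hst)).trans (ih hN)

end Bricks

section Splitting

variable {F : Type*} [Field F] {κ ν : Type*} [Fintype κ] [Fintype ν] {a : ℕ}

theorem exists_basis_inl_eq {v : κ → ν → F} (hv : LinearIndependent F v)
    (hν : Fintype.card ν = a + Fintype.card κ) :
    ∃ b : Module.Basis (κ ⊕ Fin a) F (ν → F), ∀ k, b (Sum.inl k) = v k := by
  let b := Module.Basis.sumExtend hv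
  have hb (k) : b (Sum.inl k) = v k := by
    simp only [b, Module.Basis.sumExtend, Module.Basis.reindex_apply,
      Module.Basis.extend_apply_self]
    rfl
  have : Finite (κ ⊕ Module.Basis.sumExtendIndex hv) := Module.Finite.finite_basis b
  have : Finite (Module.Basis.sumExtendIndex hv) := Finite.sum_right κ
  have hcard := Module.finrank_eq_nat_card_basis b
  rw [Nat.card_sum, Module.finrank_fintype_fun_eq_card, Nat.card_eq_fintype_card, hν] at hcard
  let e := Finite.equivFinOfCardEq (α := Module.Basis.sumExtendIndex hv) (n := a) (by omega)
  exact ⟨b.reindex ((Equiv.refl κ).sumCongr e), fun k => by simp [hb]⟩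

variable [DecidableEq κ] [DecidableEq ν]

theorem exists_splitting {B : Matrix κ ν F} (hB : LinearIndependent F B.row)
    (hν : Fintype.card ν = a + Fintype.card κ) :
    ∃ (C : Matrix ν (Fin a) F) (D : Matrix (Fin a) ν F) (E : Matrix ν κ F),
      D * C = 1 ∧ B * C = 0 ∧ D * E = 0 ∧ B * E = 1 ∧ C * D + E * B = 1 := by
  obtain ⟨b, hb⟩ := exists_basis_inl_eq hB hν
  let D : Matrix (Fin a) ν F := Matrix.of fun j => b (Sum.inr j)
  let H : Matrix ν (κ ⊕ Fin a) F := (b.toMatrix (Pi.basisFun F ν)).transpose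
  have hrows : Matrix.fromRows B D = ((Pi.basisFun F ν).toMatrix b).transpose := by
    ext (k | j) x
    · exact (congrFun (hb k) x).symm
    · rfl
  have hleft : Matrix.fromCols H.toCols₁ H.toCols₂ * Matrix.fromRows B D = 1 := by
    rw [Matrix.fromCols_toCols, hrows, ← Matrix.transpose_mul,
      Module.Basis.toMatrix_mul_toMatrix_flip, Matrix.transpose_one]
  have hright : Matrix.fromRows B D * Matrix.fromCols H.toCols₁ H.toCols₂ = 1 := by
    rw [Matrix.fromCols_toCols, hrows, ← Matrix.transpose_mul,
      Module.Basis.toMatrix_mul_toMatrix_flip, Matrix.transpose_one]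
  rw [Matrix.fromRows_mul_fromCols, ← Matrix.fromBlocks_one, Matrix.fromBlocks_inj] at hright
  rw [Matrix.fromCols_mul_fromRows, add_comm] at hleft
  obtain ⟨hBE, hBC, hDE, hDC⟩ := hright
  exact ⟨H.toCols₂, D, H.toCols₁, hDC, hBC, hDE, hBE, hleft⟩

theorem exists_splitting_mem {K L : Type*} [Field K] [Field L] [Algebra K L]
    (F : IntermediateField K L) {B : Matrix κ ν L} (hF : ∀ k x, B k x ∈ F)
    (hB : LinearIndependent L B.row) (hν : Fintype.card ν = a + Fintype.card κ) :
    ∃ (C : Matrix ν (Fin a) L) (D : Matrix (Fin a) ν L) (E : Matrix ν κ L),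
      (D * C = 1 ∧ B * C = 0 ∧ D * E = 0 ∧ B * E = 1 ∧ C * D + E * B = 1) ∧
      (∀ x j, C x j ∈ F) ∧ (∀ j x, D j x ∈ F) ∧ ∀ x k, E x k ∈ F := by
  let f : F →+* L := algebraMap F L
  let B₀ : Matrix κ ν F := Matrix.of fun k x => ⟨B k x, hF k x⟩
  have hB₀ : LinearIndependent F B₀.row :=
    LinearIndependent.of_comp ((Algebra.linearMap F L).compLeft ν) (hB.restrict_scalars' F)
  have hBf : B₀.map f = B := rfl
  obtain ⟨C, D, E, hDC, hBC, hDE, hBE, hsum⟩ := exists_splitting hB₀ hν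
  refine ⟨C.map f, D.map f, E.map f, ⟨?_, ?_, ?_, ?_, ?_⟩, fun x j => (C x j).2,
    fun j x => (D j x).2, fun x k => (E x k).2⟩
  · rw [← Matrix.map_mul, hDC, Matrix.map_one f (map_zero f) (map_one f)]
  · rw [← hBf, ← Matrix.map_mul, hBC, Matrix.map_zero f (map_zero f)]
  · rw [← Matrix.map_mul, hDE, Matrix.map_zero f (map_zero f)]
  · rw [← hBf, ← Matrix.map_mul, hBE, Matrix.map_one f (map_zero f) (map_one f)]
  · rw [← hBf, ← Matrix.map_mul, ← Matrix.map_mul, ← Matrix.map_add f (map_add f), hsum,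
      Matrix.map_one f (map_zero f) (map_one f)]

end Splitting

section Transport

theorem sum_smul_mul_sum_smul {F ι ι' κ ν ξ : Type*} [CommSemiring F] [Fintype ι] [Fintype ι']
    [Fintype ν] (c : ι → F) (d : ι' → F) (A : ι → Matrix κ ν F) (B : ι' → Matrix ν ξ F) :
    (∑ a, c a • A a) * (∑ b, d b • B b) = ∑ a, ∑ b, (c a * d b) • (A a * B b) := by
  rw [Matrix.sum_mul]
  refine Finset.sum_congr rfl fun a _ => ?_
  rw [Matrix.mul_sum]
  exact Finset.sum_congr rfl fun b _ => by rw [Matrix.smul_mul, Matrix.mul_smul, smul_smul]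

variable {I : Type u} [Quiver.{v} I] {L : Type w} [Field L] {α α' β : I → ℕ}

/-- An isomorphism of matrix representations, with its inverse. -/
structure RepIso (M M' : DRep L α) where
  hom : VMat L α α
  inv : VMat L α α
  hom_inv : ∀ i, hom i * inv i = 1
  inv_hom : ∀ i, inv i * hom i = 1
  isHom_hom : IsHom M M' hom
  isHom_inv : IsHom M' M inv

/-- An isomorphism from an element of `GL(α)` that conjugates one representation into another. -/
def RepIso.ofConj (g : GLProd L α) (M : DRep L α) : RepIso M (conj g M) where
  hom i := (g i).1
  inv i := (g i)⁻¹.1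
  hom_inv i := (g i).mul_inv
  inv_hom i := (g i).inv_mul
  isHom_hom i j e := by
    rw [conj, Matrix.mul_assoc _ _ (g i).1, (g i).inv_mul, Matrix.mul_one]
  isHom_inv i j e := by
    rw [conj, Matrix.mul_assoc (g j).1, ← Matrix.mul_assoc, (g j).inv_mul, Matrix.one_mul]

namespace Layer

variable {S : DRep L β} {m : ℕ} {N : DRep L α'} {M : DRep L α}

/-- Change of basis of the homomorphism space of a layer. -/
def changeBasis (Y : Layer S m M N) (g : GL (Fin m) L) : Layer S m M N where
  proj k := ∑ l, g.1 k l • Y.proj l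
  incl := Y.incl
  retr := Y.retr
  sect k := ∑ l, g⁻¹.1 l k • Y.sect l
  dim_eq := Y.dim_eq
  retr_incl := Y.retr_incl
  proj_incl k i := by
    simp [Finset.sum_apply, Matrix.sum_mul, Y.proj_incl]
  retr_sect k i := by
    simp [Finset.sum_apply, Matrix.mul_sum, Y.retr_sect]
  proj_sect k l i := by
    have hg := congrFun (congrFun g.mul_inv k) l
    rw [Matrix.mul_apply] at hg
    simp only [Finset.sum_apply, Pi.smul_apply, sum_smul_mul_sum_smul, Y.proj_sect, smul_ite,
      smul_zero, Finset.sum_ite_eq, Finset.mem_univ, if_true, ← Finset.sum_smul]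
    rw [hg, Matrix.one_apply, ite_smul, one_smul, zero_smul]
  sum_eq i := by
    have hsum : ∑ k, (∑ l, g⁻¹.1 l k • Y.sect l) i * (∑ l, g.1 k l • Y.proj l) i =
        ∑ l, ∑ l', (g⁻¹.1 * g.1) l l' • (Y.sect l i * Y.proj l' i) := by
      simp only [Finset.sum_apply, Pi.smul_apply, sum_smul_mul_sum_smul, Matrix.mul_apply,
        Finset.sum_smul]
      rw [Finset.sum_comm]
      exact Finset.sum_congr rfl fun l _ => Finset.sum_comm
    rw [hsum, g.inv_mul, ← Y.sum_eq i]
    simp [Matrix.one_apply]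
  incl_hom := Y.incl_hom
  proj_hom k := by
    rw [← mem_homSpace]
    exact Submodule.sum_mem _ fun l _ => Submodule.smul_mem _ _ (mem_homSpace.2 (Y.proj_hom l))
  full X hX := by
    obtain ⟨c, rfl⟩ := Y.full X hX
    have hc : c = Matrix.vecMul (Matrix.vecMul c g⁻¹.1) g.1 := by
      rw [Matrix.vecMul_vecMul, g.inv_mul, Matrix.vecMul_one]
    refine ⟨Matrix.vecMul c g⁻¹.1, ?_⟩
    conv_lhs => rw [hc]
    simp only [Finset.smul_sum, smul_smul]
    rw [Finset.sum_comm]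
    exact Finset.sum_congr rfl fun l _ => by rw [← Finset.sum_smul]; rfl

theorem linearIndependent_proj (Y : Layer S m M N) (hβ : ∃ i, 0 < β i) :
    LinearIndependent L Y.proj := by
  obtain ⟨i, hi⟩ := hβ
  rw [Fintype.linearIndependent_iff]
  intro c hc k
  have hsect : (∑ l, c l • Y.proj l) i * Y.sect k i = 0 := by
    rw [hc, Pi.zero_apply, Matrix.zero_mul]
  simp only [Finset.sum_apply, Pi.smul_apply, Matrix.sum_mul, Matrix.smul_mul, Y.proj_sect,
    smul_ite, smul_zero, Finset.sum_ite_eq', Finset.mem_univ, if_true] at hsect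
  simpa using congrFun (congrFun hsect ⟨0, hi⟩) ⟨0, hi⟩

theorem linearIndependent_rows (Y : Layer S m M N) (i : I) :
    LinearIndependent L fun kb : Fin m × Fin (β i) => Y.proj kb.1 i kb.2 := by
  let E : Matrix (Fin (α i)) (Fin m × Fin (β i)) L := Matrix.of fun x kb => Y.sect kb.1 i x kb.2
  let B : Matrix (Fin m × Fin (β i)) (Fin (α i)) L := Matrix.of fun kb => Y.proj kb.1 i kb.2
  have hE : B * E = 1 := by
    ext ⟨k, b⟩ ⟨l, b'⟩
    refine (congrFun (congrFun (Y.proj_sect k l i) b) b').trans ?_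
    by_cases hkl : k = l <;> simp [hkl, Matrix.one_apply]
  refine Matrix.vecMul_injective_iff.1 (Function.LeftInverse.injective (g := E.vecMul) fun c => ?_)
  exact (Matrix.vecMul_vecMul c B E).trans (by rw [hE, Matrix.vecMul_one])

variable {K : Type*} [Field K] [Algebra K L]

/-- The submodule is taken to be the restriction of `M` along a splitting defined over `F`. -/
theorem exists_of_linearIndependent (F : IntermediateField K L) {P : Fin m → VMat L β α}
    (hF : ∀ k i b x, P k i b x ∈ F) (dim_eq : ∀ i, α i = α' i + m * β i)
    (hrows : ∀ i, LinearIndependent L fun kb : Fin m × Fin (β i) => P kb.1 i kb.2)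
    (hP : ∀ k, IsHom M S (P k))
    (full : ∀ X, IsHom M S X → ∃ c : Fin m → L, X = ∑ k, c k • P k) :
    ∃ (N : DRep L α') (Y : Layer S m M N), Y.proj = P ∧
      (∀ i x y, Y.incl i x y ∈ F) ∧ (∀ i x y, Y.retr i x y ∈ F) ∧
      (∀ k i x y, Y.sect k i x y ∈ F) := by
  have hcard (i) : Fintype.card (Fin (α i)) = α' i + Fintype.card (Fin m × Fin (β i)) := by
    simp [dim_eq i]
  choose C D E hCDE hC hD hE using fun i => exists_splitting_mem F
    (B := Matrix.of fun kb : Fin m × Fin (β i) => P kb.1 i kb.2) (fun kb x => hF kb.1 i kb.2 x)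
    (hrows i) (hcard i)
  choose hDC hBC hDE hBE hsum using hCDE
  let sect (k : Fin m) : VMat L α β := fun i => (E i).submatrix id fun b => (k, b)
  have hPC (k i) : P k i * C i = 0 :=
    congrArg (fun A => A.submatrix (fun b => (k, b)) id) (hBC i)
  have hPE (k l i) : P k i * sect l i = if k = l then 1 else 0 := by
    ext b b'
    refine (congrFun (congrFun (hBE i) (k, b)) (l, b')).trans ?_
    by_cases hkl : k = l <;> simp [hkl, Matrix.one_apply]
  have hsum' (i) : C i * D i + ∑ k, sect k i * P k i = 1 := by
    rw [← hsum i]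
    congr 1
    ext x y
    rw [Matrix.sum_apply, Matrix.mul_apply, Fintype.sum_prod_type]
    rfl
  refine ⟨fun i j e => D j * M i j e * C i, ⟨P, C, D, sect, dim_eq, hDC, hPC, fun k i =>
    congrArg (fun A => A.submatrix id fun b => (k, b)) (hDE i), hPE, hsum', fun i j e => ?_, hP,
    full⟩, rfl, hC, hD, fun k i x y => hE i x (k, y)⟩
  have hPM (k) : P k j * (M i j e * C i) = 0 := by
    rw [← Matrix.mul_assoc, hP, Matrix.mul_assoc, hPC, Matrix.mul_zero]
  calc C j * (D j * M i j e * C i)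
      = (C j * D j + ∑ k, sect k j * P k j) * (M i j e * C i) := by
        simp only [Matrix.add_mul, Matrix.sum_mul, Matrix.mul_assoc, hPM, Matrix.mul_zero,
          Finset.sum_const_zero, add_zero]
    _ = M i j e * C i := by rw [hsum', Matrix.one_mul]

theorem exists_defined_over (Y : Layer S m M N) (F : IntermediateField K L)
    (hF : ∀ k i b x, Y.proj k i b x ∈ F) :
    ∃ (N' : DRep L α') (Y' : Layer S m M N'), Y'.proj = Y.proj ∧
      (∀ i x y, Y'.incl i x y ∈ F) ∧ (∀ i x y, Y'.retr i x y ∈ F) ∧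
      (∀ k i x y, Y'.sect k i x y ∈ F) :=
  exists_of_linearIndependent F hF Y.dim_eq Y.linearIndependent_rows Y.proj_hom Y.full

/-- Transport of a layer along an isomorphism of its middle term. -/
def congrMiddle (Y : Layer S m M N) {M' : DRep L α} (f : RepIso M M') : Layer S m M' N where
  proj k i := Y.proj k i * f.inv i
  incl i := f.hom i * Y.incl i
  retr i := Y.retr i * f.inv i
  sect k i := f.hom i * Y.sect k i
  dim_eq := Y.dim_eq
  retr_incl i := by
    rw [Matrix.mul_assoc, ← Matrix.mul_assoc (f.inv i), f.inv_hom, Matrix.one_mul, Y.retr_incl]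
  proj_incl k i := by
    rw [Matrix.mul_assoc, ← Matrix.mul_assoc (f.inv i), f.inv_hom, Matrix.one_mul, Y.proj_incl]
  retr_sect k i := by
    rw [Matrix.mul_assoc, ← Matrix.mul_assoc (f.inv i), f.inv_hom, Matrix.one_mul, Y.retr_sect]
  proj_sect k l i := by
    rw [Matrix.mul_assoc, ← Matrix.mul_assoc (f.inv i), f.inv_hom, Matrix.one_mul, Y.proj_sect]
  sum_eq i := by
    have hconj : f.hom i * (Y.incl i * Y.retr i + ∑ k, Y.sect k i * Y.proj k i) * f.inv i = 1 := by
      rw [Y.sum_eq, Matrix.mul_one, f.hom_inv]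
    simpa only [Matrix.mul_add, Matrix.add_mul, Matrix.mul_sum, Matrix.sum_mul,
      Matrix.mul_assoc] using hconj
  incl_hom := f.isHom_hom.comp Y.incl_hom
  proj_hom k := (Y.proj_hom k).comp f.isHom_inv
  full X hX := by
    obtain ⟨c, hc⟩ := Y.full _ (hX.comp f.isHom_hom)
    refine ⟨c, funext fun i => ?_⟩
    have hXi : X i = X i * f.hom i * f.inv i := by
      rw [Matrix.mul_assoc, f.hom_inv, Matrix.mul_one]
    rw [hXi, congrFun hc i]
    simp [Finset.sum_apply, Matrix.sum_mul]

/-- Transport of a layer along an isomorphism of the brick. -/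
def congrQuotient (Y : Layer S m M N) {S' : DRep L β} (f : RepIso S S') : Layer S' m M N where
  proj k i := f.hom i * Y.proj k i
  incl := Y.incl
  retr := Y.retr
  sect k i := Y.sect k i * f.inv i
  dim_eq := Y.dim_eq
  retr_incl := Y.retr_incl
  proj_incl k i := by rw [Matrix.mul_assoc, Y.proj_incl, Matrix.mul_zero]
  retr_sect k i := by rw [← Matrix.mul_assoc, Y.retr_sect, Matrix.zero_mul]
  proj_sect k l i := by
    rw [Matrix.mul_assoc, ← Matrix.mul_assoc (Y.proj k i), Y.proj_sect]
    split_ifs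
    · rw [Matrix.one_mul, f.hom_inv]
    · rw [Matrix.zero_mul, Matrix.mul_zero]
  sum_eq i := by
    rw [← Y.sum_eq i]
    congr 1
    refine Finset.sum_congr rfl fun k _ => ?_
    rw [Matrix.mul_assoc, ← Matrix.mul_assoc (f.inv i), f.inv_hom, Matrix.one_mul]
  incl_hom := Y.incl_hom
  proj_hom k := f.isHom_hom.comp (Y.proj_hom k)
  full X hX := by
    obtain ⟨c, hc⟩ := Y.full _ (f.isHom_inv.comp hX)
    refine ⟨c, funext fun i => ?_⟩
    have hXi : X i = f.hom i * (f.inv i * X i) := by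
      rw [← Matrix.mul_assoc, f.hom_inv, Matrix.one_mul]
    rw [hXi, congrFun hc i]
    simp [Finset.sum_apply, Matrix.mul_sum]

theorem incl_mul_retr_mul_incl {N' : DRep L α'} (Y : Layer S m M N) (Y' : Layer S m M N')
    (h : Y'.proj = Y.proj) (i : I) : Y'.incl i * (Y'.retr i * Y.incl i) = Y.incl i := by
  have hsum := congrArg (fun A => A * Y.incl i) (Y'.sum_eq i)
  simpa only [Matrix.add_mul, Matrix.sum_mul, Matrix.mul_assoc, h, Y.proj_incl,
    Matrix.mul_zero, Finset.sum_const_zero, add_zero, Matrix.one_mul] using hsum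

theorem isHom_retr_mul_incl {N' : DRep L α'} (Y : Layer S m M N) (Y' : Layer S m M N')
    (h : Y'.proj = Y.proj) : IsHom N N' fun i => Y'.retr i * Y.incl i := by
  intro i j e
  rw [Matrix.mul_assoc, Y.incl_hom, ← Matrix.mul_assoc, Y'.retr_mul, Matrix.add_mul,
    Matrix.sum_mul]
  simp only [Matrix.mul_assoc, h, Y.proj_incl, Matrix.mul_zero, Finset.sum_const_zero, add_zero]

/-- The kernels of two layers with the same projections are isomorphic. -/
def kernelIso {N' : DRep L α'} (Y : Layer S m M N) (Y' : Layer S m M N')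
    (h : Y'.proj = Y.proj) : RepIso N N' where
  hom i := Y'.retr i * Y.incl i
  inv i := Y.retr i * Y'.incl i
  hom_inv i := by rw [Matrix.mul_assoc, Y'.incl_mul_retr_mul_incl Y h.symm, Y'.retr_incl]
  inv_hom i := by rw [Matrix.mul_assoc, Y.incl_mul_retr_mul_incl Y' h, Y.retr_incl]
  isHom_hom := Y.isHom_retr_mul_incl Y' h
  isHom_inv := Y'.isHom_retr_mul_incl Y h.symm

end Layer

variable {r : ℕ} {β : Fin r → I → ℕ} {S S' : ∀ t, DRep L (β t)} {l : List (Fin r × ℕ)}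

theorem TopFilt.congr {M M' : DRep L α} (h : TopFilt S l α M) (f : RepIso M M') :
    TopFilt S l α M' := by
  cases l with
  | nil => exact h
  | cons a l =>
    obtain ⟨hm, α', N, hN, ⟨Y⟩⟩ := h
    exact ⟨hm, α', N, hN, ⟨Y.congrMiddle f⟩⟩

theorem TopFilt.congrQuotients (f : ∀ t, RepIso (S t) (S' t)) {α : I → ℕ} {M : DRep L α}
    (h : TopFilt S l α M) : TopFilt S' l α M := by
  induction l generalizing α with
  | nil => exact h
  | cons a l ih =>
    obtain ⟨hm, α', N, hN, ⟨Y⟩⟩ := h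
    exact ⟨hm, α', N, ih hN, ⟨Y.congrQuotient (f _)⟩⟩

end Transport

/-! ### Tangent spaces and the parameter count -/

section Tangent

variable {I : Type u}

/-- Apply a function to all entries. -/
def VMat.map {R R' : Type*} {α β : I → ℕ} (f : R → R') (x : VMat R α β) : VMat R' α β :=
  fun i => (x i).map f

theorem VMat.map_injective {R R' : Type*} {α β : I → ℕ} {f : R → R'} (hf : Function.Injective f) :
    Function.Injective (VMat.map f : VMat R α β → VMat R' α β) :=
  fun _ _ h => funext fun i => Matrix.map_injective hf (congrFun h i)

variable {K : Type*} {L : Type w} [Field K] [Field L] [Algebra K L] {α β γ : I → ℕ}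

theorem trdegAdjoin_union_vMat_le [Finite I] (X : Set L) (x : VMat L α β)
    (V : Submodule L (VMat L α β))
    (hV : ∀ (E : IntermediateField K L) (D : Derivation K E L), X ⊆ E →
      (∀ a : E, (a : L) ∈ X → D a = 0) → ∀ x' : VMat E α β, x'.map (algebraMap E L) = x →
        x'.map D ∈ V) :
    trdegAdjoin K (X ∪ Set.range x.entries) ≤ trdegAdjoin K X + Module.finrank L V := by
  rw [← LinearEquiv.finrank_map_eq (VMat.entriesEquiv L α β) V]
  refine trdegAdjoin_union_range_le X _ _ fun E D hXE hD x' hx' => ?_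
  refine ⟨_, hV E D hXE hD (fun i => Matrix.of fun a b => x' ⟨i, a, b⟩) ?_, rfl⟩
  funext i
  ext a b
  exact hx' ⟨i, a, b⟩

variable [Quiver.{v} I]

/-- Apply a function to all entries. -/
def RArr.map {R R' : Type*} {α β : I → ℕ} (f : R → R') (x : RArr R α β) : RArr R' α β :=
  fun i j e => (x i j e).map f

theorem RArr.exists_map_algebraMap_eq {E : IntermediateField K L} (D : Derivation K E L)
    {X : Set L} (hXE : X ⊆ E) (hD : ∀ a : E, (a : L) ∈ X → D a = 0) (x : RArr L α β)
    (hx : Set.range x.entries ⊆ X) :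
    ∃ x' : RArr E α β, x'.map (algebraMap E L) = x ∧ x'.map D = 0 := by
  have hentry (i j) (e : DArrow i j) (a b) : x i j e a b ∈ X := hx ⟨⟨i, j, e, a, b⟩, rfl⟩
  refine ⟨fun i j e => Matrix.of fun a b => ⟨x i j e a b, hXE (hentry i j e a b)⟩, rfl, ?_⟩
  funext i j e
  ext a b
  exact hD _ (hentry i j e a b)

section Bound

variable [Finite I]

theorem trdegAdjoin_union_isHom_le (X : Set L) {M : DRep L α} {S : DRep L β}
    (hM : Set.range (RArr.entries M) ⊆ X) (hS : Set.range (RArr.entries S) ⊆ X) {g : VMat L β α}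
    (hg : IsHom M S g) :
    trdegAdjoin K (X ∪ Set.range (VMat.entries g)) ≤
      trdegAdjoin K X + Module.finrank L (homSpace M S) := by
  refine trdegAdjoin_union_vMat_le X g _ fun E D hXE hD g' hg' => ?_
  obtain ⟨M', rfl, hDM⟩ := RArr.exists_map_algebraMap_eq D hXE hD M hM
  obtain ⟨S', rfl, hDS⟩ := RArr.exists_map_algebraMap_eq D hXE hD S hS
  subst hg'
  rw [mem_homSpace]
  intro i j e
  have hcomm : g' j * M' i j e = S' i j e * g' i := by
    refine Matrix.map_injective (algebraMap E L).injective ?_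
    beta_reduce
    rw [Matrix.map_mul, Matrix.map_mul]
    exact hg i j e
  have hDMe : (M' i j e).map D = 0 := congrFun (congrFun (congrFun hDM i) j) e
  have hDSe : (S' i j e).map D = 0 := congrFun (congrFun (congrFun hDS i) j) e
  have hderiv := congrArg (fun A => A.map D) hcomm
  simp only [map_derivation_mul, hDMe, hDSe, Matrix.mul_zero, Matrix.zero_mul, zero_add,
    add_zero] at hderiv
  exact hderiv

variable [∀ i j : I, Finite (i ⟶ j)]

theorem trdegAdjoin_union_rArr_le (X : Set L) (x : RArr L α β) (V : Submodule L (RArr L α β))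
    (hV : ∀ (E : IntermediateField K L) (D : Derivation K E L), X ⊆ E →
      (∀ a : E, (a : L) ∈ X → D a = 0) → ∀ x' : RArr E α β, x'.map (algebraMap E L) = x →
        x'.map D ∈ V) :
    trdegAdjoin K (X ∪ Set.range x.entries) ≤ trdegAdjoin K X + Module.finrank L V := by
  rw [← LinearEquiv.finrank_map_eq (RArr.entriesEquiv L α β) V]
  refine trdegAdjoin_union_range_le X _ _ fun E D hXE hD x' hx' => ?_
  refine ⟨_, hV E D hXE hD (fun i j e => Matrix.of fun a b => x' ⟨i, j, e, a, b⟩) ?_, rfl⟩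
  funext i j e
  ext a b
  exact hx' ⟨i, j, e, a, b⟩

end Bound

section Moment

variable [Fintype I] [∀ i j : I, Fintype (i ⟶ j)]

theorem map_bimoment {R R' : Type*} [CommRing R] [CommRing R'] (f : R →+* R')
    (x : RArr R α γ) (y : RArr R γ β) :
    (bimoment x y).map f = bimoment (x.map f) (y.map f) := by
  funext i
  have hf {m n : ℕ} (A : Matrix (Fin m) (Fin n) R) : A.map f = f.toAddMonoidHom.mapMatrix A := rfl
  simp only [VMat.map, bimoment_apply, RArr.map, ← Matrix.map_mul]
  simp only [hf, map_sub, map_sum]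

theorem map_derivation_bimoment {E : IntermediateField K L} (D : Derivation K E L)
    (x : RArr E α γ) (y : RArr E γ β) :
    (bimoment x y).map D =
      bimoment (x.map (algebraMap E L)) (y.map D) +
        bimoment (x.map D) (y.map (algebraMap E L)) := by
  funext i
  have hD {m n : ℕ} (A : Matrix (Fin m) (Fin n) E) :
      A.map D = D.toLinearMap.toAddMonoidHom.mapMatrix A := rfl
  rw [VMat.map, bimoment_apply, hD]
  simp only [map_sub, map_sum]
  simp only [← hD, map_derivation_mul, Finset.sum_add_distrib, Pi.add_apply, bimoment_apply,
    RArr.map]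
  abel

theorem trdegAdjoin_union_moment_le (X : Set L) (S : DRep L β) (hS : ∀ i, moment S i = 0) :
    trdegAdjoin K (X ∪ Set.range (RArr.entries S)) ≤
      trdegAdjoin K X + Module.finrank L (LinearMap.ker (dMoment S S)) := by
  refine trdegAdjoin_union_rArr_le X S _ fun E D _ _ S' hS' => ?_
  subst hS'
  have hzero : bimoment S' S' = 0 := by
    refine VMat.map_injective (algebraMap E L).injective ?_
    rw [map_bimoment]
    funext i
    exact (hS i).trans (Matrix.map_zero _ (map_zero _)).symm
  rw [LinearMap.mem_ker, dMoment_apply, ← map_derivation_bimoment, hzero]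
  funext i
  exact Matrix.map_zero _ (map_zero D)

theorem trdegAdjoin_union_cocycle_le (X : Set L) {N : DRep L α} {S : DRep L β}
    (hN : Set.range (RArr.entries N) ⊆ X) (hS : Set.range (RArr.entries S) ⊆ X) {ζ : RArr L α β}
    (hζ : dMoment N S ζ = 0) :
    trdegAdjoin K (X ∪ Set.range ζ.entries) ≤
      trdegAdjoin K X + Module.finrank L (LinearMap.ker (dMoment N S)) := by
  refine trdegAdjoin_union_rArr_le X ζ _ fun E D hXE hD ζ' hζ' => ?_
  obtain ⟨N', rfl, hDN⟩ := RArr.exists_map_algebraMap_eq D hXE hD N hN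
  obtain ⟨S', rfl, hDS⟩ := RArr.exists_map_algebraMap_eq D hXE hD S hS
  subst hζ'
  have hadd (f : E →+ L) (x y : VMat E α β) : (x + y).map f = x.map f + y.map f :=
    funext fun i => Matrix.map_add f (map_add f) _ _
  have hzero : bimoment N' ζ' + bimoment ζ' S' = 0 := by
    refine VMat.map_injective (algebraMap E L).injective ?_
    refine (hadd (algebraMap E L).toAddMonoidHom _ _).trans ?_
    refine (congrArg₂ _ (map_bimoment (algebraMap E L) N' ζ')
      (map_bimoment (algebraMap E L) ζ' S')).trans (hζ.trans ?_)
    funext i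
    exact (Matrix.map_zero _ (map_zero _)).symm
  have hderiv : (bimoment N' ζ').map D + (bimoment ζ' S').map D = 0 := by
    refine (hadd D.toLinearMap.toAddMonoidHom _ _).symm.trans ?_
    rw [hzero]
    funext i
    exact Matrix.map_zero _ (map_zero D)
  rwa [map_derivation_bimoment, map_derivation_bimoment, hDN, hDS, map_zero,
    LinearMap.zero_apply, map_zero, add_zero, zero_add] at hderiv

end Moment

end Tangent

section Count

variable {I : Type u} [Quiver.{v} I] {K : Type*} {L : Type w} [Field K] [Field L] [Algebra K L]
  {α α' β : I → ℕ}

namespace Layer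

variable {S : DRep L β} {m : ℕ} {M : DRep L α} {N : DRep L α'}

/-- The matrix whose rows are the coordinate vectors of the projections of a layer. -/
def projMatrix (Y : Layer S m M N) : Matrix (Fin m) (VCoord β α) L :=
  Matrix.of fun k => VMat.entries (Y.proj k)

theorem exists_projMatrix_submatrix_eq_one [Finite I] (Y : Layer S m M N) (hβ : ∃ i, 0 < β i) :
    ∃ (Y' : Layer S m M N) (a : Fin m → VCoord β α), Function.Injective a ∧
      Y'.projMatrix.submatrix id a = 1 := by
  have hrow : LinearIndependent L Y.projMatrix.row :=
    (Y.linearIndependent_proj hβ).map' (VMat.entriesEquiv L β α).toLinearMap (LinearEquiv.ker _)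
  obtain ⟨g, a, ha, hga⟩ := exists_mul_submatrix_eq_one Y.projMatrix hrow
  refine ⟨Y.changeBasis g, a, ha, ?_⟩
  rw [← hga]
  congr 1
  ext k c
  simp [projMatrix, changeBasis, VMat.entries, Finset.sum_apply, Matrix.sum_apply,
    Matrix.mul_apply]

theorem range_entries_subset (Y : Layer S m M N) {F : IntermediateField K L}
    (hincl : ∀ i x y, Y.incl i x y ∈ F) (hretr : ∀ i x y, Y.retr i x y ∈ F)
    (hsect : ∀ k i x y, Y.sect k i x y ∈ F) (hproj : ∀ k i x y, Y.proj k i x y ∈ F)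
    (hN : Set.range (RArr.entries N) ⊆ F) (hS : Set.range (RArr.entries S) ⊆ F)
    (hζ : ∀ k, Set.range (Y.cocycle k).entries ⊆ F) : Set.range (RArr.entries M) ⊆ F := by
  rintro _ ⟨⟨i, j, e, x, y⟩, rfl⟩
  change M i j e x y ∈ F
  rw [Y.eq_sum i j e, Matrix.add_apply, Matrix.sum_apply]
  refine add_mem ?_ (sum_mem fun k _ => ?_)
  · refine matrix_mul_mem (matrix_mul_mem (hincl j) fun x y => ?_) (hretr i) x y
    exact hN ⟨⟨i, j, e, x, y⟩, rfl⟩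
  · refine matrix_mul_mem (fun x y => ?_) (hproj k i) x y
    exact add_mem (matrix_mul_mem (hincl j) (fun x y => hζ k ⟨⟨i, j, e, x, y⟩, rfl⟩) x y)
      (matrix_mul_mem (hsect k j) (fun x y => hS ⟨⟨i, j, e, x, y⟩, rfl⟩) x y)

theorem trdegAdjoin_union_range_entries_le (Y : Layer S m M N) {X Z : Set L}
    {F : IntermediateField K L} (hFZ : F ≤ IntermediateField.adjoin K Z) (hXZ : X ⊆ Z)
    (hincl : ∀ i x y, Y.incl i x y ∈ F) (hretr : ∀ i x y, Y.retr i x y ∈ F)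
    (hsect : ∀ k i x y, Y.sect k i x y ∈ F) (hproj : ∀ k i x y, Y.proj k i x y ∈ F)
    (hN : Set.range (RArr.entries N) ⊆ Z) (hS : Set.range (RArr.entries S) ⊆ Z)
    (hζ : ∀ k, Set.range (Y.cocycle k).entries ⊆ Z) :
    trdegAdjoin K (X ∪ Set.range (RArr.entries M)) ≤ trdegAdjoin K Z := by
  have hadj : Z ⊆ IntermediateField.adjoin K Z := IntermediateField.subset_adjoin _ _
  exact trdegAdjoin_le_of_subset_adjoin (Set.union_subset (hXZ.trans hadj)
    (Y.range_entries_subset (fun i x y => hFZ (hincl i x y)) (fun i x y => hFZ (hretr i x y))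
      (fun k i x y => hFZ (hsect k i x y)) (fun k i x y => hFZ (hproj k i x y)) (hN.trans hadj)
      (hS.trans hadj) fun k => (hζ k).trans hadj))

theorem exists_trdegAdjoin_le [Fintype I] [∀ i j : I, Fintype (i ⟶ j)] (Y : Layer S m M N)
    (hβ : ∃ i, 0 < β i) (hM : ∀ i, moment M i = 0) {X : Set L}
    (hX : Set.range (RArr.entries S) ⊆ X) :
    ∃ (N' : DRep L α') (Y₁ : Layer S m M N) (Y₂ : Layer S m M N'), Y₂.proj = Y₁.proj ∧
      m ≤ vertDim β α ∧
      trdegAdjoin K (X ∪ Set.range (RArr.entries M)) ≤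
        trdegAdjoin K (X ∪ Set.range (RArr.entries N')) +
        (m * (vertDim β α - m) + m * Module.finrank L (LinearMap.ker (dMoment N' S)) : ℕ) := by
  obtain ⟨Y₁, a, ha, hechelon⟩ := Y.exists_projMatrix_submatrix_eq_one hβ
  let F := IntermediateField.adjoin K (⋃ k, Set.range (Y₁.projMatrix k))
  have hproj (k i x y) : Y₁.proj k i x y ∈ F :=
    IntermediateField.subset_adjoin _ _ (Set.mem_iUnion.2 ⟨k, ⟨i, x, y⟩, rfl⟩)
  obtain ⟨N', Y₂, hY, hincl, hretr, hsect⟩ := Y₁.exists_defined_over F hproj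
  refine ⟨N', Y₁, Y₂, hY, ?_, ?_⟩
  · simpa only [card_vCoord, Fintype.card_fin] using Fintype.card_le_of_injective a ha
  let X₁ := X ∪ Set.range (RArr.entries N')
  let X₂ := X₁ ∪ ⋃ k, Set.range (Y₁.projMatrix k)
  let X₃ := X₂ ∪ ⋃ k, Set.range (Y₂.cocycle k).entries
  have hS₂ : Set.range (RArr.entries S) ⊆ X₂ :=
    hX.trans (Set.subset_union_left.trans Set.subset_union_left)
  have hN₂ : Set.range (RArr.entries N') ⊆ X₂ :=
    Set.subset_union_right.trans Set.subset_union_left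
  have hX₂ : trdegAdjoin K X₂ ≤ trdegAdjoin K X₁ + (m * (vertDim β α - m) : ℕ) := by
    simpa only [card_vCoord] using trdegAdjoin_union_echelon_le X₁ Y₁.projMatrix ha hechelon
  have hX₃ : trdegAdjoin K X₃ ≤ trdegAdjoin K X₂ +
      (m * Module.finrank L (LinearMap.ker (dMoment N' S)) : ℕ) := by
    simpa using trdegAdjoin_union_iUnion_le (K := K) X₂
      (fun k => Set.range (Y₂.cocycle k).entries)
      (fun _ => Module.finrank L (LinearMap.ker (dMoment N' S))) fun k X' hX' =>
        trdegAdjoin_union_cocycle_le X' (hN₂.trans hX') (hS₂.trans hX') (Y₂.dMoment_cocycle hM k)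
  have hM₃ : trdegAdjoin K (X ∪ Set.range (RArr.entries M)) ≤ trdegAdjoin K X₃ :=
    Y₂.trdegAdjoin_union_range_entries_le
      (IntermediateField.adjoin.mono _ _ _ (Set.subset_union_right.trans Set.subset_union_left))
      ((Set.subset_union_left.trans Set.subset_union_left).trans Set.subset_union_left)
      hincl hretr hsect (fun k i x y => hY ▸ hproj k i x y) (hN₂.trans Set.subset_union_left)
      (hS₂.trans Set.subset_union_left) fun k =>
        (Set.subset_iUnion (fun k => Set.range (Y₂.cocycle k).entries) k).trans
          Set.subset_union_right
  refine hM₃.trans (hX₃.trans ?_)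
  rw [Nat.cast_add, ← add_assoc]
  gcongr

end Layer

/-- The slack in the parameter count of a filtration, at a brick with `p = c` whose topmost
multiplicity is `n`; it is chosen so that `two_mul_mul_add_defect_le` holds. -/
def defect (c : ℤ) (n : ℕ) : ℤ := if c = 0 ∨ n = 0 then 0 else -2 * c + 1 - n ^ 2

theorem two_mul_mul_add_defect_le {c : ℤ} (hc : 0 ≤ c) {m n l : ℕ} (hm : 0 < m) (hn : n ≤ l)
    (h0 : c = 0 → n = 0) :
    2 * m * n + defect c l ≤ 2 * c * m ^ 2 + defect c m := by
  unfold defect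
  rcases eq_or_ne c 0 with rfl | hc0
  · simp [h0 rfl]
  have hc1 : 1 ≤ c := by omega
  have : (1 : ℤ) ≤ m := by exact_mod_cast hm
  rcases eq_or_ne l 0 with rfl | hl
  · obtain rfl : n = 0 := by omega
    simp only [hc0, hm.ne', or_self, or_true, if_true, if_false]
    have hmul : 0 ≤ (2 * c - 1) * ((m : ℤ) ^ 2 - 1) :=
      mul_nonneg (by omega) (by nlinarith)
    push_cast
    nlinarith
  · simp only [hc0, hm.ne', hl, or_self, if_false]
    have : (n : ℤ) ≤ l := by exact_mod_cast hn
    nlinarith [sq_nonneg ((m : ℤ) - l)]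

theorem defect_le {c : ℤ} (hc : 0 ≤ c) {n : ℕ} (hn : 0 < n) : defect c n ≤ -2 * c := by
  unfold defect
  rcases eq_or_ne c 0 with rfl | hc0
  · simp
  · simp only [hc0, hn.ne', or_self, if_false]
    have : (1 : ℤ) ≤ n := by exact_mod_cast hn
    nlinarith

theorem sum_defect_cons {r : ℕ} (c : Fin r → ℤ) (t : Fin r) (m : ℕ) (l : List (Fin r × ℕ)) :
    ∑ s, defect (c s) (firstMult s ((t, m) :: l)) =
      ∑ s, defect (c s) (firstMult s l) - defect (c t) (firstMult t l) + defect (c t) m := by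
  have hne : ∀ s ∈ Finset.univ.erase t, defect (c s) (firstMult s ((t, m) :: l)) =
      defect (c s) (firstMult s l) := fun s hs => by
    simp only [firstMult, if_neg (Finset.ne_of_mem_erase hs).symm]
  rw [← Finset.add_sum_erase _ _ (Finset.mem_univ t),
    ← Finset.add_sum_erase (a := t) (f := fun s => defect (c s) (firstMult s l)) _
      (Finset.mem_univ t), Finset.sum_congr rfl hne]
  simp only [firstMult, if_true]
  ring

variable [Fintype I] [∀ i j : I, Fintype (i ⟶ j)] {r : ℕ} {β : Fin r → I → ℕ}
  {S : ∀ t, DRep L (β t)} {X : Set L}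

theorem Layer.arrDim_add_defect_le (hS : OrthBricks S) {l : List (Fin r × ℕ)} {t : Fin r} {m : ℕ}
    (hm : 0 < m) {M : DRep L α} {N : DRep L α'} (hN : TopFilt S l α' N) (Y : Layer (S t) m M N)
    (hM : ∀ i, moment M i = 0) (hmV : m ≤ vertDim (β t) α) :
    arrDim α' α' + ∑ s, defect (p (β s)) (firstMult s l) + 2 * ((m * (vertDim (β t) α - m) +
        m * Module.finrank L (LinearMap.ker (dMoment N (S t))) : ℕ) : ℤ) ≤
      arrDim α α + ∑ s, defect (p (β s)) (firstMult s ((t, m) :: l)) := by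
  have hker := finrank_ker_dMoment_add_le N (S t)
  have hrigid (hp : p (β t) = 0) : Module.finrank L (homSpace N (S t)) = 0 :=
    (hS.isBrick t).finrank_homSpace_eq_zero hp Y hM
  have hdefect := two_mul_mul_add_defect_le (hS.isBrick t).p_nonneg hm
    (hN.finrank_homSpace_le hS t) hrigid
  have hvert : vertDim (β t) α = vertDim α' (β t) + m * vertDim (β t) (β t) := by
    rw [funext Y.dim_eq, vertDim_add_mul]
  have harr : arrDim α α = arrDim α' α' + 2 * m * arrDim α' (β t) +
      m ^ 2 * arrDim (β t) (β t) := by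
    rw [funext Y.dim_eq, arrDim_add_mul]
  have hp := two_mul_p (β t)
  rw [sum_defect_cons, harr]
  zify [hmV] at hker hvert ⊢
  rw [hvert]
  have hkerm := mul_le_mul_of_nonneg_left hker (Nat.cast_nonneg (α := ℤ) m)
  have hpm := congrArg (fun c => (m : ℤ) ^ 2 * c) hp
  nlinarith [hkerm, hpm, hdefect]

theorem TopFilt.exists_trdegAdjoin_le (hS : OrthBricks S)
    (hX : ∀ t, Set.range (RArr.entries (S t)) ⊆ X) {l : List (Fin r × ℕ)} {α : I → ℕ}
    {M : DRep L α} (h : TopFilt S l α M) (hM : ∀ i, moment M i = 0) :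
    ∃ d : ℕ, trdegAdjoin K (X ∪ Set.range (RArr.entries M)) ≤ trdegAdjoin K X + d ∧
      2 * (d : ℤ) ≤ arrDim α α + ∑ t, defect (p (β t)) (firstMult t l) := by
  induction l generalizing α with
  | nil =>
    refine ⟨0, ?_, by simp [firstMult, defect]⟩
    have : IsEmpty (RCoord α α) := ⟨fun c => Fin.elim0 (h c.2.1 ▸ c.2.2.2.1)⟩
    rw [Set.range_eq_empty, Set.union_empty, Nat.cast_zero, add_zero]
  | cons a l ih =>
    obtain ⟨t, m⟩ := a
    obtain ⟨hm, α', N, hN, ⟨Y⟩⟩ := h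
    obtain ⟨N', Y₁, Y₂, hY, hmV, hle⟩ :=
      Y.exists_trdegAdjoin_le (K := K) (hS.isBrick t).exists_pos hM (hX t)
    have hN' : TopFilt S l α' N' := hN.congr (Y₁.kernelIso Y₂ hY)
    obtain ⟨d, hd, hd2⟩ := ih hN' (Y₂.moment_sub hM)
    refine ⟨d + (m * (vertDim (β t) α - m) +
      m * Module.finrank L (LinearMap.ker (dMoment N' (S t)))), ?_, ?_⟩
    · rw [Nat.cast_add d, ← add_assoc]
      exact hle.trans (add_le_add_left hd _)
    · have hcount := Y₂.arrDim_add_defect_le hS hm hN' hM hmV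
      rw [Nat.cast_add d]
      linarith

theorem TopFilt.trdegAdjoin_le (hS : OrthBricks S)
    (hX : ∀ t, Set.range (RArr.entries (S t)) ⊆ X) {l : List (Fin r × ℕ)} {α : I → ℕ}
    {M : DRep L α} (h : TopFilt S l α M) (hl : ∀ t, 0 < firstMult t l)
    (hM : ∀ i, moment M i = 0) :
    ∃ d : ℕ, trdegAdjoin K (X ∪ Set.range (RArr.entries M)) ≤ trdegAdjoin K X + d ∧
      (d : ℤ) ≤ dotSelf α - 1 + p α - ∑ t, p (β t) := by
  obtain ⟨d, hd, hd2⟩ := h.exists_trdegAdjoin_le (K := K) hS hX hM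
  refine ⟨d, hd, ?_⟩
  have hdefect : ∑ t, defect (p (β t)) (firstMult t l) ≤ ∑ t, (-2 * p (β t)) :=
    Finset.sum_le_sum fun t _ => defect_le (hS.isBrick t).p_nonneg (hl t)
  rw [← Finset.mul_sum] at hdefect
  rw [← two_mul_dotSelf_sub_q α] at hd2
  rw [p]
  linarith

end Count

/-! ### Germs of representations -/

universe ww

section Germs

variable {K : Type w} [Field K] {Ω : Type w'} {L : Type ww} [Field L] [Algebra K L]
  (π : (Ω → K) →ₐ[K] L)

/-- The germ of a family of matrices. -/
def matGerm {m n : ℕ} (A : Ω → Matrix (Fin m) (Fin n) K) : Matrix (Fin m) (Fin n) L :=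
  Matrix.of fun a b => π fun ω => A ω a b

theorem matGerm_mul {l m n : ℕ} (A : Ω → Matrix (Fin l) (Fin m) K)
    (B : Ω → Matrix (Fin m) (Fin n) K) :
    matGerm π (fun ω => A ω * B ω) = matGerm π A * matGerm π B := by
  ext a b
  simp only [matGerm, Matrix.of_apply, Matrix.mul_apply, ← map_mul, ← map_sum]
  congr 1
  funext ω
  simp only [Finset.sum_apply, Pi.mul_apply]

theorem matGerm_add {m n : ℕ} (A B : Ω → Matrix (Fin m) (Fin n) K) :
    matGerm π (fun ω => A ω + B ω) = matGerm π A + matGerm π B := by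
  ext a b
  exact map_add π (fun ω => A ω a b) fun ω => B ω a b

theorem matGerm_smul {m n : ℕ} (c : Ω → K) (A : Ω → Matrix (Fin m) (Fin n) K) :
    matGerm π (fun ω => c ω • A ω) = π c • matGerm π A := by
  ext a b
  exact map_mul π c fun ω => A ω a b

theorem matGerm_zero {m n : ℕ} : matGerm π (fun _ => (0 : Matrix (Fin m) (Fin n) K)) = 0 :=
  Matrix.ext fun _ _ => map_zero π

theorem matGerm_one {n : ℕ} : matGerm π (fun _ => (1 : Matrix (Fin n) (Fin n) K)) = 1 := by
  ext a b
  rcases eq_or_ne a b with rfl | h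
  · simp only [matGerm, Matrix.of_apply, Matrix.one_apply_eq]
    exact map_one π
  · simp only [matGerm, Matrix.of_apply, Matrix.one_apply_ne h]
    exact map_zero π

theorem matGerm_sum {τ : Type*} (s : Finset τ) {m n : ℕ} (A : τ → Ω → Matrix (Fin m) (Fin n) K) :
    matGerm π (fun ω => ∑ t ∈ s, A t ω) = ∑ t ∈ s, matGerm π (A t) := by
  classical
  induction s using Finset.induction_on with
  | empty => simp only [Finset.sum_empty, matGerm_zero]
  | insert t s hts ih => simp only [Finset.sum_insert hts, matGerm_add, ih]

variable {π} {U : Ultrafilter Ω}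

theorem IsUltrapower.eq_iff (hπ : IsUltrapower U π) (f g : Ω → K) :
    π f = π g ↔ ∀ᶠ ω in U, f ω = g ω := by
  rw [← sub_eq_zero, ← map_sub, hπ.eq_zero_iff]
  simp only [Pi.sub_apply, sub_eq_zero]

theorem IsUltrapower.matGerm_eq_iff (hπ : IsUltrapower U π) {m n : ℕ}
    (A B : Ω → Matrix (Fin m) (Fin n) K) :
    matGerm π A = matGerm π B ↔ ∀ᶠ ω in U, A ω = B ω := by
  simp only [← Matrix.ext_iff, matGerm, Matrix.of_apply, hπ.eq_iff, Filter.eventually_all]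

variable (π)
variable {I : Type u} {α α' β γ : I → ℕ}

/-- The germ of a family of vertex matrices. -/
def vertGerm (X : Ω → VMat K α β) : VMat L α β := fun i => matGerm π fun ω => X ω i

variable {π}

theorem vertGerm_surjective (hπ : Function.Surjective π) :
    Function.Surjective (vertGerm π : (Ω → VMat K α β) → VMat L α β) := by
  choose f hf using hπ
  refine fun X => ⟨fun ω i => Matrix.of fun a b => f (X i a b) ω, ?_⟩
  funext i
  ext a b
  exact hf _

theorem IsUltrapower.exists_eq_sum_smul_vertGerm (hπ : IsUltrapower U π) {m : ℕ}
    {P : Ω → Fin m → VMat K β α} {X : Ω → VMat K β α}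
    (hX : ∀ᶠ ω in U, ∃ c : Fin m → K, X ω = ∑ k, c k • P ω k) :
    ∃ c : Fin m → L, vertGerm π X = ∑ k, c k • vertGerm π fun ω => P ω k := by
  obtain ⟨c, hc⟩ := hX.choice
  refine ⟨fun k => π fun ω => c ω k, funext fun i => ?_⟩
  simp only [Finset.sum_apply, Pi.smul_apply, vertGerm]
  simp only [← matGerm_smul]
  rw [← matGerm_sum, hπ.matGerm_eq_iff]
  filter_upwards [hc] with ω hω
  simp only [hω, Finset.sum_apply, Pi.smul_apply]

variable [Quiver.{v} I]

variable (π) in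
/-- The germ of a family of representations. -/
def arrGerm (x : Ω → RArr K α β) : RArr L α β := fun i j e => matGerm π fun ω => x ω i j e

theorem range_entries_arrGerm_const_subset (M : RArr K α β) :
    Set.range (RArr.entries (arrGerm π fun _ => M)) ⊆ Set.range (algebraMap K L) := by
  rintro _ ⟨c, rfl⟩
  exact ⟨M.entries c, (π.commutes _).symm⟩

theorem isHom_vertGerm {M : Ω → DRep K α} {S : Ω → DRep K β} {X : Ω → VMat K β α}
    (h : ∀ ω, IsHom (M ω) (S ω) (X ω)) : IsHom (arrGerm π M) (arrGerm π S) (vertGerm π X) := by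
  intro i j e
  simp only [arrGerm, vertGerm, ← matGerm_mul, h _ i j e]

theorem IsUltrapower.isHom_iff (hπ : IsUltrapower U π) [Finite I] [∀ i j : I, Finite (i ⟶ j)]
    (M : Ω → DRep K α) (S : Ω → DRep K β) (X : Ω → VMat K β α) :
    IsHom (arrGerm π M) (arrGerm π S) (vertGerm π X) ↔ ∀ᶠ ω in U, IsHom (M ω) (S ω) (X ω) := by
  simp only [IsHom, arrGerm, vertGerm, ← matGerm_mul, hπ.matGerm_eq_iff, Filter.eventually_all]

/-- The germ of a family of isomorphisms. -/
def RepIso.germ (π : (Ω → K) →ₐ[K] L) {M M' : Ω → DRep K α} (f : ∀ ω, RepIso (M ω) (M' ω)) :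
    RepIso (arrGerm π M) (arrGerm π M') where
  hom := vertGerm π fun ω => (f ω).hom
  inv := vertGerm π fun ω => (f ω).inv
  hom_inv i := by simp only [vertGerm, ← matGerm_mul, RepIso.hom_inv, matGerm_one]
  inv_hom i := by simp only [vertGerm, ← matGerm_mul, RepIso.inv_hom, matGerm_one]
  isHom_hom := isHom_vertGerm fun ω => (f ω).isHom_hom
  isHom_inv := isHom_vertGerm fun ω => (f ω).isHom_inv

section Layer

variable {S : Ω → DRep K β} {m : ℕ} {M : Ω → DRep K α} {N : Ω → DRep K α'}

/-- The germ of a family of layers. -/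
def IsUltrapower.layer (hπ : IsUltrapower U π) [Finite I] [∀ i j : I, Finite (i ⟶ j)]
    (Y : ∀ ω, Layer (S ω) m (M ω) (N ω)) :
    Layer (arrGerm π S) m (arrGerm π M) (arrGerm π N) where
  proj k := vertGerm π fun ω => (Y ω).proj k
  incl := vertGerm π fun ω => (Y ω).incl
  retr := vertGerm π fun ω => (Y ω).retr
  sect k := vertGerm π fun ω => (Y ω).sect k
  dim_eq := (U.neBot.nonempty.elim fun ω => (Y ω).dim_eq)
  retr_incl i := by simp only [vertGerm, ← matGerm_mul, Layer.retr_incl, matGerm_one]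
  proj_incl k i := by simp only [vertGerm, ← matGerm_mul, Layer.proj_incl, matGerm_zero]
  retr_sect k i := by simp only [vertGerm, ← matGerm_mul, Layer.retr_sect, matGerm_zero]
  proj_sect k l i := by
    simp only [vertGerm, ← matGerm_mul, Layer.proj_sect]
    split_ifs
    · exact matGerm_one π
    · exact matGerm_zero π
  sum_eq i := by
    simp only [vertGerm, ← matGerm_mul, ← matGerm_sum, ← matGerm_add, Layer.sum_eq, matGerm_one]
  incl_hom := isHom_vertGerm fun ω => (Y ω).incl_hom
  proj_hom k := isHom_vertGerm fun ω => (Y ω).proj_hom k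
  full X hX := by
    obtain ⟨x, rfl⟩ := vertGerm_surjective hπ.surjective X
    rw [hπ.isHom_iff] at hX
    exact hπ.exists_eq_sum_smul_vertGerm (hX.mono fun ω => (Y ω).full (x ω))

theorem Layer.tail_dim_eq {K : Type*} [Field K] {S : DRep K β} {m : ℕ} {M : DRep K α}
    {N : DRep K α'} (Y : Layer S m M N) : α' = fun i => α i - m * β i :=
  funext fun i => by rw [Y.dim_eq i, Nat.add_sub_cancel]

end Layer

section Bricks

variable [Fintype I] [∀ i j : I, Fintype (i ⟶ j)]

theorem bimoment_arrGerm (x : Ω → RArr K α γ) (y : Ω → RArr K γ β) :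
    bimoment (arrGerm π x) (arrGerm π y) = vertGerm π fun ω => bimoment (x ω) (y ω) := by
  let x' : RArr (Ω → K) α γ := fun i j e => Matrix.of fun a b ω => x ω i j e a b
  let y' : RArr (Ω → K) γ β := fun i j e => Matrix.of fun a b ω => y ω i j e a b
  refine (map_bimoment (π : (Ω → K) →+* L) x' y').symm.trans ?_
  funext i
  ext a b
  refine congrArg π (funext fun ω => ?_)
  exact congrFun (congrFun (congrFun
    (map_bimoment (Pi.evalRingHom (fun _ : Ω => K) ω) x' y') i) a) b

theorem moment_arrGerm (π : (Ω → K) →ₐ[K] L) {M : Ω → DRep K α} (h : ∀ ω i, moment (M ω) i = 0)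
    (i : I) : moment (arrGerm π M) i = 0 := by
  simp only [moment_eq_bimoment] at h ⊢
  simp only [bimoment_arrGerm, vertGerm, h, matGerm_zero]

theorem IsUltrapower.isBrick (hπ : IsUltrapower U π) {S : Ω → DRep K β}
    (h : ∀ ω, IsBrick (S ω)) : IsBrick (arrGerm π S) where
  moment_eq := moment_arrGerm π fun ω => (h ω).moment_eq
  exists_pos := U.neBot.nonempty.elim fun ω => (h ω).exists_pos
  hom_self X hX := by
    obtain ⟨x, rfl⟩ := vertGerm_surjective hπ.surjective X
    rw [hπ.isHom_iff] at hX
    obtain ⟨c, hc⟩ := (hX.mono fun ω => (h ω).hom_self (x ω)).choice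
    refine ⟨π c, funext fun i => ?_⟩
    rw [vertGerm, ← matGerm_one π, ← matGerm_smul, hπ.matGerm_eq_iff]
    exact hc.mono fun ω hω => congrFun hω i

theorem IsBrick.congr {S S' : DRep K β} (h : IsBrick S) (f : RepIso S S') : IsBrick S' where
  moment_eq i := by
    have hmid : (fun i j e => S' i j e * f.hom i : RArr K β β) =
        fun i j e => f.hom j * S i j e := by
      funext i j e
      exact (f.isHom_hom i j e).symm
    have hmul : moment S' i * f.hom i = 0 := by
      rw [moment_eq_bimoment, ← bimoment_mul_right, hmid, ← bimoment_mul_middle, hmid,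
        bimoment_mul_left, ← moment_eq_bimoment, h.moment_eq, Matrix.mul_zero]
    rw [← Matrix.mul_one (moment S' i), ← f.hom_inv i, ← Matrix.mul_assoc, hmul, Matrix.zero_mul]
  exists_pos := h.exists_pos
  hom_self X hX := by
    obtain ⟨c, hc⟩ := h.hom_self _ (f.isHom_inv.comp (hX.comp f.isHom_hom))
    refine ⟨c, funext fun i => ?_⟩
    calc X i = f.hom i * (f.inv i * (X i * f.hom i)) * f.inv i := by
          rw [← Matrix.mul_assoc (f.hom i), f.hom_inv, Matrix.one_mul, Matrix.mul_assoc, f.hom_inv,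
            Matrix.mul_one]
      _ = c • 1 := by
          rw [congrFun hc i, Matrix.mul_smul, Matrix.smul_mul, Matrix.mul_one, f.hom_inv]

theorem IsBrick.finrank_homSpace_le_one {S S' : DRep K β} (hS : IsBrick S) (f : RepIso S S') :
    Module.finrank K (homSpace S S') ≤ 1 := by
  refine finrank_le_one (R := K) ⟨f.hom, mem_homSpace.2 f.isHom_hom⟩ ?_
  rintro ⟨X, hX⟩
  obtain ⟨c, hc⟩ := hS.hom_self _ (f.isHom_inv.comp (mem_homSpace.1 hX))
  refine ⟨c, Subtype.ext (funext fun i => ?_)⟩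
  change c • f.hom i = X i
  rw [← Matrix.one_mul (X i), ← f.hom_inv, Matrix.mul_assoc, congrFun hc i, Matrix.mul_smul,
    Matrix.mul_one]

variable {r : ℕ} {β : Fin r → I → ℕ}

theorem IsUltrapower.orthBricks (hπ : IsUltrapower U π) {S : Ω → ∀ t, DRep K (β t)}
    (h : ∀ ω, OrthBricks (S ω)) : OrthBricks (fun t => arrGerm π fun ω => S ω t) where
  isBrick t := hπ.isBrick fun ω => (h ω).isBrick t
  hom_ne s t hst X hX := by
    obtain ⟨x, rfl⟩ := vertGerm_surjective hπ.surjective X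
    rw [hπ.isHom_iff] at hX
    funext i
    rw [Pi.zero_apply, vertGerm, ← matGerm_zero π, hπ.matGerm_eq_iff]
    exact hX.mono fun ω hω => congrFun ((h ω).hom_ne s t hst _ hω) i

theorem OrthBricks.congr {S S' : ∀ t, DRep K (β t)} (h : OrthBricks S)
    (f : ∀ t, RepIso (S t) (S' t)) : OrthBricks S' where
  isBrick t := (h.isBrick t).congr (f t)
  hom_ne s t hst X hX := by
    have hzero := h.hom_ne s t hst _ ((f t).isHom_inv.comp (hX.comp (f s).isHom_hom))
    funext i
    calc X i = (f t).hom i * ((f t).inv i * (X i * (f s).hom i)) * (f s).inv i := by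
          rw [← Matrix.mul_assoc ((f t).hom i), (f t).hom_inv, Matrix.one_mul, Matrix.mul_assoc,
            (f s).hom_inv, Matrix.mul_one]
      _ = 0 := by rw [congrFun hzero i, Pi.zero_apply, Matrix.mul_zero, Matrix.zero_mul]

end Bricks

section Filtration

variable [Finite I] [∀ i j : I, Finite (i ⟶ j)] {r : ℕ} {β : Fin r → I → ℕ}
  {S : Ω → ∀ t, DRep K (β t)} {l : List (Fin r × ℕ)}

theorem IsUltrapower.topFilt_of_forall (hπ : IsUltrapower U π) {α : I → ℕ} {M : Ω → DRep K α}
    (h : ∀ ω, TopFilt (S ω) l α (M ω)) :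
    TopFilt (fun t => arrGerm π fun ω => S ω t) l α (arrGerm π M) := by
  obtain ⟨ω₀⟩ := U.neBot.nonempty
  induction l generalizing α with
  | nil => exact h ω₀
  | cons a l ih =>
    obtain ⟨t, m⟩ := a
    have htail (ω) : ∃ N : DRep K (fun i => α i - m * β t i),
        TopFilt (S ω) l _ N ∧ Nonempty (Layer (S ω t) m (M ω) N) := by
      obtain ⟨_, α', N, hN, ⟨Y⟩⟩ := h ω
      obtain rfl := Y.tail_dim_eq
      exact ⟨N, hN, ⟨Y⟩⟩
    choose N hN hY using htail
    exact ⟨(h ω₀).1, _, arrGerm π N, ih hN, ⟨hπ.layer fun ω => (hY ω).some⟩⟩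

theorem IsUltrapower.topFilt (hπ : IsUltrapower U π) {M : Ω → DRep K α}
    (h : ∀ᶠ ω in U, TopFilt (S ω) l α (M ω)) :
    TopFilt (fun t => arrGerm π fun ω => S ω t) l α (arrGerm π M) := by
  classical
  obtain ⟨ω₀, hω₀⟩ := h.exists
  let f (ω : Ω) : Ω := if TopFilt (S ω) l α (M ω) then ω else ω₀
  have hf (ω) : TopFilt (S (f ω)) l α (M (f ω)) := by
    by_cases hω : TopFilt (S ω) l α (M ω)
    · rwa [show f ω = ω from if_pos hω]
    · rwa [show f ω = ω₀ from if_neg hω]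
  have hcomp {α β : I → ℕ} (x : Ω → RArr K α β) : arrGerm π (x ∘ f) = arrGerm π x := by
    funext i j e
    refine (hπ.matGerm_eq_iff _ _).2 (h.mono fun ω hω => ?_)
    rw [Function.comp_apply, show f ω = ω from if_pos hω]
  have hS : (fun t => arrGerm π fun ω => S ω t) = fun t => arrGerm π fun ω => S (f ω) t :=
    funext fun t => (hcomp fun ω => S ω t).symm
  rw [hS, ← hcomp M]
  exact hπ.topFilt_of_forall hf

end Filtration

end Germs

/-! ### The free path algebra and trace functions -/

section Semisimple

open Polynomial in
/-- The idempotent is the projection onto the part of the Fitting decomposition on which `f` is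
invertible. -/
theorem exists_isIdempotentElem_aeval_mul_X_pow {F A : Type*} [Field F] [Ring A] [Algebra F A]
    {f : A} (hf : IsIntegral F f) : ∃ (n : ℕ) (a : F[X]),
      IsIdempotentElem (aeval f (a * X ^ (n + 1))) ∧ f ^ n * aeval f (a * X ^ (n + 1)) = f ^ n := by
  obtain ⟨g, hg, hX⟩ := exists_eq_pow_rootMultiplicity_mul_and_not_dvd _ (minpoly.ne_zero hf) 0
  set n := rootMultiplicity 0 (minpoly F f)
  rw [C_0, sub_zero] at hg hX
  have hcoprime : IsCoprime ((X : F[X]) ^ (n + 1)) g :=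
    (irreducible_X.coprime_iff_not_dvd.2 hX).pow_left
  obtain ⟨a, b, hab⟩ := hcoprime
  have hsum : aeval f (b * g) = 1 - aeval f (a * X ^ (n + 1)) := by
    rw [eq_sub_iff_add_eq', ← map_add, hab, map_one]
  have hmul : f ^ n * aeval f (b * g) = 0 := by
    rw [← aeval_X_pow (R := F) f (n := n), ← map_mul, mul_left_comm, ← hg, map_mul, minpoly.aeval,
      mul_zero]
  have hfactor : aeval f (a * X ^ (n + 1)) = aeval f (a * X) * f ^ n := by
    rw [pow_succ', ← mul_assoc, map_mul, aeval_X_pow]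
  refine ⟨n, a, ?_, ?_⟩
  · have hzero : aeval f (a * X ^ (n + 1)) * aeval f (b * g) = 0 := by
      rw [hfactor, mul_assoc, hmul, mul_zero]
    rw [hsum, mul_sub, mul_one, sub_eq_zero] at hzero
    exact hzero.symm
  · rw [hsum, mul_sub, mul_one, sub_eq_zero] at hmul
    exact hmul.symm

open Polynomial in
theorem trace_aeval_mul_X_pow_eq_zero {R V : Type*} [CommRing R] [AddCommGroup V] [Module R V]
    {f : Module.End R V} (h : ∀ j, LinearMap.trace R V (f ^ (j + 1)) = 0) (a : R[X]) (n : ℕ) :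
    LinearMap.trace R V (aeval f (a * X ^ (n + 1))) = 0 := by
  induction a using Polynomial.induction_on' with
  | add p q hp hq => rw [add_mul, map_add, map_add, hp, hq, add_zero]
  | monomial m c =>
    rw [← C_mul_X_pow_eq_monomial, mul_assoc, ← pow_add, map_mul, aeval_C, aeval_X_pow,
      ← Algebra.smul_def, map_smul, ← add_assoc, h, smul_zero]

theorem isNilpotent_of_trace_pow_eq_zero {F V : Type*} [Field F] [CharZero F] [AddCommGroup V]
    [Module F V] [Module.Finite F V] {f : Module.End F V}
    (h : ∀ j, LinearMap.trace F V (f ^ (j + 1)) = 0) : IsNilpotent f := by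
  obtain ⟨n, a, hidem, hpow⟩ :=
    exists_isIdempotentElem_aeval_mul_X_pow (Algebra.IsIntegral.isIntegral (R := F) f)
  refine ⟨n, ?_⟩
  rw [← hpow, LinearMap.IsIdempotentElem.eq_zero_of_trace_eq_zero hidem
    (trace_aeval_mul_X_pow_eq_zero h a n), mul_zero]

section Product

variable {A P Q : Type*} [Ring A] [AddCommGroup P] [Module A P] [AddCommGroup Q] [Module A Q]

theorem isSemisimpleModule_prod [IsSemisimpleModule A P] [IsSemisimpleModule A Q] :
    IsSemisimpleModule A (P × Q) := by
  refine isSemisimpleModule_of_isSemisimpleModule_submodule' (ι := Bool)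
    (p := fun b => cond b (LinearMap.range (LinearMap.inl A P Q))
      (LinearMap.range (LinearMap.inr A P Q))) ?_ ?_
  · rintro (_ | _)
    · exact IsSemisimpleModule.range _
    · exact IsSemisimpleModule.range _
  · rw [iSup_bool_eq]
    exact LinearMap.sup_range_inl_inr

theorem end_prod_apply_fst_zero (hPQ : ∀ f : P →ₗ[A] Q, f = 0) (hQP : ∀ f : Q →ₗ[A] P, f = 0)
    (g : Module.End A (P × Q)) (z : P × Q) : g (z.1, 0) = ((g z).1, 0) := by
  have hsnd : (g (z.1, 0)).2 = 0 :=
    DFunLike.congr_fun (hPQ (LinearMap.snd A P Q ∘ₗ g ∘ₗ LinearMap.inl A P Q)) z.1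
  have hfst : (g (0, z.2)).1 = 0 :=
    DFunLike.congr_fun (hQP (LinearMap.fst A P Q ∘ₗ g ∘ₗ LinearMap.inr A P Q)) z.2
  have hsum : g z = g (z.1, 0) + g (0, z.2) := by rw [← map_add]; simp
  ext
  · simp [hsum, hfst]
  · simp [hsnd]

/-- The projection of `P × Q` onto `P` commutes with all endomorphisms, so the density theorem
applies to it. -/
theorem exists_smul_eq_self_and_eq_zero [IsSemisimpleModule A P] [IsSemisimpleModule A Q]
    (hPQ : ∀ f : P →ₗ[A] Q, f = 0) (hQP : ∀ f : Q →ₗ[A] P, f = 0) (s : Finset P) (s' : Finset Q) :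
    ∃ a : A, (∀ x ∈ s, a • x = x) ∧ ∀ y ∈ s', a • y = 0 := by
  classical
  have := isSemisimpleModule_prod (A := A) (P := P) (Q := Q)
  let f : Module.End (Module.End A (P × Q)) (P × Q) :=
    { toFun := fun z => (z.1, 0)
      map_add' := fun z z' => by simp
      map_smul' := fun g z => (end_prod_apply_fst_zero hPQ hQP g z).symm }
  obtain ⟨a, ha⟩ := jacobson_density f
    (s.image (fun x => (x, (0 : Q))) ∪ s'.image (fun y => ((0 : P), y)))
  refine ⟨a, fun x hx => ?_, fun y hy => ?_⟩
  · have hax := ha (x, 0) (Finset.mem_union_left _ (Finset.mem_image_of_mem _ hx))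
    exact (congrArg Prod.fst hax).symm
  · have hay := ha (0, y) (Finset.mem_union_right _ (Finset.mem_image_of_mem _ hy))
    exact (congrArg Prod.snd hay).symm

end Product

end Semisimple

section Modules

variable {I : Type u} {K : Type w} [Field K] {α β : I → ℕ}

namespace VMat

/-- The action of a family of vertex matrices on families of column vectors. -/
def toLin (X : VMat K β α) : (∀ i, Fin (α i) → K) →ₗ[K] (∀ i, Fin (β i) → K) :=
  LinearMap.pi fun i => (X i).mulVecLin ∘ₗ LinearMap.proj i

@[simp] theorem toLin_apply (X : VMat K β α) (v : ∀ i, Fin (α i) → K) (i : I) :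
    X.toLin v i = Matrix.mulVec (X i) (v i) := rfl

theorem toLin_zero_apply (v : ∀ i, Fin (α i) → K) : toLin (0 : VMat K β α) v = 0 :=
  funext fun i => by rw [toLin_apply, Pi.zero_apply, Matrix.zero_mulVec, Pi.zero_apply]

open Classical in
theorem toLin_single (X : VMat K β α) (i : I) (v : Fin (α i) → K) :
    X.toLin (Pi.single i v) = Pi.single i (Matrix.mulVec (X i) v) := by
  funext j
  by_cases h : j = i
  · subst h; simp
  · simp [h]

theorem eq_of_toLin_eq {X Y : VMat K β α} (h : ∀ v, X.toLin v = Y.toLin v) : X = Y := by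
  classical
  funext i
  refine Matrix.toLin'.injective (LinearMap.ext fun v => ?_)
  have hi := congrFun (h (Pi.single i v)) i
  simpa [toLin_single] using hi

theorem mul_eq_one_of_toLin {X : VMat K β α} {Y : VMat K α β}
    (h : ∀ v, X.toLin (Y.toLin v) = v) (i : I) : X i * Y i = 1 := by
  have hone : (fun i => X i * Y i : VMat K β β) = fun i => 1 := by
    refine eq_of_toLin_eq fun v => funext fun i => ?_
    rw [toLin_apply, toLin_apply, Matrix.one_mulVec, ← Matrix.mulVec_mulVec]
    exact congrFun (h v) i
  exact congrFun hone i

end VMat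

variable [Quiver.{v} I]

/-- The free algebra on the vertices and the arrows of the double. It acts on representations
through the path algebra, so it serves in place of the latter. -/
abbrev FreePathAlgebra (K : Type w) [Field K] (I : Type u) [Quiver.{v} I] : Type (max u v w) :=
  FreeAlgebra K (I ⊕ Σ (i : I) (j : I), DArrow i j)

open Classical in
/-- The action of the free path algebra on a representation of the double. -/
noncomputable def repAct (x : DRep K α) :
    FreePathAlgebra K I →ₐ[K] Module.End K (∀ i, Fin (α i) → K) :=
  FreeAlgebra.lift K <| Sum.elim (fun i => LinearMap.single K _ i ∘ₗ LinearMap.proj i)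
    fun e => LinearMap.single K _ e.2.1 ∘ₗ (x e.1 e.2.1 e.2.2).mulVecLin ∘ₗ LinearMap.proj e.1

open Classical in
theorem repAct_vertex (x : DRep K α) (i : I) (v : ∀ i, Fin (α i) → K) :
    repAct x (FreeAlgebra.ι K (Sum.inl i)) v = Pi.single i (v i) := by
  simp [repAct]

open Classical in
theorem repAct_arrow (x : DRep K α) (i j : I) (e : DArrow i j) (v : ∀ i, Fin (α i) → K) :
    repAct x (FreeAlgebra.ι K (Sum.inr ⟨i, j, e⟩)) v =
      Pi.single j (Matrix.mulVec (x i j e) (v i)) := by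
  simp [repAct]

theorem IsHom.toLin_repAct {M : DRep K α} {S : DRep K β} {X : VMat K β α} (hX : IsHom M S X)
    (a : FreePathAlgebra K I) : ∀ v, X.toLin (repAct M a v) = repAct S a (X.toLin v) := by
  classical
  induction a using FreeAlgebra.induction with
  | grade0 c => intro v; simp [AlgHom.commutes, Module.algebraMap_end_apply]
  | grade1 g =>
    intro v
    rcases g with i | ⟨i, j, e⟩
    · rw [repAct_vertex, repAct_vertex, VMat.toLin_single]; rfl
    · rw [repAct_arrow, repAct_arrow, VMat.toLin_single, Matrix.mulVec_mulVec, hX,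
        ← Matrix.mulVec_mulVec]; rfl
  | mul a b ha hb => intro v; rw [map_mul, map_mul, Module.End.mul_apply, ha, hb]; rfl
  | add a b ha hb =>
    intro v
    rw [map_add, map_add, LinearMap.add_apply, map_add, ha, hb]; rfl

/-- The space of a representation, as a module over the free path algebra. -/
def RepMod (_ : DRep K α) : Type (max u w) := ∀ i, Fin (α i) → K

namespace RepMod

instance (x : DRep K α) : AddCommGroup (RepMod x) :=
  inferInstanceAs (AddCommGroup (∀ i, Fin (α i) → K))

instance (x : DRep K α) : Module K (RepMod x) :=
  inferInstanceAs (Module K (∀ i, Fin (α i) → K))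

instance [Finite I] (x : DRep K α) : Module.Finite K (RepMod x) :=
  inferInstanceAs (Module.Finite K (∀ i, Fin (α i) → K))

noncomputable instance (x : DRep K α) : Module (FreePathAlgebra K I) (RepMod x) :=
  Module.compHom (M := ∀ i, Fin (α i) → K) (repAct x).toRingHom

theorem smul_def (x : DRep K α) (a : FreePathAlgebra K I) (v : RepMod x) :
    a • v = (repAct x a v : ∀ i, Fin (α i) → K) := rfl

instance (x : DRep K α) : IsScalarTower K (FreePathAlgebra K I) (RepMod x) where
  smul_assoc c a v := by
    rw [smul_def, map_smul]
    rfl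

theorem nontrivial (M : DRep K α) {i : I} (hi : 0 < α i) : Nontrivial (RepMod M) := by
  classical
  refine ⟨⟨(Pi.single i (fun _ => 1) : ∀ i, Fin (α i) → K), 0, fun h => ?_⟩⟩
  have hentry := congrFun (congrFun h i) ⟨0, hi⟩
  rw [Pi.single_eq_same] at hentry
  exact one_ne_zero hentry

open Classical in
theorem mem_iff_single_mem [Finite I] {M : DRep K α}
    (N : Submodule (FreePathAlgebra K I) (RepMod M)) (w : ∀ i, Fin (α i) → K) :
    w ∈ N ↔ ∀ i, (Pi.single i (w i) : ∀ i, Fin (α i) → K) ∈ N := by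
  cases nonempty_fintype I
  refine ⟨fun hw i => ?_, fun h => ?_⟩
  · rw [← repAct_vertex M i w]
    exact N.smul_mem _ hw
  · have hsum : w = ∑ i, (Pi.single i (w i) : ∀ i, Fin (α i) → K) :=
      (Finset.univ_sum_single w).symm
    rw [hsum]
    exact Submodule.sum_mem N fun i _ => h i

open Classical in
/-- The component at the vertex `i` of a submodule. -/
noncomputable def component {M : DRep K α} (N : Submodule (FreePathAlgebra K I) (RepMod M))
    (i : I) : Submodule K (Fin (α i) → K) :=
  (N.restrictScalars K : Submodule K (RepMod M)).comap
    (LinearMap.single K (fun i => Fin (α i) → K) i)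

theorem map_mem_component {M : DRep K α} (N : Submodule (FreePathAlgebra K I) (RepMod M))
    (i j : I) (e : DArrow i j) {v : Fin (α i) → K} (hv : v ∈ component N i) :
    toLinRep M i j e v ∈ component N j := by
  classical
  have hmem : repAct M (FreeAlgebra.ι K (Sum.inr ⟨i, j, e⟩)) (Pi.single i v) ∈ N :=
    N.smul_mem _ hv
  rw [repAct_arrow, Pi.single_eq_same] at hmem
  exact hmem

end RepMod

theorem LinRep.IsSimple.exists_pos {T : DRep K β} (hT : (toLinRep T).IsSimple) : ∃ i, 0 < β i := by
  obtain ⟨⟨i, hi⟩, -⟩ := hT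
  refine ⟨i, Nat.pos_of_ne_zero fun h => ?_⟩
  have : IsEmpty (Fin (β i)) := by rw [h]; infer_instance
  exact not_subsingleton _ (inferInstance : Subsingleton (Fin (β i) → K))

theorem LinRep.IsSimple.isSimpleModule [Finite I] {T : DRep K β} (hT : (toLinRep T).IsSimple) :
    IsSimpleModule (FreePathAlgebra K I) (RepMod T) := by
  classical
  obtain ⟨i, hi⟩ := hT.exists_pos
  have := RepMod.nontrivial T hi
  rw [isSimpleModule_iff]
  refine { eq_bot_or_eq_top := fun N => ?_ }
  refine (hT.2 (RepMod.component N) fun i j e v => RepMod.map_mem_component N i j e).imp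
    (fun h => ?_) (fun h => ?_)
  · refine eq_bot_iff.2 fun w hw => (funext fun i => ?_ : w = (0 : ∀ i, Fin (β i) → K))
    have hi : w i ∈ RepMod.component N i := (RepMod.mem_iff_single_mem N w).1 hw i
    rw [h i] at hi
    exact hi
  · refine eq_top_iff.2 fun w _ => (RepMod.mem_iff_single_mem N w).2 fun i => ?_
    have hi : w i ∈ RepMod.component N i := h i ▸ Submodule.mem_top
    exact hi

/-- A homomorphism of representations, as a linear map of modules. -/
def IsHom.toLinearMap {M : DRep K α} {S : DRep K β} {X : VMat K β α} (hX : IsHom M S X) :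
    RepMod M →ₗ[FreePathAlgebra K I] RepMod S where
  toFun := X.toLin
  map_add' := map_add X.toLin
  map_smul' a v := hX.toLin_repAct a v

theorem exists_isHom_of_linearMap {M : DRep K α} {S : DRep K β}
    (f : RepMod M →ₗ[FreePathAlgebra K I] RepMod S) :
    ∃ X : VMat K β α, IsHom M S X ∧ ∀ v, f v = X.toLin v := by
  classical
  let f' : (∀ i, Fin (α i) → K) →ₗ[K] (∀ i, Fin (β i) → K) := f.restrictScalars K
  have hf (a v) : f' (repAct M a v) = repAct S a (f' v) := f.map_smul a v
  let X : VMat K β α := fun i =>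
    LinearMap.toMatrix' (LinearMap.proj i ∘ₗ f' ∘ₗ LinearMap.single K (fun i => Fin (α i) → K) i)
  have hX (v i) : f' v i = Matrix.mulVec (X i) (v i) := by
    rw [← Matrix.toLin'_apply, Matrix.toLin'_toMatrix']
    change f' v i = f' (Pi.single i (v i)) i
    rw [← repAct_vertex M i v, hf, repAct_vertex, Pi.single_eq_same]
  refine ⟨X, fun i j e => ?_, fun v => funext fun i => hX v i⟩
  refine Matrix.toLin'.injective (LinearMap.ext fun v => ?_)
  rw [Matrix.toLin'_apply, Matrix.toLin'_apply, ← Matrix.mulVec_mulVec, ← Matrix.mulVec_mulVec]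
  have harrow := congrFun (hf (FreeAlgebra.ι K (Sum.inr ⟨i, j, e⟩)) (Pi.single i v)) j
  simpa only [repAct_arrow, hX, Pi.single_eq_same] using harrow

theorem forall_linearMap_eq_zero_iff {M : DRep K α} {S : DRep K β} :
    (∀ f : RepMod M →ₗ[FreePathAlgebra K I] RepMod S, f = 0) ↔ ∀ X, IsHom M S X → X = 0 := by
  refine ⟨fun h X hX => VMat.eq_of_toLin_eq fun v => ?_, fun h f => LinearMap.ext fun v => ?_⟩
  · rw [VMat.toLin_zero_apply]
    exact DFunLike.congr_fun (h hX.toLinearMap) v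
  · obtain ⟨X, hX, hf⟩ := exists_isHom_of_linearMap f
    rw [hf, h X hX]
    exact VMat.toLin_zero_apply v

theorem iso_of_linearEquiv {S : DRep K α} {T : DRep K β}
    (f : RepMod S ≃ₗ[FreePathAlgebra K I] RepMod T) : (toLinRep S).Iso (toLinRep T) := by
  obtain ⟨X, hX, hfX⟩ := exists_isHom_of_linearMap f.toLinearMap
  obtain ⟨Y, -, hfY⟩ := exists_isHom_of_linearMap f.symm.toLinearMap
  have hXY : ∀ i, X i * Y i = 1 := VMat.mul_eq_one_of_toLin fun v =>
    ((hfX _).symm.trans (congrArg f (hfY v).symm)).trans (f.apply_symm_apply v)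
  have hYX : ∀ i, Y i * X i = 1 := VMat.mul_eq_one_of_toLin fun v =>
    ((hfY _).symm.trans (congrArg f.symm (hfX v).symm)).trans (f.symm_apply_apply v)
  refine ⟨fun i => Matrix.toLin'OfInv (hYX i) (hXY i), fun i j e v => ?_⟩
  change Matrix.mulVec (X j) (Matrix.mulVec (S i j e) v) =
    Matrix.mulVec (T i j e) (Matrix.mulVec (X i) v)
  rw [Matrix.mulVec_mulVec, Matrix.mulVec_mulVec, hX]

theorem LinRep.IsSimple.eq_smul_one_of_isHom [Finite I] [IsAlgClosed K] {T : DRep K β}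
    (hT : (toLinRep T).IsSimple) {X : VMat K β β} (hX : IsHom T T X) :
    ∃ c : K, X = fun _ => c • 1 := by
  have := hT.isSimpleModule
  obtain ⟨c, hc⟩ := (IsSimpleModule.algebraMap_end_bijective_of_isAlgClosed
    (A := FreePathAlgebra K I) (V := RepMod T) K).2 hX.toLinearMap
  refine ⟨c, VMat.eq_of_toLin_eq fun v => funext fun i => ?_⟩
  have hscalar : c • v = X.toLin v := DFunLike.congr_fun hc v
  rw [← hscalar, VMat.toLin_apply, Matrix.smul_mulVec, Matrix.one_mulVec]
  rfl

theorem LinRep.IsSimple.eq_zero_of_isHom [Finite I] {S : DRep K α} {T : DRep K β}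
    (hS : (toLinRep S).IsSimple) (hT : (toLinRep T).IsSimple)
    (hne : ¬ (toLinRep S).Iso (toLinRep T)) : ∀ X, IsHom S T X → X = 0 := by
  have := hS.isSimpleModule
  have := hT.isSimpleModule
  refine forall_linearMap_eq_zero_iff.1 fun f => ?_
  by_contra hf
  exact hne (iso_of_linearEquiv
    (LinearEquiv.ofBijective f ((LinearMap.bijective_or_eq_zero f).resolve_right hf)))

end Modules

theorem orthBricks_of_isSimple {I : Type u} [Fintype I] [Quiver.{v} I] [∀ i j : I, Fintype (i ⟶ j)]
    {K : Type w} [Field K] [IsAlgClosed K] {r : ℕ} {β : Fin r → I → ℕ} {T : ∀ t, DRep K (β t)}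
    (hmem : ∀ t, T t ∈ zeroFibre K (β t)) (hT : ∀ t, (toLinRep (T t)).IsSimple)
    (hne : ∀ s t, s ≠ t → ¬ (toLinRep (T s)).Iso (toLinRep (T t))) : OrthBricks T where
  isBrick t := ⟨hmem t, (hT t).exists_pos, fun _ hX => (hT t).eq_smul_one_of_isHom hX⟩
  hom_ne s t hst := (hT s).eq_zero_of_isHom (hT t) (hne s t hst)

section Traces

variable {I : Type u} {K : Type w} [Field K] {α β γ : I → ℕ}

namespace VMat

theorem toLin_mul (X : VMat K γ β) (Y : VMat K β α) :
    toLin (fun i => X i * Y i) = X.toLin ∘ₗ Y.toLin := by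
  refine LinearMap.ext fun v => funext fun i => ?_
  simp [Matrix.mulVec_mulVec]

theorem toLin_one : toLin (fun i => (1 : Matrix (Fin (α i)) (Fin (α i)) K)) = LinearMap.id := by
  refine LinearMap.ext fun v => funext fun i => ?_
  simp

theorem toLin_add (X Y : VMat K β α) : toLin (fun i => X i + Y i) = X.toLin + Y.toLin := by
  refine LinearMap.ext fun v => funext fun i => ?_
  simp [Matrix.add_mulVec]

theorem toLin_sum {ι : Type*} (s : Finset ι) (X : ι → VMat K β α) :
    toLin (fun i => ∑ k ∈ s, X k i) = ∑ k ∈ s, (X k).toLin := by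
  refine LinearMap.ext fun v => funext fun i => ?_
  simp [Matrix.sum_mulVec, LinearMap.sum_apply, Finset.sum_apply]

theorem toLin_sum_smul {ι : Type*} [Fintype ι] (c : ι → K) (X : ι → VMat K β α)
    (v : ∀ i, Fin (α i) → K) : toLin (∑ k, c k • X k) v = ∑ k, c k • (X k).toLin v := by
  funext i
  simp [Finset.sum_apply, Matrix.sum_mulVec, Matrix.smul_mulVec]

end VMat

variable [Quiver.{v} I]

/-- The trace of an element of the free path algebra on a representation. -/
noncomputable def repTrace (x : DRep K α) (a : FreePathAlgebra K I) : K :=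
  LinearMap.trace K (∀ i, Fin (α i) → K) (repAct x a)

theorem IsHom.toLin_comp_repAct {M : DRep K α} {S : DRep K β} {X : VMat K β α} (hX : IsHom M S X)
    (a : FreePathAlgebra K I) : X.toLin ∘ₗ repAct M a = repAct S a ∘ₗ X.toLin :=
  LinearMap.ext (hX.toLin_repAct a)

theorem repTrace_eq_zero {M : DRep K α} (h : ∀ i, α i = 0) (a : FreePathAlgebra K I) :
    repTrace M a = 0 := by
  have : ∀ i, IsEmpty (Fin (α i)) := fun i => by rw [h i]; infer_instance
  rw [repTrace, Subsingleton.elim (repAct M a) 0, map_zero]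

variable [Finite I]

theorem IsHom.trace_mul_sect_proj {M : DRep K α} {S : DRep K β} {X : VMat K β α} {Y : VMat K α β}
    (hX : IsHom M S X) (hXY : ∀ i, X i * Y i = 1) (a : FreePathAlgebra K I) :
    LinearMap.trace K (∀ i, Fin (α i) → K) (repAct M a * VMat.toLin (fun i => Y i * X i)) =
      repTrace S a := by
  rw [Module.End.mul_eq_comp, VMat.toLin_mul, ← LinearMap.comp_assoc, LinearMap.trace_comp_comm',
    ← LinearMap.comp_assoc, hX.toLin_comp_repAct, LinearMap.comp_assoc, ← VMat.toLin_mul]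
  simp only [hXY]
  rw [VMat.toLin_one, LinearMap.comp_id]
  rfl

theorem IsHom.trace_mul_incl_retr {M : DRep K α} {N : DRep K β} {X : VMat K α β} {Y : VMat K β α}
    (hX : IsHom N M X) (hYX : ∀ i, Y i * X i = 1) (a : FreePathAlgebra K I) :
    LinearMap.trace K (∀ i, Fin (α i) → K) (repAct M a * VMat.toLin (fun i => X i * Y i)) =
      repTrace N a := by
  rw [Module.End.mul_eq_comp, VMat.toLin_mul, ← LinearMap.comp_assoc, ← hX.toLin_comp_repAct,
    LinearMap.comp_assoc, LinearMap.trace_comp_comm', LinearMap.comp_assoc, ← VMat.toLin_mul]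
  simp only [hYX]
  rw [VMat.toLin_one, LinearMap.comp_id]
  rfl

theorem repTrace_eq_sum {ι : Type*} [Fintype ι] {M : DRep K α} {b : ι → I → ℕ}
    {S : ∀ k, DRep K (b k)} {X : ∀ k, VMat K (b k) α} {Y : ∀ k, VMat K α (b k)}
    (hX : ∀ k, IsHom M (S k) (X k)) (hXY : ∀ k i, X k i * Y k i = 1)
    (hsum : ∀ i, ∑ k, Y k i * X k i = 1) (a : FreePathAlgebra K I) :
    repTrace M a = ∑ k, repTrace (S k) a := by
  have hM : repAct M a = ∑ k, repAct M a * VMat.toLin (fun i => Y k i * X k i) := by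
    rw [← Finset.mul_sum, ← VMat.toLin_sum]
    simp only [hsum, VMat.toLin_one]
    exact (mul_one _).symm
  rw [repTrace, hM, map_sum]
  exact Finset.sum_congr rfl fun k _ => (hX k).trace_mul_sect_proj (hXY k) a

theorem RepIso.repTrace_eq {M M' : DRep K α} (f : RepIso M M') (a : FreePathAlgebra K I) :
    repTrace M a = repTrace M' a := by
  rw [← f.isHom_hom.trace_mul_sect_proj f.hom_inv]
  simp only [f.inv_hom, VMat.toLin_one]
  exact congrArg (LinearMap.trace K (∀ i, Fin (α i) → K)) (mul_one (repAct M a)).symm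

theorem Layer.repTrace_eq {S : DRep K β} {m : ℕ} {M : DRep K α} {N : DRep K γ}
    (Y : Layer S m M N) (a : FreePathAlgebra K I) :
    repTrace M a = repTrace N a + m * repTrace S a := by
  have hM : repAct M a = repAct M a * VMat.toLin (fun i => Y.incl i * Y.retr i) +
      ∑ k, repAct M a * VMat.toLin (fun i => Y.sect k i * Y.proj k i) := by
    rw [← Finset.mul_sum, ← mul_add, ← VMat.toLin_sum, ← VMat.toLin_add]
    simp only [Y.sum_eq, VMat.toLin_one]
    exact (mul_one _).symm
  have hsect (k) := (Y.proj_hom k).trace_mul_sect_proj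
    (fun i => (Y.proj_sect k k i).trans (if_pos rfl)) a
  rw [repTrace, hM, map_add, map_sum, Y.incl_hom.trace_mul_incl_retr Y.retr_incl,
    Finset.sum_congr rfl fun k _ => hsect k]
  simp

end Traces

section Composition

variable {I : Type u} [Finite I] [Quiver.{v} I] {K : Type w} [Field K] {α β : I → ℕ}

theorem exists_finset_repAct_eq (M : DRep K α) : ∃ s : Finset (RepMod M),
    ∀ a b : FreePathAlgebra K I, (∀ v ∈ s, a • v = b • v) → repAct M a = repAct M b := by
  obtain ⟨s, hs⟩ := Module.Finite.fg_top (R := K) (M := RepMod M)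
  exact ⟨s, fun a b h => LinearMap.ext_on hs fun v hv => h v hv⟩

variable [IsAlgClosed K]

theorem LinRep.IsSimple.repAct_surjective {T : DRep K β} (hT : (toLinRep T).IsSimple) :
    Function.Surjective (repAct T) := by
  intro φ
  have := hT.isSimpleModule
  let f : Module.End (Module.End (FreePathAlgebra K I) (RepMod T)) (RepMod T) :=
    { toFun := φ
      map_add' := φ.map_add
      map_smul' := fun g v => by
        obtain ⟨d, rfl⟩ := (IsSimpleModule.algebraMap_end_bijective_of_isAlgClosed K).2 g
        exact φ.map_smul d v }
  obtain ⟨s, hs⟩ := Module.Finite.fg_top (R := K) (M := RepMod T)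
  obtain ⟨a, ha⟩ := jacobson_density f s
  exact ⟨a, LinearMap.ext_on hs fun v hv => (ha v hv).symm⟩

/-- Linearly independent homomorphisms to a simple representation `T` are the components of
a surjection onto a power of `T`, stated here in terms of the dual spaces. -/
theorem LinRep.IsSimple.dual_eq_zero {M : DRep K α} {T : DRep K β} (hT : (toLinRep T).IsSimple)
    {κ : Type*} [Fintype κ] {P : κ → VMat K β α} (hP : ∀ k, IsHom M T (P k))
    (hlin : LinearIndependent K P) {ℓ : κ → Module.Dual K (∀ i, Fin (β i) → K)}
    (hℓ : ∀ v, ∑ k, ℓ k ((P k).toLin v) = 0) (k : κ) : ℓ k = 0 := by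
  refine LinearMap.ext fun u => Fintype.linearIndependent_iff.1 hlin (fun k => ℓ k u) ?_ k
  refine VMat.eq_of_toLin_eq fun v => ?_
  rw [VMat.toLin_sum_smul, VMat.toLin_zero_apply]
  refine (Module.forall_dual_apply_eq_zero_iff K _).1 fun η => ?_
  obtain ⟨a, ha⟩ := hT.repAct_surjective (η.smulRight u)
  calc η (∑ k, ℓ k u • (P k).toLin v) = ∑ k, ℓ k (η ((P k).toLin v) • u) := by
        simp only [map_sum, map_smul, smul_eq_mul, mul_comm]
    _ = ∑ k, ℓ k ((P k).toLin (repAct M a v)) := by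
        simp only [(hP _).toLin_repAct, ha, LinearMap.smulRight_apply]
    _ = 0 := hℓ _

theorem LinRep.IsSimple.linearIndependent_rows {M : DRep K α} {T : DRep K β}
    (hT : (toLinRep T).IsSimple) {m : ℕ} {P : Fin m → VMat K β α} (hP : ∀ k, IsHom M T (P k))
    (hlin : LinearIndependent K P) (i : I) :
    LinearIndependent K fun kb : Fin m × Fin (β i) => P kb.1 i kb.2 := by
  classical
  refine Fintype.linearIndependent_iff.2 fun g hg ⟨k, b⟩ => ?_
  let ℓ (k : Fin m) : Module.Dual K (∀ i, Fin (β i) → K) :=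
    ∑ b, g (k, b) • ((LinearMap.proj b : (Fin (β i) → K) →ₗ[K] K) ∘ₗ
      (LinearMap.proj i : (∀ i, Fin (β i) → K) →ₗ[K] Fin (β i) → K))
  have hℓ (v : ∀ i, Fin (α i) → K) : ∑ k, ℓ k ((P k).toLin v) = 0 := by
    calc ∑ k, ℓ k ((P k).toLin v)
        = (∑ kb : Fin m × Fin (β i), g kb • P kb.1 i kb.2) ⬝ᵥ v i := by
          simp [ℓ, Matrix.mulVec, sum_dotProduct, Fintype.sum_prod_type]
      _ = 0 := by rw [hg, zero_dotProduct]
  have hzero := DFunLike.congr_fun (hT.dual_eq_zero hP hlin hℓ k) (Pi.single i (Pi.single b 1))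
  simpa [ℓ, Pi.single_apply] using hzero

theorem LinRep.IsSimple.exists_layer (M : DRep K α) {T : DRep K β}
    (hT : (toLinRep T).IsSimple) : ∃ (α' : I → ℕ) (N : DRep K α'),
      Nonempty (Layer T (Module.finrank K (homSpace M T)) M N) := by
  let b := Module.finBasis K (homSpace M T)
  let P (k) : VMat K β α := (b k).1
  have hP (k) : IsHom M T (P k) := mem_homSpace.1 (b k).2
  have hlin : LinearIndependent K P :=
    b.linearIndependent.map' (homSpace M T).subtype (Submodule.ker_subtype _)
  have hrows := hT.linearIndependent_rows hP hlin
  have hdim (i) : Module.finrank K (homSpace M T) * β i ≤ α i := by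
    simpa using (hrows i).fintype_card_le_finrank
  have full (X) (hX : IsHom M T X) : ∃ c : Fin _ → K, X = ∑ k, c k • P k := by
    refine ⟨b.repr ⟨X, mem_homSpace.2 hX⟩, ?_⟩
    have hrepr := congrArg Subtype.val (b.sum_repr ⟨X, mem_homSpace.2 hX⟩)
    rw [AddSubmonoidClass.coe_finsetSum] at hrepr
    exact hrepr.symm
  obtain ⟨N, Y, -⟩ := Layer.exists_of_linearIndependent (K := K) (S := T) (M := M)
    (α' := fun i => α i - Module.finrank K (homSpace M T) * β i) ⊤ (P := P)
    (fun _ _ _ _ => IntermediateField.mem_top) (fun i => (Nat.sub_add_cancel (hdim i)).symm)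
    hrows hP full
  exact ⟨_, N, ⟨Y⟩⟩

end Composition

theorem Layer.sum_dim_lt {I : Type u} [Fintype I] [Quiver.{v} I] {K : Type w} [Field K]
    {α α' β : I → ℕ} {S : DRep K β} {m : ℕ} {M : DRep K α} {N : DRep K α'} (Y : Layer S m M N)
    (hm : 0 < m) (hβ : ∃ i, 0 < β i) : ∑ i, α' i < ∑ i, α i := by
  obtain ⟨i, hi⟩ := hβ
  refine Finset.sum_lt_sum (fun i _ => by rw [Y.dim_eq i]; omega) ⟨i, Finset.mem_univ i, ?_⟩
  have := Nat.mul_pos hm hi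
  rw [Y.dim_eq i]
  omega

theorem forall_linearMap_eq_zero_symm {A P Q : Type*} [Ring A] [AddCommGroup P] [Module A P]
    [AddCommGroup Q] [Module A Q] [IsSimpleModule A P] [IsSimpleModule A Q]
    (h : ∀ f : P →ₗ[A] Q, f = 0) (g : Q →ₗ[A] P) : g = 0 := by
  by_contra hg
  let e := LinearEquiv.ofBijective g ((LinearMap.bijective_or_eq_zero g).resolve_right hg)
  have := IsSimpleModule.nontrivial A P
  obtain ⟨x, hx⟩ := exists_ne (0 : P)
  exact hx (e.symm.map_eq_zero_iff.1 (DFunLike.congr_fun (h e.symm.toLinearMap) x))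

section Filtration

variable {I : Type u} [Quiver.{v} I] {K : Type w} [Field K] {α : I → ℕ}

theorem exists_smul_eq_self_and_repAct_eq_zero [Finite I] {ι : Type*} [Finite ι] {b : ι → I → ℕ}
    {T : ∀ t, DRep K (b t)} (hT : ∀ t, (toLinRep (T t)).IsSimple) {W : Type*} [AddCommGroup W]
    [Module (FreePathAlgebra K I) W] [IsSimpleModule (FreePathAlgebra K I) W]
    (hWT : ∀ t (f : W →ₗ[FreePathAlgebra K I] RepMod (T t)), f = 0) (s : Finset W) :
    ∃ a : FreePathAlgebra K I, (∀ x ∈ s, a • x = x) ∧ ∀ t, repAct (T t) a = 0 := by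
  classical
  cases nonempty_fintype ι
  have := fun t => (hT t).isSimpleModule
  choose s' hs' using fun t => exists_finset_repAct_eq (T t)
  obtain ⟨a, ha, ha'⟩ := exists_smul_eq_self_and_eq_zero (A := FreePathAlgebra K I) (P := W)
    (Q := ∀ t, RepMod (T t))
    (fun f => LinearMap.ext fun w => funext fun t =>
      DFunLike.congr_fun (hWT t (LinearMap.proj t ∘ₗ f)) w)
    (fun f => LinearMap.pi_ext' fun t => by
      rw [forall_linearMap_eq_zero_symm (hWT t) (f ∘ₗ _), LinearMap.zero_comp]) s
    (Finset.univ.biUnion fun t => (s' t).image fun v => Pi.single t v)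
  refine ⟨a, ha, fun t => (hs' t a 0 fun v hv => ?_).trans (map_zero _)⟩
  have hav := congrFun (ha' (Pi.single t v) (Finset.mem_biUnion.2
    ⟨t, Finset.mem_univ _, Finset.mem_image_of_mem _ hv⟩)) t
  rwa [Pi.smul_apply, Pi.single_eq_same, Pi.zero_apply, ← zero_smul (FreePathAlgebra K I) v] at hav

variable [CharZero K] {r : ℕ} {β : Fin r → I → ℕ} {T : ∀ t, DRep K (β t)}

/-- Otherwise some `a` acts as the identity on a simple quotient of `M`, but by zero on every
`T t`. Then the powers of `a` have trace zero on `M`, so that `a` acts nilpotently on `M`. -/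
theorem exists_isHom_ne_zero [Finite I] (hT : ∀ t, (toLinRep (T t)).IsSimple) {M : DRep K α}
    (hM : ∃ i, 0 < α i) {c : Fin r → K} (htr : ∀ a, repTrace M a = ∑ t, c t * repTrace (T t) a) :
    ∃ t X, IsHom M (T t) X ∧ X ≠ 0 := by
  by_contra! hno
  obtain ⟨i, hi⟩ := hM
  have := RepMod.nontrivial M hi
  have : IsNoetherian (FreePathAlgebra K I) (RepMod M) := isNoetherian_of_tower K inferInstance
  obtain ⟨N, hN, -⟩ := (eq_top_or_exists_le_coatom
    (⊥ : Submodule (FreePathAlgebra K I) (RepMod M))).resolve_left bot_ne_top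
  have : IsSimpleModule (FreePathAlgebra K I) (RepMod M ⧸ N) := isSimpleModule_iff_isCoatom.2 hN
  have := IsSimpleModule.nontrivial (FreePathAlgebra K I) (RepMod M ⧸ N)
  obtain ⟨w, hw⟩ := exists_ne (0 : RepMod M ⧸ N)
  obtain ⟨v, rfl⟩ := Submodule.mkQ_surjective N w
  obtain ⟨a, hself, hzero⟩ := exists_smul_eq_self_and_repAct_eq_zero hT
    (fun t f => Submodule.linearMap_qext N (by
      rw [LinearMap.zero_comp]
      exact forall_linearMap_eq_zero_iff.2 (hno t) _)) {N.mkQ v}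
  obtain ⟨n, hn⟩ : IsNilpotent (repAct M a) := isNilpotent_of_trace_pow_eq_zero fun j => by
    rw [← map_pow]
    refine (htr _).trans (Finset.sum_eq_zero fun t _ => ?_)
    rw [repTrace, map_pow, hzero, zero_pow (Nat.succ_ne_zero j), map_zero, mul_zero]
  have hpow (n : ℕ) : a ^ n • N.mkQ v = N.mkQ v := by
    induction n with
    | zero => rw [pow_zero, one_smul]
    | succ n ih => rw [pow_succ, mul_smul, hself _ (Finset.mem_singleton_self _), ih]
  have hav : a ^ n • v = 0 := by
    rw [RepMod.smul_def, map_pow, hn]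
    rfl
  exact hw (by rw [← hpow n, ← map_smul, hav, map_zero])

theorem eq_zero_of_sum_mul_repTrace_eq_zero [Finite I] (hT : ∀ t, (toLinRep (T t)).IsSimple)
    (hne : ∀ s t, s ≠ t → ∀ X, IsHom (T s) (T t) X → X = 0) {c : Fin r → K}
    (hc : ∀ a, ∑ t, c t * repTrace (T t) a = 0) (t : Fin r) : c t = 0 := by
  have := (hT t).isSimpleModule
  obtain ⟨s, hs⟩ := exists_finset_repAct_eq (T t)
  obtain ⟨a, hself, hzero⟩ := exists_smul_eq_self_and_repAct_eq_zero
    (ι := {s : Fin r // s ≠ t}) (T := fun s => T s.1) (fun s => hT s.1) (W := RepMod (T t))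
    (fun s => forall_linearMap_eq_zero_iff.2 (hne t s.1 s.2.symm)) s
  have hone : repAct (T t) a = 1 := by
    rw [hs a 1 fun v hv => by rw [hself v hv, one_smul], map_one]
  have hsum := hc a
  rw [Finset.sum_eq_single t, repTrace, hone, LinearMap.trace_one] at hsum
  · have := IsSimpleModule.nontrivial (FreePathAlgebra K I) (RepMod (T t))
    have hpos : Module.finrank K (RepMod (T t)) ≠ 0 := Module.finrank_pos.ne'
    exact (mul_eq_zero.1 hsum).resolve_right (Nat.cast_ne_zero.2 hpos)
  · intro s _ hst
    rw [repTrace, hzero ⟨s, hst⟩, map_zero, mul_zero]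
  · exact fun h => absurd (Finset.mem_univ t) h

theorem exists_topFilt [Finite I] [IsAlgClosed K] (hT : ∀ t, (toLinRep (T t)).IsSimple)
    (hne : ∀ s t, s ≠ t → ∀ X, IsHom (T s) (T t) X → X = 0) (M : DRep K α) (c : Fin r → K)
    (htr : ∀ a, repTrace M a = ∑ t, c t * repTrace (T t) a) :
    ∃ l, TopFilt T l α M ∧ ∀ t, c t ≠ 0 → 0 < firstMult t l := by
  cases nonempty_fintype I
  induction hn : ∑ i, α i using Nat.strong_induction_on generalizing α M c with
  | _ n ih =>
  by_cases hα : ∀ i, α i = 0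
  · exact ⟨[], hα, fun t ht => absurd (eq_zero_of_sum_mul_repTrace_eq_zero hT hne
      (fun a => (htr a).symm.trans (repTrace_eq_zero hα a)) t) ht⟩
  push Not at hα
  obtain ⟨i, hi⟩ := hα
  obtain ⟨t, X, hX, hX0⟩ := exists_isHom_ne_zero hT ⟨i, Nat.pos_of_ne_zero hi⟩ htr
  obtain ⟨α', N, ⟨Y⟩⟩ := (hT t).exists_layer M
  set m := Module.finrank K (homSpace M (T t))
  have hm : 0 < m := Module.finrank_pos_iff_exists_ne_zero.2
    ⟨⟨X, mem_homSpace.2 hX⟩, fun h => hX0 (congrArg Subtype.val h)⟩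
  obtain ⟨l, hl, hfirst⟩ := ih _ (hn ▸ Y.sum_dim_lt hm (hT t).exists_pos) N
    (fun s => c s - if s = t then (m : K) else 0)
    (fun a => by
      rw [eq_sub_of_add_eq (Y.repTrace_eq a).symm, htr]
      simp [sub_mul, Finset.sum_sub_distrib, ite_mul]) rfl
  refine ⟨(t, m) :: l, ⟨hm, α', N, hl, ⟨Y⟩⟩, fun s hs => ?_⟩
  by_cases hst : t = s
  · simpa only [firstMult, if_pos hst] using hm
  · simp only [firstMult, if_neg hst]
    refine hfirst s ?_
    rwa [if_neg (Ne.symm hst), sub_zero]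

end Filtration

section Invariants

variable {I : Type u} [Quiver.{v} I] {K : Type w} [Field K] {α : I → ℕ}

theorem exists_isHom_of_iso_sumPow {r : ℕ} {k : Fin r → ℕ} {β : Fin r → I → ℕ} {y : DRep K α}
    {T : ∀ t, DRep K (β t)} (h : (toLinRep y).Iso (LinRep.sumPow k fun t => toLinRep (T t))) :
    ∃ (X : ∀ ts : Σ t, Fin (k t), VMat K (β ts.1) α) (Y : ∀ ts, VMat K α (β ts.1)),
      (∀ ts, IsHom y (T ts.1) (X ts)) ∧ (∀ ts i, X ts i * Y ts i = 1) ∧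
        ∀ i, ∑ ts, Y ts i * X ts i = 1 := by
  classical
  obtain ⟨f, hf⟩ := h
  let X (ts : Σ t, Fin (k t)) : VMat K (β ts.1) α := fun i => LinearMap.toMatrix'
    (LinearMap.proj ts.2 ∘ₗ LinearMap.proj (φ := fun t => Fin (k t) → Fin (β t i) → K) ts.1 ∘ₗ
      (f i).toLinearMap)
  let Y (ts : Σ t, Fin (k t)) : VMat K α (β ts.1) := fun i => LinearMap.toMatrix'
    ((f i).symm.toLinearMap ∘ₗ LinearMap.single K (fun t => Fin (k t) → Fin (β t i) → K) ts.1 ∘ₗ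
      LinearMap.single K (fun _ : Fin (k ts.1) => Fin (β ts.1 i) → K) ts.2)
  have hX (ts i v) : (X ts i).mulVec v = f i v ts.1 ts.2 := by
    rw [← Matrix.toLin'_apply, Matrix.toLin'_toMatrix']; rfl
  have hY (ts i v) : (Y ts i).mulVec v = (f i).symm (Pi.single ts.1 (Pi.single ts.2 v)) := by
    rw [← Matrix.toLin'_apply, Matrix.toLin'_toMatrix']; rfl
  refine ⟨X, Y, fun ts i j e => Matrix.mulVec_injective (funext fun v => ?_), fun ts i =>
    Matrix.mulVec_injective (funext fun v => ?_), fun i =>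
    Matrix.mulVec_injective (funext fun v => (f i).injective ?_)⟩
  · rw [← Matrix.mulVec_mulVec, ← Matrix.mulVec_mulVec, hX, hX]
    exact congrFun (congrFun (hf i j e v) ts.1) ts.2
  · rw [← Matrix.mulVec_mulVec, hX, hY, LinearEquiv.apply_symm_apply, Pi.single_eq_same,
      Pi.single_eq_same, Matrix.one_mulVec]
  · calc f i ((∑ ts, Y ts i * X ts i).mulVec v)
        = ∑ ts : Σ t, Fin (k t), Pi.single ts.1 (Pi.single ts.2 (f i v ts.1 ts.2)) := by
          simp only [Matrix.sum_mulVec, map_sum, ← Matrix.mulVec_mulVec, hX, hY,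
            LinearEquiv.apply_symm_apply]
      _ = ∑ t, Pi.single t (∑ s, Pi.single s (f i v t s)) := by
          rw [Fintype.sum_sigma]
          exact Finset.sum_congr rfl fun t _ => (map_sum (AddMonoidHom.single
            (fun t => Fin (k t) → Fin (β t i) → K) t) _ _).symm
      _ = f i ((1 : Matrix (Fin (α i)) (Fin (α i)) K).mulVec v) := by
          simp only [Finset.univ_sum_single, Matrix.one_mulVec]

theorem repTrace_eq_of_iso_sumPow [Finite I] {r : ℕ} {k : Fin r → ℕ} {β : Fin r → I → ℕ}
    {y : DRep K α} {T : ∀ t, DRep K (β t)}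
    (h : (toLinRep y).Iso (LinRep.sumPow k fun t => toLinRep (T t))) (a : FreePathAlgebra K I) :
    repTrace y a = ∑ t, (k t : K) * repTrace (T t) a := by
  obtain ⟨X, Y, hX, hXY, hsum⟩ := exists_isHom_of_iso_sumPow h
  rw [repTrace_eq_sum hX hXY hsum, Fintype.sum_sigma]
  simp

variable [Fintype I] [∀ i j : I, Fintype (i ⟶ j)]

theorem repAct_mem_coordRing (a : FreePathAlgebra K I) (v : zeroFibre K α → ∀ i, Fin (α i) → K)
    (hv : ∀ i b, (fun z => v z i b) ∈ coordRing K α) (i : I) (b : Fin (α i)) :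
    (fun z : zeroFibre K α => repAct z.1 a (v z) i b) ∈ coordRing K α := by
  classical
  induction a using FreeAlgebra.induction generalizing v i with
  | grade0 c =>
    simp only [AlgHom.commutes, Module.algebraMap_end_apply]
    exact (coordRing K α).smul_mem (hv i b) c
  | grade1 g =>
    rcases g with j | ⟨j, k, e⟩
    · simp only [repAct_vertex]
      obtain rfl | h := eq_or_ne i j
      · simpa only [Pi.single_eq_same] using hv i b
      · simp only [Pi.single_eq_of_ne h]
        exact (coordRing K α).zero_mem
    · simp only [repAct_arrow]
      obtain rfl | h := eq_or_ne i k
      · simp only [Pi.single_eq_same]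
        have hsum : (fun z : zeroFibre K α => (z.1 j i e).mulVec (v z j) b) =
            ∑ x, (fun z => coords z.1 ⟨j, i, e, b, x⟩) * fun z => v z j x := by
          funext z
          simp only [Finset.sum_apply]
          rfl
        rw [hsum]
        refine Subalgebra.sum_mem _ fun x _ => Subalgebra.mul_mem _ ?_ (hv j x)
        exact ⟨MvPolynomial.X ⟨j, i, e, b, x⟩, MvPolynomial.aeval_X _ _⟩
      · simp only [Pi.single_eq_of_ne h]
        exact (coordRing K α).zero_mem
  | mul a a' ha ha' =>
    simp only [map_mul, Module.End.mul_apply]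
    exact ha _ (ha' v hv) i b
  | add a a' ha ha' =>
    simp only [map_add, LinearMap.add_apply, Pi.add_apply]
    exact Subalgebra.add_mem _ (ha v hv i b) (ha' v hv i b)

theorem repTrace_mem_invRing (a : FreePathAlgebra K I) :
    (fun z : zeroFibre K α => repTrace z.1 a) ∈ invRing K α := by
  classical
  refine ⟨?_, fun g x y hxy => ?_⟩
  · have hsum : (fun z : zeroFibre K α => repTrace z.1 a) = ∑ c : Σ i, Fin (α i),
        fun z : zeroFibre K α => repAct z.1 a (Pi.single c.1 (Pi.single c.2 1)) c.1 c.2 := by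
      funext z
      rw [repTrace, LinearMap.trace_eq_matrix_trace K (Pi.basis fun i => Pi.basisFun K (Fin (α i))),
        Matrix.trace, Finset.sum_apply]
      refine Finset.sum_congr rfl fun c _ => ?_
      simp [LinearMap.toMatrix_apply, Pi.basis_repr, Pi.basis_apply]
    rw [hsum]
    refine Subalgebra.sum_mem _ fun c _ => repAct_mem_coordRing a _ (fun i b => ?_) c.1 c.2
    exact (coordRing K α).algebraMap_mem
      ((Pi.single c.1 (Pi.single c.2 1) : ∀ i, Fin (α i) → K) i b)
  · change repTrace y.1 a = repTrace x.1 a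
    rw [hxy]
    exact ((RepIso.ofConj g x.1).repTrace_eq a).symm

theorem repTrace_eq_of_quotMap_eq {y z : zeroFibre K α} (h : quotMap z = quotMap y)
    (a : FreePathAlgebra K I) : repTrace z.1 a = repTrace y.1 a :=
  DFunLike.congr_fun h ⟨_, repTrace_mem_invRing a⟩

theorem exists_topFilt_of_quotMap_eq [IsAlgClosed K] [CharZero K] {r : ℕ} {k : Fin r → ℕ}
    {β : Fin r → I → ℕ} {T : ∀ t, DRep K (β t)} {y z : zeroFibre K α} (hk : ∀ t, 0 < k t)
    (hT : ∀ t, (toLinRep (T t)).IsSimple)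
    (hne : ∀ s t, s ≠ t → ∀ X, IsHom (T s) (T t) X → X = 0)
    (hy : (toLinRep y.1).Iso (LinRep.sumPow k fun t => toLinRep (T t)))
    (h : quotMap z = quotMap y) : ∃ l, TopFilt T l α z.1 ∧ ∀ t, 0 < firstMult t l := by
  obtain ⟨l, hl, hfirst⟩ := exists_topFilt hT hne z.1 (fun t => (k t : K)) fun a => by
    rw [repTrace_eq_of_quotMap_eq h, repTrace_eq_of_iso_sumPow hy]
  exact ⟨l, hl, fun t => hfirst t (Nat.cast_ne_zero.2 (hk t).ne')⟩

end Invariants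

/-! ### The dimension bounds -/

section Finiteness

theorem finite_setOf_length_le_of_forall_mem {A : Type*} {s : Set A} (hs : s.Finite) (n : ℕ) :
    {l : List A | l.length ≤ n ∧ ∀ a ∈ l, a ∈ s}.Finite := by
  have := hs.to_subtype
  refine ((List.finite_length_le s n).image (List.map Subtype.val)).subset ?_
  rintro l ⟨hl, hmem⟩
  lift l to List s using hmem
  exact ⟨l, by simpa using hl, rfl⟩

variable {I : Type u} [Quiver.{v} I] {K : Type w} [Field K] {r : ℕ} {β : Fin r → I → ℕ}
  {l : List (Fin r × ℕ)}

theorem TopFilt.forall_pos {S : ∀ t, DRep K (β t)} {α : I → ℕ} {M : DRep K α}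
    (h : TopFilt S l α M) : ∀ a ∈ l, 0 < a.2 := by
  induction l generalizing α with
  | nil => simp
  | cons a l ih =>
    obtain ⟨hm, α', N, hN, -⟩ := h
    exact List.forall_mem_cons.2 ⟨hm, ih hN⟩

theorem TopFilt.sum_le [Fintype I] (hβ : ∀ t, ∃ i, 0 < β t i) {S : ∀ t, DRep K (β t)}
    {α : I → ℕ} {M : DRep K α} (h : TopFilt S l α M) : (l.map Prod.snd).sum ≤ ∑ i, α i := by
  induction l generalizing α with
  | nil => exact Nat.zero_le _
  | cons a l ih =>
    obtain ⟨-, α', N, hN, ⟨Y⟩⟩ := h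
    have hdim : ∑ i, α i = ∑ i, α' i + a.2 * ∑ i, β a.1 i := by
      rw [Finset.mul_sum, ← Finset.sum_add_distrib]
      exact Finset.sum_congr rfl fun i _ => Y.dim_eq i
    have hpos : 0 < ∑ i, β a.1 i :=
      (hβ a.1).elim fun i hi =>
        Finset.sum_pos' (fun _ _ => Nat.zero_le _) ⟨i, Finset.mem_univ i, hi⟩
    rw [List.map_cons, List.sum_cons, hdim, add_comm]
    exact Nat.add_le_add (ih hN) (Nat.le_mul_of_pos_right _ hpos)

theorem finite_setOf_topFilt [Finite I] (hβ : ∀ t, ∃ i, 0 < β t i) (α : I → ℕ) :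
    {l | ∃ (S : ∀ t, DRep K (β t)) (M : DRep K α), TopFilt S l α M}.Finite := by
  cases nonempty_fintype I
  refine (finite_setOf_length_le_of_forall_mem
    (Set.finite_univ.prod (Set.finite_Iic (∑ i, α i))) (∑ i, α i)).subset ?_
  rintro l ⟨S, M, h⟩
  have hsum := h.sum_le hβ
  have hlen := (l.map Prod.snd).length_le_sum_of_one_le
    (List.forall_mem_map.2 h.forall_pos)
  rw [List.length_map] at hlen
  exact ⟨hlen.trans hsum, fun a ha =>
    ⟨Set.mem_univ _, (List.le_sum_of_mem (List.mem_map_of_mem ha)).trans hsum⟩⟩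

theorem exists_eventually_topFilt [Finite I] {Ω : Type*} (U : Ultrafilter Ω) {α : I → ℕ}
    (hβ : ∀ t, ∃ i, 0 < β t i) {S : Ω → ∀ t, DRep K (β t)} {M : Ω → DRep K α}
    (h : ∀ ω, ∃ l, TopFilt (S ω) l α (M ω) ∧ ∀ t, 0 < firstMult t l) :
    ∃ l, (∀ᶠ ω in U, TopFilt (S ω) l α (M ω)) ∧ ∀ t, 0 < firstMult t l := by
  obtain ⟨l, -, hl⟩ := (U.eventually_exists_mem_iff (P := fun l ω => TopFilt (S ω) l α (M ω) ∧
    ∀ t, 0 < firstMult t l) (finite_setOf_topFilt (K := K) hβ α)).1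
    (Filter.Eventually.of_forall fun ω => (h ω).imp fun l hl => ⟨⟨S ω, M ω, hl.1⟩, hl⟩)
  obtain ⟨ω, hω⟩ := hl.exists
  exact ⟨l, hl.mono fun ω h => h.1, hω.2⟩

end Finiteness

section GenericConjugates

theorem eq_zero_of_forall_eval_ne_zero {σ R : Type*} [CommRing R] [IsDomain R] [Infinite R]
    {P D : MvPolynomial σ R} (hD : D ≠ 0)
    (h : ∀ x, MvPolynomial.eval x D ≠ 0 → MvPolynomial.eval x P = 0) : P = 0 := by
  refine (mul_eq_zero.1 (MvPolynomial.funext fun x => ?_ : P * D = 0)).resolve_right hD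
  by_cases hx : MvPolynomial.eval x D = 0
  · rw [map_mul, hx, mul_zero, map_zero]
  · rw [map_mul, h x hx, zero_mul, map_zero]

/-- The product of the determinants of a family of square matrices of indeterminates. -/
noncomputable def genericDet (L : Type*) [CommRing L] {τ I : Type*} [Fintype τ] [Fintype I]
    (β : τ → I → ℕ) : MvPolynomial (Σ t, VCoord (β t) (β t)) L :=
  ∏ t, ∏ i, MvPolynomial.rename (fun ab => ⟨t, i, ab⟩)
    (Matrix.mvPolynomialX (Fin (β t i)) (Fin (β t i)) L).det

theorem genericDet_ne_zero (L : Type*) [CommRing L] [IsDomain L] {τ I : Type*} [Fintype τ]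
    [Fintype I] (β : τ → I → ℕ) : genericDet L β ≠ 0 := by
  refine Finset.prod_ne_zero_iff.2 fun t _ => Finset.prod_ne_zero_iff.2 fun i _ => ?_
  refine (map_ne_zero_iff _ (MvPolynomial.rename_injective _ fun _ _ h => ?_)).2
    (Matrix.det_mvPolynomialX_ne_zero _ L)
  simpa using h

theorem eval_genericDet {L : Type*} [CommRing L] {τ I : Type*} [Fintype τ] [Fintype I]
    {β : τ → I → ℕ} (x : (Σ t, VCoord (β t) (β t)) → L) :
    MvPolynomial.eval x (genericDet L β) =
      ∏ t, ∏ i, Matrix.det (Matrix.of fun a b : Fin (β t i) => x ⟨t, i, a, b⟩) := by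
  simp only [genericDet, map_prod, MvPolynomial.eval_rename]
  refine Finset.prod_congr rfl fun t _ => Finset.prod_congr rfl fun i _ => ?_
  rw [RingHom.map_det]
  congr 1
  ext a b
  simp

theorem algebraicIndependent_entries_gl {I : Type u} [Finite I] (L : Type w) [Field L] [Infinite L]
    {τ : Type*} [Finite τ] (β : τ → I → ℕ) :
    AlgebraicIndependent L fun (c : Σ t, VCoord (β t) (β t)) (ω : ∀ t, GLProd L (β t)) =>
      VMat.entries (fun i => (ω c.1 i).1) c.2 := by
  cases nonempty_fintype I
  cases nonempty_fintype τ
  refine (injective_iff_map_eq_zero _).2 fun P hP =>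
    eq_zero_of_forall_eval_ne_zero (genericDet_ne_zero L β) fun x hx => ?_
  simp only [eval_genericDet, Finset.prod_ne_zero_iff, Finset.mem_univ, true_imp_iff] at hx
  let g (t) : GLProd L (β t) := fun i =>
    Matrix.GeneralLinearGroup.mk'' _ (isUnit_iff_ne_zero.2 (hx t i))
  have heval : MvPolynomial.aeval (fun (c : Σ t, VCoord (β t) (β t)) (ω : ∀ t, GLProd L (β t)) =>
      VMat.entries (fun i => (ω c.1 i).1) c.2) P g = MvPolynomial.aeval x P :=
    MvPolynomial.comp_aeval_apply _ (Pi.evalAlgHom L (fun _ : ∀ t, GLProd L (β t) => L) g) P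
  rw [← MvPolynomial.aeval_eq_eval, ← heval]
  exact congrFun hP g

theorem trdegAdjoin_add_card_le_of_union_range_le {K L L' : Type*} [Field K] [Field L] [Field L']
    [Algebra K L] [Algebra K L'] [Algebra L L'] [IsScalarTower K L L'] {A B B' : Set L'}
    (hA : A.Finite) (hB : B.Finite) (hAB : A ∪ B ⊆ Set.range (algebraMap L L')) {J : Type*}
    [Fintype J] {y : J → L'} (hy : AlgebraicIndependent L y) {c : ℕ}
    (hc : trdegAdjoin K (A ∪ B ∪ B' ∪ Set.range y) ≤ trdegAdjoin K (A ∪ B ∪ B') + c) :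
    trdegAdjoin K A + Fintype.card J ≤ trdegAdjoin K (A ∪ B') + c := by
  have hgeneric : trdegAdjoin K (A ∪ B) + Fintype.card J ≤ trdegAdjoin K (A ∪ B ∪ B') + c :=
    (trdegAdjoin_add_card_le hy hAB).trans ((Matroid.eRk_mono _
      (Set.union_subset_union_left _ Set.subset_union_left)).trans hc)
  have hsubmodular : trdegAdjoin K A + trdegAdjoin K (A ∪ B ∪ B') ≤
      trdegAdjoin K (A ∪ B) + trdegAdjoin K (A ∪ B') := by
    refine le_trans ?_ (Matroid.eRk_inter_add_eRk_union_le _ (A ∪ B) (A ∪ B'))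
    rw [← Set.union_inter_distrib_left, ← Set.union_union_distrib_left, ← Set.union_assoc]
    exact add_le_add_left (Matroid.eRk_mono _ Set.subset_union_left) _
  refine (ENat.add_le_add_iff_left (trdegAdjoin_ne_top_of_finite (K := K) (hA.union hB))).1 ?_
  calc trdegAdjoin K (A ∪ B) + (trdegAdjoin K A + Fintype.card J)
      = trdegAdjoin K A + (trdegAdjoin K (A ∪ B) + Fintype.card J) := add_left_comm _ _ _
    _ ≤ trdegAdjoin K A + (trdegAdjoin K (A ∪ B ∪ B') + c) := by gcongr
    _ = trdegAdjoin K A + trdegAdjoin K (A ∪ B ∪ B') + c := (add_assoc _ _ _).symm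
    _ ≤ trdegAdjoin K (A ∪ B) + trdegAdjoin K (A ∪ B') + c := by gcongr
    _ = trdegAdjoin K (A ∪ B) + (trdegAdjoin K (A ∪ B') + c) := add_assoc _ _ _

variable {I : Type u} [Fintype I] [Quiver.{v} I] [∀ i j : I, Fintype (i ⟶ j)]

theorem trdegAdjoin_union_repIso_le (K : Type*) {L : Type*} [Field K] [Field L] [Algebra K L]
    {τ : Type*} [Fintype τ] {β : τ → I → ℕ} {S S' : ∀ t, DRep L (β t)} (hS : ∀ t, IsBrick (S t))
    (f : ∀ t, RepIso (S t) (S' t)) (X : Set L) (hSX : ⋃ t, Set.range (RArr.entries (S t)) ⊆ X)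
    (hSX' : ⋃ t, Set.range (RArr.entries (S' t)) ⊆ X) :
    trdegAdjoin K (X ∪ ⋃ t, Set.range (VMat.entries (f t).hom)) ≤
      trdegAdjoin K X + Fintype.card τ := by
  rw [← Finset.card_univ, Finset.card_eq_sum_ones]
  refine trdegAdjoin_union_iUnion_le X _ _ fun t X' hX => (trdegAdjoin_union_isHom_le X'
    ((Set.iUnion_subset_iff.1 hSX t).trans hX) ((Set.iUnion_subset_iff.1 hSX' t).trans hX)
    (f t).isHom_hom).trans ?_
  gcongr
  exact (hS t).finrank_homSpace_le_one (f t)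

/-- Conjugating the bricks by generic elements `g t` loses none of the parameters of `M`:
the entries of the `g t` are recovered, up to one scalar each, from the bricks and their conjugates,
so the conjugates carry almost `∑ t, β t · β t` parameters independent of those of `M`. -/
theorem TopFilt.exists_generic_conj {K : Type*} {L : Type w} [Field K] [Field L] [Algebra K L]
    [Infinite L] {r : ℕ} {β : Fin r → I → ℕ} {S : ∀ t, DRep L (β t)} (hS : OrthBricks S)
    {l : List (Fin r × ℕ)} {α : I → ℕ} {M : DRep L α} (h : TopFilt S l α M)
    (hM : ∀ i, moment M i = 0) :
    ∃ (L' : Type (max u w)) (_ : Field L') (_ : Algebra K L') (S' : ∀ t, DRep L' (β t))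
      (M' : DRep L' α), OrthBricks S' ∧ TopFilt S' l α M' ∧ (∀ i, moment M' i = 0) ∧
        trdegAdjoin K (Set.range (RArr.entries M)) + (∑ t, vertDim (β t) (β t) : ℕ) ≤
          trdegAdjoin K ((⋃ t, Set.range (RArr.entries (S' t))) ∪ Set.range (RArr.entries M')) +
            r := by
  obtain ⟨U, L', instField, _, π, hπ, hind⟩ :=
    exists_isUltrapower_algebraicIndependent (algebraicIndependent_entries_gl L β)
  let instAlgebra : Algebra K L' := ((algebraMap L L').comp (algebraMap K L)).toAlgebra
  have : IsScalarTower K L L' := IsScalarTower.of_algebraMap_eq' rfl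
  let S₀ (t) : DRep L' (β t) := arrGerm π fun _ => S t
  let S' (t) : DRep L' (β t) := arrGerm π fun ω => conj (ω t) (S t)
  let M' : DRep L' α := arrGerm π fun _ => M
  let g (t) : RepIso (S₀ t) (S' t) := RepIso.germ π fun ω => RepIso.ofConj (ω t) (S t)
  have hS₀ : OrthBricks S₀ := hπ.orthBricks fun _ => hS
  refine ⟨L', instField, instAlgebra, S', M',
    hπ.orthBricks fun ω => hS.congr fun t => RepIso.ofConj (ω t) (S t),
    hπ.topFilt_of_forall fun ω => h.congrQuotients fun t => RepIso.ofConj (ω t) (S t),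
    moment_arrGerm π fun _ => hM, ?_⟩
  have hg : ⋃ t, Set.range (VMat.entries (g t).hom) =
      Set.range fun c : Σ t, VCoord (β t) (β t) => π fun ω : ∀ t, GLProd L (β t) =>
        VMat.entries (fun i => (ω c.1 i).1) c.2 := by
    ext x
    simp only [Set.mem_iUnion, Set.mem_range, Sigma.exists]
    rfl
  have hentries : Set.range (RArr.entries M') = algebraMap L L' '' Set.range (RArr.entries M) := by
    rw [← Set.range_comp]
    exact congrArg Set.range (funext fun c => π.commutes _)
  have hcount := trdegAdjoin_add_card_le_of_union_range_le (K := K)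
    (A := Set.range (RArr.entries M')) (B := ⋃ t, Set.range (RArr.entries (S₀ t)))
    (B' := ⋃ t, Set.range (RArr.entries (S' t))) (c := Fintype.card (Fin r)) (Set.finite_range _)
    (Set.finite_iUnion fun t => Set.finite_range _)
    (Set.union_subset (range_entries_arrGerm_const_subset M)
      (Set.iUnion_subset fun t => range_entries_arrGerm_const_subset (S t))) hind
    (hg ▸ trdegAdjoin_union_repIso_le K hS₀.isBrick g _
      (Set.subset_union_right.trans Set.subset_union_left) Set.subset_union_right)
  rw [Fintype.card_sigma, Fintype.card_fin, Set.union_comm] at hcount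
  simp only [card_vCoord] at hcount
  exact le_trans (by rw [hentries]; gcongr; exact trdegAdjoin_le_image_algebraMap _) hcount

variable {r : ℕ} {β : Fin r → I → ℕ}

theorem exists_trdegAdjoin_iUnion_le (K : Type*) {L : Type*} [Field K] [Field L] [Algebra K L]
    {S : ∀ t, DRep L (β t)} (hS : ∀ t, IsBrick (S t)) :
    ∃ d : ℕ, trdegAdjoin K (⋃ t, Set.range (RArr.entries (S t))) ≤ d ∧
      (d : ℤ) ≤ ∑ t, (2 * p (β t) + vertDim (β t) (β t) - 1) := by
  refine ⟨∑ t, Module.finrank L (LinearMap.ker (dMoment (S t) (S t))), ?_, ?_⟩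
  · have h := trdegAdjoin_union_iUnion_le (K := K) ∅ _ _ fun t X _ =>
      trdegAdjoin_union_moment_le (K := K) X (S t) (hS t).moment_eq
    rwa [Set.empty_union, trdegAdjoin_eq_zero_of_subset_range (Set.empty_subset _), zero_add] at h
  · push_cast
    refine Finset.sum_le_sum fun t _ => ?_
    rw [← dotSelf_eq_vertDim]
    exact (hS t).finrank_ker_dMoment_le

theorem TopFilt.le_of_le_trdegAdjoin {K : Type*} {L : Type w} [Field K] [Field L] [Algebra K L]
    [CharZero K] {S : ∀ t, DRep L (β t)} (hS : OrthBricks S) {l : List (Fin r × ℕ)} {α : I → ℕ}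
    {M : DRep L α} (h : TopFilt S l α M) (hl : ∀ t, 0 < firstMult t l)
    (hM : ∀ i, moment M i = 0) {n : ℕ}
    (hn : (n : ℕ∞) ≤ trdegAdjoin K (Set.range (RArr.entries M))) :
    (n : ℤ) ≤ dotSelf α - 1 + p α + ∑ t, p (β t) := by
  have : CharZero L := charZero_of_injective_algebraMap (algebraMap K L).injective
  obtain ⟨L', _, _, S', M', hS', h', hM', hgeneric⟩ := h.exists_generic_conj (K := K) hS hM
  obtain ⟨b, hb, hb'⟩ := exists_trdegAdjoin_iUnion_le K hS'.isBrick
  obtain ⟨d, hd, hd'⟩ := h'.trdegAdjoin_le (K := K) hS'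
    (Set.subset_iUnion fun t => Set.range (RArr.entries (S' t))) hl hM'
  have hle : (n + (∑ t, vertDim (β t) (β t) : ℕ) : ℕ∞) ≤ b + d + r :=
    (add_le_add_left hn _).trans (hgeneric.trans (add_le_add_left (hd.trans (by gcongr)) _))
  have hle' : (n : ℤ) + ∑ t, (vertDim (β t) (β t) : ℤ) ≤ b + d + r := by exact_mod_cast hle
  rw [Finset.sum_sub_distrib, Finset.sum_add_distrib, ← Finset.mul_sum, Finset.sum_const,
    Finset.card_univ, Fintype.card_fin, nsmul_one] at hb'
  linarith

end GenericConjugates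

section Dimension

variable {K : Type w} [Field K] [IsAlgClosed K] [CharZero K] {I : Type u} [Fintype I]
  [Quiver.{v} I] [∀ i j : I, Fintype (i ⟶ j)] {α : I → ℕ} {r : ℕ} {k : Fin r → ℕ}
  {β : Fin r → I → ℕ}

theorem dimLE_preimage_singleton {x : NQ K α} (hx : x ∈ stratum α k β) :
    DimLE (preimage {x}) (dotSelf α - 1 + p α - ∑ t, p (β t)) := by
  intro n hn
  obtain ⟨y, rfl, hk, T, hT0, hT, hne, hy⟩ := hx
  obtain ⟨U, L, _, _, π, hπ, hrk⟩ := exists_isUltrapower_of_le_dim hn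
  have hS := orthBricks_of_isSimple hT0 hT hne
  have hpt : ∀ s : preimage {quotMap y}, (∀ i, moment s.1 i = 0) ∧
      ∃ l, TopFilt T l α s.1 ∧ ∀ t, 0 < firstMult t l := by
    rintro ⟨_, z, hz, rfl⟩
    exact ⟨z.2, exists_topFilt_of_quotMap_eq hk hT hS.hom_ne hy hz⟩
  obtain ⟨l, hl, hfirst⟩ := exists_eventually_topFilt U (fun t => (hS.isBrick t).exists_pos)
    fun s => (hpt s).2
  let X := ⋃ t, Set.range (RArr.entries (arrGerm π fun _ => T t))
  have hX : trdegAdjoin K X = 0 := trdegAdjoin_eq_zero_of_subset_range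
    (Set.iUnion_subset fun t => range_entries_arrGerm_const_subset (T t))
  obtain ⟨d, hd, hd'⟩ := (hπ.topFilt hl).trdegAdjoin_le (K := K) (hπ.orthBricks fun _ => hS)
    (Set.subset_iUnion _ : ∀ t, _ ⊆ X) hfirst (moment_arrGerm π fun s => (hpt s).1)
  rw [hX, zero_add] at hd
  have hnd : n ≤ d := by
    exact_mod_cast (hrk.trans (Matroid.eRk_mono _ Set.subset_union_right)).trans hd
  omega

theorem dimLE_preimage_stratum :
    DimLE (preimage (stratum (K := K) α k β)) (dotSelf α - 1 + p α + ∑ t, p (β t)) := by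
  intro n hn
  obtain ⟨U, L, _, _, π, hπ, hrk⟩ := exists_isUltrapower_of_le_dim hn
  have hpt : ∀ s : preimage (stratum (K := K) α k β), ∃ T : ∀ t, DRep K (β t), OrthBricks T ∧
      (∀ i, moment s.1 i = 0) ∧ ∃ l, TopFilt T l α s.1 ∧ ∀ t, 0 < firstMult t l := by
    rintro ⟨_, z, ⟨y, hz, hk, T, hT0, hT, hne, hy⟩, rfl⟩
    have hS := orthBricks_of_isSimple hT0 hT hne
    exact ⟨T, hS, z.2, exists_topFilt_of_quotMap_eq hk hT hS.hom_ne hy hz.symm⟩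
  choose T hS hM hfilt using hpt
  obtain ⟨s₀⟩ := U.neBot.nonempty
  obtain ⟨l, hl, hfirst⟩ :=
    exists_eventually_topFilt U (fun t => ((hS s₀).isBrick t).exists_pos) hfilt
  exact (hπ.topFilt hl).le_of_le_trdegAdjoin (K := K) (hπ.orthBricks hS) hfirst
    (moment_arrGerm π hM) hrk

end Dimension

end QuiverReduction

theorem theorem6p3 {K : Type w} [Field K] [IsAlgClosed K] [CharZero K]
    {I : Type u} [Fintype I] [Quiver.{v} I] [∀ i j : I, Fintype (i ⟶ j)]
    (α : I → ℕ) {r : ℕ} (k : Fin r → ℕ) (β : Fin r → I → ℕ) :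
    (∀ x : QuiverReduction.NQ K α, x ∈ QuiverReduction.stratum α k β →
      QuiverReduction.DimLE (QuiverReduction.preimage {x})
        (QuiverReduction.dotSelf α - 1 + QuiverReduction.p α
          - ∑ t, QuiverReduction.p (β t))) ∧
    QuiverReduction.DimLE
      (QuiverReduction.preimage (QuiverReduction.stratum (K := K) α k β))
      (QuiverReduction.dotSelf α - 1 + QuiverReduction.p α
        + ∑ t, QuiverReduction.p (β t)) :=
  ⟨fun _ hx => QuiverReduction.dimLE_preimage_singleton hx,
    QuiverReduction.dimLE_preimage_stratum⟩
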